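/- Let $c\in\mathbb N$ be a constant. There is a randomized dynamic streaming algorithm $\mathcal A$ (a fixed word-RAM program for setup, one for an update, one for a query) and constants $W,C,p$, all depending only on $c$, such that the following holds for all integers $n\ge 2$, $1\le k\le n$ and all $\delta\in(0,1)$, where $\mathcal A$ is given $n$, $k$ and $\lceil 1/\delta\rceil$ and runs on words of $W\lceil\log_2(n/\delta)\rceil$ bits. Let $S$ be any sequence of at most $n^c$ insertions and deletions of edges on the vertex set $\{0,\dots,n-1\}$, starting from the empty graph, in which only absent edges (no loops) are inserted and only present edges are deleted; $S$ is fixed before the random choices of $\mathcal A$ are made (oblivious adversary). Suppose we are promised that at every time $i\in\{0,\dots,|S|\}$ the current graph has an inclusion-maximal matching of size at most $k$. Then $\mathcal A$ processes $S$ in one pass and, for every outcome of its random choices, * uses at most $C\,k^2\log_2^p(n/\delta)$ bits of space, * takes at most $C\,k\log_2^p(n/\delta)$ steps for each single update (and for the setup), and * at every time answers a query for the matching in at most $C\,k\log_2^p(n/\delta)$ steps, without changing its memory. With probability at least $1-\delta/n^c$, the answers at all times $i$ simultaneously are correct: each lists the edges of a maximal matching of the graph at time $i$. In particular (space $\tilde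 O(k^2)$, worst-case update and query time $\tilde O(k)$), for $k=\tilde O(\sqrt n)$ the same algorithm uses space $\tilde O(n)$ and has worst-case update and query times $\tilde O(\sqrt n)$: for all $a\in\mathbb R$, $q\in\mathbb N$ there are constants $C',p'$ such that, whenever moreover $k\le a\sqrt n\,\log_2^q n$, the space is at most $C' n\log_2^{p'}(n/\delta)$ bits and the time of each update and each query is at most $C'\sqrt n\,\log_2^{p'}(n/\delta)$. -/

import Mathlib

/-! ## A randomized word RAM with a step count -/

namespace WordRAM

/-- The arithmetic of the machine.  Subtraction is truncated at `0`; division and remainder by `0`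
return `0` and the dividend.  A comparison returns `1` or `0`. -/
inductive BinOp
  | add | sub | mul | div | mod | eq | lt | and | or | xor | shl | shr

/-- The exact value of an operation, before it is cut down to a word. -/
def BinOp.val : BinOp → ℕ → ℕ → ℕ
  | .add, a, b => a + b
  | .sub, a, b => a - b
  | .mul, a, b => a * b
  | .div, a, b => a / b
  | .mod, a, b => a % b
  | .eq, a, b => if a = b then 1 else 0
  | .lt, a, b => if a < b then 1 else 0
  | .and, a, b => a &&& b
  | .or, a, b => a ||| b
  | .xor, a, b => a ^^^ b
  | .shl, a, b => a <<< b
  | .shr, a, b => a >>> b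

/-- Expressions over the registers. -/
inductive Expr
  | const (a : ℕ)
  | reg (i : ℕ)
  | bin (o : BinOp) (e f : Expr)

/-- Value of an expression on a machine with `w`-bit words: every intermediate result is reduced
modulo `2 ^ w`. -/
def Expr.eval (w : ℕ) (ρ : ℕ → ℕ) : Expr → ℕ
  | .const a => a % 2 ^ w
  | .reg i => ρ i
  | .bin o e f => o.val (e.eval w ρ) (f.eval w ρ) % 2 ^ w

/-- Programs.  `load i e` reads the memory cell whose address is the value of `e` into register
`i`, `store e f` writes the value of `f` to the cell with address `e`, `rand i` puts a fresh
uniformly random word into register `i`, `emit e` writes to the output. -/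
inductive Cmd
  | set (i : ℕ) (e : Expr)
  | load (i : ℕ) (e : Expr)
  | store (e f : Expr)
  | rand (i : ℕ)
  | emit (e : Expr)
  | skip
  | seq (a b : Cmd)
  | cond (e : Expr) (a b : Cmd)
  | loop (e : Expr) (a : Cmd)

/-- Number of registers that an expression needs (one more than the largest index). -/
def Expr.numRegs : Expr → ℕ
  | .const _ => 0
  | .reg i => i + 1
  | .bin _ e f => max e.numRegs f.numRegs

/-- Number of registers that a program needs. -/
def Cmd.numRegs : Cmd → ℕ
  | .set i e => max (i + 1) e.numRegs
  | .load i e => max (i + 1) e.numRegs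
  | .store e f => max e.numRegs f.numRegs
  | .rand i => i + 1
  | .emit e => e.numRegs
  | .skip => 0
  | .seq a b => max a.numRegs b.numRegs
  | .cond e a b => max e.numRegs (max a.numRegs b.numRegs)
  | .loop e a => max e.numRegs a.numRegs

/-- Configuration of the machine: registers, memory, number of random words consumed so far, and
the output written so far. -/
structure Config where
  regs : ℕ → ℕ
  mem : ℕ → ℕ
  pos : ℕ
  out : List ℕ

/-- `Exec w s ω a σ t τ`: on a machine with `w`-bit words, a memory of `s` words (addresses
`0, …, s - 1`) and the sequence `ω` of random words, the program `a` started in `σ` halts in `τ`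
after `t` steps.  An access outside the memory has no execution.  Each elementary command and each
test of a condition is one step; the expressions in it have a size fixed by the program. -/
inductive Exec (w s : ℕ) (ω : ℕ → Fin (2 ^ w)) : Cmd → Config → ℕ → Config → Prop
  | set (i : ℕ) (e : Expr) (σ : Config) :
      Exec w s ω (.set i e) σ 1 { σ with regs := Function.update σ.regs i (e.eval w σ.regs) }
  | load (i : ℕ) (e : Expr) (σ : Config) (h : e.eval w σ.regs < s) :
      Exec w s ω (.load i e) σ 1
        { σ with regs := Function.update σ.regs i (σ.mem (e.eval w σ.regs)) }
  | store (e f : Expr) (σ : Config) (h : e.eval w σ.regs < s) :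
      Exec w s ω (.store e f) σ 1
        { σ with mem := Function.update σ.mem (e.eval w σ.regs) (f.eval w σ.regs) }
  | rand (i : ℕ) (σ : Config) :
      Exec w s ω (.rand i) σ 1
        { σ with regs := Function.update σ.regs i (ω σ.pos : ℕ), pos := σ.pos + 1 }
  | emit (e : Expr) (σ : Config) :
      Exec w s ω (.emit e) σ 1 { σ with out := σ.out ++ [e.eval w σ.regs] }
  | skip (σ : Config) : Exec w s ω .skip σ 1 σ
  | seq {a b : Cmd} {σ₀ σ₁ σ₂ : Config} {t₁ t₂ : ℕ} (h₁ : Exec w s ω a σ₀ t₁ σ₁)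
      (h₂ : Exec w s ω b σ₁ t₂ σ₂) : Exec w s ω (.seq a b) σ₀ (t₁ + t₂) σ₂
  | condTrue {e : Expr} {a b : Cmd} {σ₀ σ₁ : Config} {t : ℕ} (he : e.eval w σ₀.regs ≠ 0)
      (h : Exec w s ω a σ₀ t σ₁) : Exec w s ω (.cond e a b) σ₀ (t + 1) σ₁
  | condFalse {e : Expr} {a b : Cmd} {σ₀ σ₁ : Config} {t : ℕ} (he : e.eval w σ₀.regs = 0)
      (h : Exec w s ω b σ₀ t σ₁) : Exec w s ω (.cond e a b) σ₀ (t + 1) σ₁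
  | loopDone {e : Expr} {a : Cmd} {σ : Config} (he : e.eval w σ.regs = 0) :
      Exec w s ω (.loop e a) σ 1 σ
  | loopStep {e : Expr} {a : Cmd} {σ₀ σ₁ σ₂ : Config} {t₁ t₂ : ℕ} (he : e.eval w σ₀.regs ≠ 0)
      (h₁ : Exec w s ω a σ₀ t₁ σ₁) (h₂ : Exec w s ω (.loop e a) σ₁ t₂ σ₂) :
      Exec w s ω (.loop e a) σ₀ (t₁ + t₂ + 1) σ₂

/-- The machine is deterministic once the random words are fixed. -/
theorem Exec.deterministic {w s : ℕ} {ω : ℕ → Fin (2 ^ w)} {a : Cmd} {σ τ τ' : Config}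
    {t t' : ℕ} (h : Exec w s ω a σ t τ) (h' : Exec w s ω a σ t' τ') : t = t' ∧ τ = τ' := by
  induction h generalizing t' τ' with
  | set | load | store | rand | emit | skip => cases h'; exact ⟨rfl, rfl⟩
  | seq _ _ ih₁ ih₂ =>
    cases h' with
    | seq k₁ k₂ =>
      obtain ⟨rfl, rfl⟩ := ih₁ k₁
      obtain ⟨rfl, rfl⟩ := ih₂ k₂
      exact ⟨rfl, rfl⟩
  | condTrue he _ ih =>
    cases h' with
    | condTrue _ k => obtain ⟨rfl, rfl⟩ := ih k; exact ⟨rfl, rfl⟩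
    | condFalse he' _ => exact absurd he' he
  | condFalse he _ ih =>
    cases h' with
    | condTrue he' _ => exact absurd he he'
    | condFalse _ k => obtain ⟨rfl, rfl⟩ := ih k; exact ⟨rfl, rfl⟩
  | loopDone he =>
    cases h' with
    | loopDone _ => exact ⟨rfl, rfl⟩
    | loopStep he' _ _ => exact absurd he he'
  | loopStep he _ _ ih₁ ih₂ =>
    cases h' with
    | loopDone he' => exact absurd he' he
    | loopStep _ k₁ k₂ =>
      obtain ⟨rfl, rfl⟩ := ih₁ k₁
      obtain ⟨rfl, rfl⟩ := ih₂ k₂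
      exact ⟨rfl, rfl⟩

/-- Start of a procedure: the arguments are put into the registers `0, 1, …`, all other registers
are cleared and the output is emptied; memory and random source are kept. -/
def Config.call (w : ℕ) (σ : Config) (args : List ℕ) : Config :=
  { σ with regs := fun i => args.getD i 0 % 2 ^ w, out := [] }

/-- The machine before anything has happened, with cleared memory. -/
def Config.blank : Config := ⟨fun _ => 0, fun _ => 0, 0, []⟩

/-- The law of the random source: independent uniform `w`-bit words. -/
noncomputable def coins (w : ℕ) : MeasureTheory.Measure (ℕ → Fin (2 ^ w)) :=
  MeasureTheory.Measure.infinitePi fun _ : ℕ => (PMF.uniformOfFintype (Fin (2 ^ w))).toMeasure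

end WordRAM

/-! ## Dynamic graph streams and maximal matchings -/

namespace DynStream

/-- An update of a graph with vertex set `{0, …, n - 1}`. -/
inductive Update (n : ℕ)
  | insert (u v : Fin n)
  | delete (u v : Fin n)

/-- Effect of an update on the edge set. -/
def Update.apply {n : ℕ} (E : Finset (Sym2 (Fin n))) : Update n → Finset (Sym2 (Fin n))
  | .insert u v => Insert.insert s(u, v) E
  | .delete u v => E.erase s(u, v)

/-- Only an absent edge (no loop) may be inserted, only a present edge may be deleted. -/
def Update.Admissible {n : ℕ} (E : Finset (Sym2 (Fin n))) : Update n → Prop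
  | .insert u v => u ≠ v ∧ s(u, v) ∉ E
  | .delete u v => s(u, v) ∈ E

/-- The edge set after a sequence of updates of the empty graph. -/
def edges {n : ℕ} (S : List (Update n)) : Finset (Sym2 (Fin n)) :=
  S.foldl Update.apply ∅

/-- Dynamic graph streams; the edge set at time `i` is `edges (S.take i)`. -/
def IsStream {n : ℕ} (S : List (Update n)) : Prop :=
  ∀ (i : ℕ) (h : i < S.length), S[i].Admissible (edges (S.take i))

/-- `M` is a set of edges from `E`, no two of which share a vertex. -/
def IsMatching {n : ℕ} (E M : Finset (Sym2 (Fin n))) : Prop :=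
  M ⊆ E ∧ ∀ e ∈ M, ∀ f ∈ M, ∀ v, v ∈ e → v ∈ f → e = f

/-- Matchings that are maximal under inclusion. -/
def IsMaximalMatching {n : ℕ} (E M : Finset (Sym2 (Fin n))) : Prop :=
  Maximal (IsMatching E) M

/-- The promise: at every time there is a maximal matching of size at most `k`. -/
def Promise {n : ℕ} (k : ℕ) (S : List (Update n)) : Prop :=
  ∀ i ≤ S.length, ∃ M, IsMaximalMatching (edges (S.take i)) M ∧ M.card ≤ k

/-- The output `u₁, v₁, u₂, v₂, …` lists, without repetition, the edges `u₁v₁, u₂v₂, …` of a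
maximal matching of the graph with edge set `E`. -/
def ListsMaximalMatching {n : ℕ} (E : Finset (Sym2 (Fin n))) (out : List ℕ) : Prop :=
  ∃ L : List (Fin n × Fin n),
    out = L.flatMap (fun p => [(p.1 : ℕ), (p.2 : ℕ)]) ∧
    (L.map fun p => s(p.1, p.2)).Nodup ∧
    IsMaximalMatching E (L.map fun p => s(p.1, p.2)).toFinset

/-! ## Dynamic streaming algorithms -/

open WordRAM

/-- A dynamic algorithm consists of three programs: one for the preparation before the stream
starts, one that processes an update, and one that answers a query for the matching. -/
structure Algorithm where
  setup : Cmd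
  update : Cmd
  query : Cmd

/-- Number of registers of the algorithm (at least four, which carry the arguments). -/
def Algorithm.numRegs (A : Algorithm) : ℕ :=
  max 4 (max A.setup.numRegs (max A.update.numRegs A.query.numRegs))

/-- The arguments handed to the update program: `0, u, v` for an insertion and `1, u, v` for a
deletion of the edge `uv`. -/
def Update.args {n : ℕ} : Update n → List ℕ
  | .insert u v => [0, u, v]
  | .delete u v => [1, u, v]

/-- `σ i` is the configuration of the algorithm at time `i` of the stream `S`.  The setup program
gets `params`.  The setup and each single update take at most `T` steps. -/
def IsRun (A : Algorithm) {n : ℕ} (w s : ℕ) (ω : ℕ → Fin (2 ^ w)) (params : List ℕ)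
    (S : List (Update n)) (T : ℝ) (σ : ℕ → Config) : Prop :=
  (∃ t : ℕ, (t : ℝ) ≤ T ∧ Exec w s ω A.setup (Config.blank.call w params) t (σ 0)) ∧
  ∀ (i : ℕ) (h : i < S.length),
    ∃ t : ℕ, (t : ℝ) ≤ T ∧ Exec w s ω A.update ((σ i).call w S[i].args) t (σ (i + 1))

/-- In configuration `σ` the query program halts within `Q` steps with output `out`; it leaves the
memory and the random source as they were, so that queries may be asked at any time and any number
of times. -/
def Answers (A : Algorithm) (w s : ℕ) (ω : ℕ → Fin (2 ^ w)) (Q : ℝ) (σ : Config)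
    (out : List ℕ) : Prop :=
  ∃ (t : ℕ) (τ : Config), (t : ℝ) ≤ Q ∧ Exec w s ω A.query (σ.call w []) t τ ∧
    τ.mem = σ.mem ∧ τ.pos = σ.pos ∧ τ.out = out

/-- On graphs with `n` vertices, under the promise with parameter `k`, on machines with `w`-bit
words, the algorithm `A` maintains a maximal matching in at most `B` bits of space, with update
time at most `T` and query time at most `Q`.  The bounds hold for every stream of length at most
`n ^ c` that satisfies the promise and every outcome of the random choices.  The stream is fixed
before the random choices are made, and with probability at least `1 - δ / n ^ c` the answers at
all times of the stream are correct. -/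
def Maintains (A : Algorithm) (c n k : ℕ) (δ : ℝ) (w : ℕ) (B T Q : ℝ) : Prop :=
  ∃ s : ℕ, (((s + A.numRegs) * w : ℕ) : ℝ) ≤ B ∧
    ∀ S : List (Update n), IsStream S → S.length ≤ n ^ c → Promise k S →
      (∀ ω : ℕ → Fin (2 ^ w), ∃ σ : ℕ → Config,
        IsRun A w s ω [n, k, ⌈1 / δ⌉₊, w] S T σ ∧
        ∀ i ≤ S.length, ∃ out, Answers A w s ω Q (σ i) out) ∧
      coins w {ω | ¬ ∃ σ : ℕ → Config,
        IsRun A w s ω [n, k, ⌈1 / δ⌉₊, w] S T σ ∧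
        ∀ i ≤ S.length, ∃ out, Answers A w s ω Q (σ i) out ∧
          ListsMaximalMatching (edges (S.take i)) out} ≤ ENNReal.ofReal (δ / (n : ℝ) ^ c)

end DynStream

/-!
The ordered pairs of adjacent vertices form a binary matrix, and the algorithm stores linear
sketches of it: rows and columns are hashed by independent multiply-shift functions to
`2 ^ l = Θ(k)` buckets each, and every cell of the resulting table keeps enough sums over its pairs
to decode the pair if it is alone in its cell.  Sketch `t` discards all but a `2 ^ (-(t % w))`-th
part of the vertices as columns.  Insertions and deletions only add to or subtract from a constant
number of cells of each of the `w * w` independent sketches.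

The matching itself is kept as a list of edges.  An insertion adds the new edge if both of its end
points are free.  Only the deletion of a matching edge is expensive: then each of its two end
points looks for a free neighbour among the neighbours that some sketch recovers.  By the promise
the graph has a vertex cover of size at most `2 * k`, and outside a vertex cover all degrees are
small.  If `u` has few neighbours, each neighbour of small degree is alone in its cell with constant
probability in a sketch without sampling, hence is recovered by one of these except with probability
exponentially small in `w`.  If `u` has many neighbours, a sketch whose sampling rate fits their
number recovers with constant probability more of them than there are matched vertices, and one of
these must be free.

The stream is oblivious and the sketches depend only on the current graph, so the failure
probabilities at the individual times are simply added up.  They do not depend on the matching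
chosen by the algorithm, which is correlated with the random words.
-/

/-! ## A program logic for the word RAM -/

namespace WordRAM

instance : Add Expr := ⟨.bin .add⟩
instance : Sub Expr := ⟨.bin .sub⟩
instance : Mul Expr := ⟨.bin .mul⟩
instance : Mod Expr := ⟨.bin .mod⟩
instance (a : ℕ) : OfNat Expr a := ⟨.const a⟩

section Eval

variable {w : ℕ} {ρ : ℕ → ℕ} {e f : Expr} {a b : ℕ}

lemma eval_reg {i : ℕ} (h : ρ i = a) : (Expr.reg i).eval w ρ = a := h

lemma eval_lit (h : (OfNat.ofNat a : ℕ) < 2 ^ w) :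
    (OfNat.ofNat a : Expr).eval w ρ = (OfNat.ofNat a : ℕ) := Nat.mod_eq_of_lt h

lemma eval_add (he : e.eval w ρ = a) (hf : f.eval w ρ = b) (h : a + b < 2 ^ w) :
    (e + f).eval w ρ = a + b := by
  subst he hf; exact Nat.mod_eq_of_lt h

lemma eval_sub (he : e.eval w ρ = a) (hf : f.eval w ρ = b) (h : a - b < 2 ^ w) :
    (e - f).eval w ρ = a - b := by
  subst he hf; exact Nat.mod_eq_of_lt h

lemma eval_mul (he : e.eval w ρ = a) (hf : f.eval w ρ = b) (h : a * b < 2 ^ w) :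
    (e * f).eval w ρ = a * b := by
  subst he hf; exact Nat.mod_eq_of_lt h

lemma eval_mod (he : e.eval w ρ = a) (hf : f.eval w ρ = b) (h : a % b < 2 ^ w) :
    (e % f).eval w ρ = a % b := by
  subst he hf; exact Nat.mod_eq_of_lt h

lemma eval_lt_ne_zero_iff (hw : w ≠ 0) (he : e.eval w ρ = a) (hf : f.eval w ρ = b) :
    (Expr.bin .lt e f).eval w ρ ≠ 0 ↔ a < b := by
  subst he hf
  have : 1 < 2 ^ w := Nat.one_lt_two_pow hw
  by_cases h : e.eval w ρ < f.eval w ρ <;>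
    simp [Expr.eval, BinOp.val, h, Nat.mod_eq_of_lt this]

lemma eval_eq (hw : w ≠ 0) (he : e.eval w ρ = a) (hf : f.eval w ρ = b) :
    (Expr.bin .eq e f).eval w ρ = if a = b then 1 else 0 := by
  subst he hf
  have : 1 < 2 ^ w := Nat.one_lt_two_pow hw
  by_cases h : e.eval w ρ = f.eval w ρ <;>
    simp [Expr.eval, BinOp.val, h, Nat.mod_eq_of_lt this]

lemma eval_eq_ne_zero_iff (hw : w ≠ 0) (he : e.eval w ρ = a) (hf : f.eval w ρ = b) :
    (Expr.bin .eq e f).eval w ρ ≠ 0 ↔ a = b := by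
  simp [eval_eq hw he hf]

end Eval

/-- The registers that a program may change. -/
def Cmd.writes : Cmd → ℕ → Bool
  | .set i _, r => i == r
  | .load i _, r => i == r
  | .store _ _, _ => false
  | .rand i, r => i == r
  | .emit _, _ => false
  | .skip, _ => false
  | .seq a b, r => a.writes r || b.writes r
  | .cond _ a b, r => a.writes r || b.writes r
  | .loop _ a, r => a.writes r

/-- Does the program contain a store? -/
def Cmd.stores : Cmd → Bool
  | .store _ _ => true
  | .seq a b => a.stores || b.stores
  | .cond _ a b => a.stores || b.stores
  | .loop _ a => a.stores
  | _ => false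

/-- Does the program draw random words? -/
def Cmd.draws : Cmd → Bool
  | .rand _ => true
  | .seq a b => a.draws || b.draws
  | .cond _ a b => a.draws || b.draws
  | .loop _ a => a.draws
  | _ => false

/-- Does the program write to the output? -/
def Cmd.emits : Cmd → Bool
  | .emit _ => true
  | .seq a b => a.emits || b.emits
  | .cond _ a b => a.emits || b.emits
  | .loop _ a => a.emits
  | _ => false

/-- The passage from `σ` to `τ` changes only components that the text of `a` allows `a` to
change. -/
structure Frame (a : Cmd) (σ τ : Config) : Prop where
  regs : ∀ r, a.writes r = false → τ.regs r = σ.regs r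
  mem : a.stores = false → τ.mem = σ.mem
  pos : a.draws = false → τ.pos = σ.pos
  out : a.emits = false → τ.out = σ.out

namespace Frame

variable {a b : Cmd} {σ τ υ : Config}

lemma refl (a : Cmd) (σ : Config) : Frame a σ σ :=
  ⟨fun _ _ => rfl, fun _ => rfl, fun _ => rfl, fun _ => rfl⟩

lemma trans (h : Frame a σ τ) (h' : Frame a τ υ) : Frame a σ υ :=
  ⟨fun r hr => (h'.regs r hr).trans (h.regs r hr), fun hr => (h'.mem hr).trans (h.mem hr),
    fun hr => (h'.pos hr).trans (h.pos hr), fun hr => (h'.out hr).trans (h.out hr)⟩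

lemma mono (h : Frame a σ τ) (hregs : ∀ r, b.writes r = false → a.writes r = false)
    (hmem : b.stores = false → a.stores = false) (hpos : b.draws = false → a.draws = false)
    (hout : b.emits = false → a.emits = false) : Frame b σ τ :=
  ⟨fun r hr => h.regs r (hregs r hr), fun hr => h.mem (hmem hr), fun hr => h.pos (hpos hr),
    fun hr => h.out (hout hr)⟩

end Frame

variable {w s : ℕ} {ω : ℕ → Fin (2 ^ w)}

theorem Exec.frame {a : Cmd} {σ τ : Config} {t : ℕ} (h : Exec w s ω a σ t τ) : Frame a σ τ := by
  induction h with
  | set i e σ | load i e σ | rand i σ =>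
    refine ⟨fun r hr => ?_, fun _ => rfl, ?_, fun _ => rfl⟩
    · have : r ≠ i := by rintro rfl; simp [Cmd.writes] at hr
      simp [Function.update_of_ne this]
    · simp [Cmd.draws]
  | store => exact ⟨fun _ _ => rfl, by simp [Cmd.stores], fun _ => rfl, fun _ => rfl⟩
  | emit => exact ⟨fun _ _ => rfl, fun _ => rfl, fun _ => rfl, by simp [Cmd.emits]⟩
  | skip | loopDone => exact Frame.refl _ _
  | seq _ _ ih₁ ih₂ =>
    refine (ih₁.mono ?_ ?_ ?_ ?_).trans (ih₂.mono ?_ ?_ ?_ ?_) <;>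
      simp +contextual [Cmd.writes, Cmd.stores, Cmd.draws, Cmd.emits]
  | condTrue _ _ ih | condFalse _ _ ih =>
    refine ih.mono ?_ ?_ ?_ ?_ <;>
      simp +contextual [Cmd.writes, Cmd.stores, Cmd.draws, Cmd.emits]
  | loopStep _ _ _ ih₁ ih₂ =>
    exact Frame.trans ⟨ih₁.regs, ih₁.mem, ih₁.pos, ih₁.out⟩ ih₂

/-- The configuration after writing `v` to register `i`. -/
def Config.setReg (σ : Config) (i v : ℕ) : Config :=
  { σ with regs := Function.update σ.regs i v }

/-- The configuration after writing `v` to the memory cell `i`. -/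
def Config.setMem (σ : Config) (i v : ℕ) : Config :=
  { σ with mem := Function.update σ.mem i v }

namespace Config

variable (σ : Config) (i v j : ℕ)

@[simp] lemma setReg_regs : (σ.setReg i v).regs j = if j = i then v else σ.regs j :=
  Function.update_apply ..

@[simp] lemma setReg_mem : (σ.setReg i v).mem = σ.mem := rfl

@[simp] lemma setReg_pos : (σ.setReg i v).pos = σ.pos := rfl

@[simp] lemma setReg_out : (σ.setReg i v).out = σ.out := rfl

@[simp] lemma setMem_mem : (σ.setMem i v).mem j = if j = i then v else σ.mem j :=
  Function.update_apply ..

@[simp] lemma setMem_regs : (σ.setMem i v).regs = σ.regs := rfl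

@[simp] lemma setMem_pos : (σ.setMem i v).pos = σ.pos := rfl

end Config

/-- Total correctness with a time bound: the program halts within `T` steps in a configuration
that satisfies `Q`. -/
def Reaches (w s : ℕ) (ω : ℕ → Fin (2 ^ w)) (a : Cmd) (σ : Config) (T : ℕ)
    (Q : Config → Prop) : Prop :=
  ∃ t τ, t ≤ T ∧ Exec w s ω a σ t τ ∧ Q τ

/-- Sequential composition of a list of programs. -/
def block : List Cmd → Cmd
  | [] => .skip
  | a :: l => .seq a (block l)

namespace Reaches

variable {a b : Cmd} {l : List Cmd} {e f : Expr} {σ : Config} {T T₁ T₂ : ℕ}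
  {Q R : Config → Prop}

lemma weaken (h : Reaches w s ω a σ T₁ R) (hT : T₁ ≤ T) (hQ : ∀ τ, Frame a σ τ → R τ → Q τ) :
    Reaches w s ω a σ T Q := by
  obtain ⟨t, τ, ht, hx, hR⟩ := h
  exact ⟨t, τ, ht.trans hT, hx, hQ τ hx.frame hR⟩

lemma skip (h : Q σ) : Reaches w s ω .skip σ (T + 1) Q := ⟨1, σ, by omega, .skip σ, h⟩

lemma nil (h : Q σ) : Reaches w s ω (block []) σ (T + 1) Q := skip h

lemma cons (h : Reaches w s ω a σ T₁ R)
    (h' : ∀ τ, Frame a σ τ → R τ → Reaches w s ω (block l) τ T₂ Q) :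
    Reaches w s ω (block (a :: l)) σ (T₁ + T₂) Q := by
  obtain ⟨t, τ, ht, hx, hR⟩ := h
  obtain ⟨t', τ', ht', hx', hQ⟩ := h' τ hx.frame hR
  exact ⟨t + t', τ', by omega, .seq hx hx', hQ⟩

lemma set (i v : ℕ) (he : e.eval w σ.regs = v)
    (h : Reaches w s ω (block l) (σ.setReg i v) T Q) :
    Reaches w s ω (block (.set i e :: l)) σ (T + 1) Q := by
  subst he
  obtain ⟨t, τ, ht, hx, hQ⟩ := h
  exact ⟨1 + t, τ, by omega, .seq (.set i e σ) hx, hQ⟩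

lemma load (i v : ℕ) (he : e.eval w σ.regs = v) (hv : v < s)
    (h : Reaches w s ω (block l) (σ.setReg i (σ.mem v)) T Q) :
    Reaches w s ω (block (.load i e :: l)) σ (T + 1) Q := by
  subst he
  obtain ⟨t, τ, ht, hx, hQ⟩ := h
  exact ⟨1 + t, τ, by omega, .seq (.load i e σ hv) hx, hQ⟩

lemma store (v x : ℕ) (he : e.eval w σ.regs = v) (hv : v < s) (hf : f.eval w σ.regs = x)
    (h : Reaches w s ω (block l) (σ.setMem v x) T Q) :
    Reaches w s ω (block (.store e f :: l)) σ (T + 1) Q := by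
  subst he hf
  obtain ⟨t, τ, ht, hx, hQ⟩ := h
  exact ⟨1 + t, τ, by omega, .seq (.store e f σ hv) hx, hQ⟩

lemma rand (i : ℕ)
    (h : Reaches w s ω (block l)
      { σ with regs := Function.update σ.regs i (ω σ.pos), pos := σ.pos + 1 } T Q) :
    Reaches w s ω (block (.rand i :: l)) σ (T + 1) Q := by
  obtain ⟨t, τ, ht, hx, hQ⟩ := h
  exact ⟨1 + t, τ, by omega, .seq (.rand i σ) hx, hQ⟩

lemma emit (v : ℕ) (he : e.eval w σ.regs = v)
    (h : Reaches w s ω (block l) { σ with out := σ.out ++ [v] } T Q) :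
    Reaches w s ω (block (.emit e :: l)) σ (T + 1) Q := by
  subst he
  obtain ⟨t, τ, ht, hx, hQ⟩ := h
  exact ⟨1 + t, τ, by omega, .seq (.emit e σ) hx, hQ⟩

lemma cond {p : Prop} (hp : e.eval w σ.regs ≠ 0 ↔ p) (h : p → Reaches w s ω a σ T Q)
    (h' : ¬ p → Reaches w s ω b σ T Q) : Reaches w s ω (.cond e a b) σ (T + 1) Q := by
  by_cases he : e.eval w σ.regs = 0
  · obtain ⟨t, τ, ht, hx, hQ⟩ := h' fun hp' => hp.2 hp' he
    exact ⟨t + 1, τ, by omega, .condFalse he hx, hQ⟩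
  · obtain ⟨t, τ, ht, hx, hQ⟩ := h (hp.1 he)
    exact ⟨t + 1, τ, by omega, .condTrue he hx, hQ⟩

lemma loop (N : ℕ) (I : ℕ → Config → Prop) (h₀ : I 0 σ)
    (hstep : ∀ i < N, ∀ τ, Frame a σ τ → I i τ →
      e.eval w τ.regs ≠ 0 ∧ Reaches w s ω a τ T (I (i + 1)))
    (hend : ∀ τ, Frame a σ τ → I N τ → e.eval w τ.regs = 0) :
    Reaches w s ω (.loop e a) σ (N * (T + 1) + 1) (I N) := by
  have remaining : ∀ d i, i + d = N → ∀ τ, Frame a σ τ → I i τ →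
      Reaches w s ω (.loop e a) τ (d * (T + 1) + 1) (I N) := by
    intro d
    induction d with
    | zero =>
      rintro i rfl τ hF hI
      exact ⟨1, τ, by omega, .loopDone (hend τ hF hI), hI⟩
    | succ d ih =>
      intro i hi τ hF hI
      obtain ⟨he, t, τ', ht, hx, hI'⟩ := hstep i (by omega) τ hF hI
      obtain ⟨t', τ'', ht', hx', hQ⟩ := ih (i + 1) (by omega) τ' (hF.trans hx.frame) hI'
      refine ⟨t + t' + 1, τ'', ?_, .loopStep he hx hx', hQ⟩
      rw [Nat.add_one_mul]
      omega
  exact remaining N 0 (by omega) σ (Frame.refl _ _) h₀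

end Reaches

/-- `for r := 0, …, q - 1 do a`, where `r` and `q` are registers. -/
def forLoop (r q : ℕ) (a : Cmd) : Cmd :=
  block [.set r 0, .loop (.bin .lt (.reg r) (.reg q)) (block [a, .set r (.reg r + 1)])]

lemma Frame.forLoop {a : Cmd} {r q : ℕ} {σ τ : Config}
    (h : Frame (block [a, .set r (.reg r + 1)]) (σ.setReg r 0) τ) :
    Frame (forLoop r q a) σ τ := by
  refine ⟨fun i hi => ?_, fun hi => ?_, fun hi => ?_, fun hi => ?_⟩
  · simp only [WordRAM.forLoop, block, Cmd.writes, Bool.or_false, Bool.or_eq_false_iff,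
      beq_eq_false_iff_ne] at hi
    rw [h.regs i (by simp [block, Cmd.writes, hi])]
    simp [Ne.symm hi.1]
  · exact h.mem (by simpa [WordRAM.forLoop, block, Cmd.stores] using hi)
  · exact h.pos (by simpa [WordRAM.forLoop, block, Cmd.draws] using hi)
  · exact h.out (by simpa [WordRAM.forLoop, block, Cmd.emits] using hi)

theorem Reaches.forLoop {a : Cmd} {σ : Config} {T r q : ℕ} (hw : w ≠ 0) (N : ℕ)
    (hq : σ.regs q = N) (hN : N < 2 ^ w) (hr : a.writes r = false) (hq' : a.writes q = false)
    (hrq : q ≠ r) (I : ℕ → Config → Prop) (h₀ : I 0 (σ.setReg r 0))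
    (hstep : ∀ i < N, ∀ τ, Frame (forLoop r q a) σ τ → τ.regs r = i → I i τ →
      Reaches w s ω a τ T (fun υ => I (i + 1) (υ.setReg r (i + 1)))) :
    Reaches w s ω (forLoop r q a) σ (N * (T + 3) + 3) (I N) := by
  have hw' : 1 < 2 ^ w := Nat.one_lt_two_pow hw
  have hqF : ∀ τ, Frame (block [a, .set r (.reg r + 1)]) (σ.setReg r 0) τ → τ.regs q = N := by
    intro τ h
    rw [h.regs q (by simp [block, Cmd.writes, hq', hrq.symm])]
    simp [hrq, hq]
  have : Reaches w s ω (WordRAM.forLoop r q a) σ ((N * (T + 2 + 1) + 1) + 1 + 1) (I N) := by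
    refine Reaches.set r 0 (eval_lit (by omega)) ?_
    refine Reaches.cons (R := fun τ => τ.regs r = N ∧ I N τ)
      (Reaches.loop N (fun i τ => τ.regs r = i ∧ I i τ) ⟨by simp, h₀⟩ ?_ ?_)
      (T₂ := 1) (fun τ _ h => Reaches.nil h.2)
    · rintro i hi τ hτ ⟨hri, hI⟩
      refine ⟨(eval_lt_ne_zero_iff hw (eval_reg hri) (eval_reg (hqF τ hτ))).2 hi, ?_⟩
      refine Reaches.cons (hstep i hi τ hτ.forLoop hri hI) fun υ hυ h => ?_
      refine Reaches.set r (i + 1) (eval_add (eval_reg ?_) (eval_lit hw') (by omega)) ?_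
      · rw [hυ.regs r hr, hri]
      · exact Reaches.nil ⟨by simp, h⟩
    · rintro τ hτ ⟨hri, -⟩
      have := eval_lt_ne_zero_iff hw (eval_reg hri) (eval_reg (hqF τ hτ))
      simpa using this
  exact this.weaken (by rw [Nat.add_assoc T]) fun _ _ h => h

end WordRAM

namespace DynStream

open WordRAM

/-! ## Multiply-shift hashing -/

/-- The multiply-shift hash function with seeds `a` and `b` on `w`-bit words, which drops the last
`r` bits. -/
def mulShift (w a b r x : ℕ) : ℕ := (a * x + b) % 2 ^ w / 2 ^ r

section Hashing

variable {w r t : ℕ}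

lemma mulShift_lt {l : ℕ} (hl : l ≤ w) (a b x : ℕ) : mulShift w a b (w - l) x < 2 ^ l := by
  rw [mulShift, Nat.div_lt_iff_lt_mul (Nat.two_pow_pos _), ← pow_add, Nat.add_sub_cancel' hl]
  exact Nat.mod_lt _ (Nat.two_pow_pos w)

lemma card_add_mul_two_pow_mul_odd_eq_le (ht : t ≤ w) {o : ℕ} (ho : Odd o) (c v : ℕ) :
    (Finset.univ.filter fun a : Fin (2 ^ w) => (c + a * (2 ^ t * o)) % 2 ^ w = v).card ≤ 2 ^ t := by
  have hcop : Nat.Coprime (2 ^ (w - t)) o := (Nat.coprime_two_left.2 ho).pow_left _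
  have hwt : 2 ^ w = 2 ^ t * 2 ^ (w - t) := by rw [← pow_add, Nat.add_sub_cancel' ht]
  conv_rhs => rw [← Finset.card_range (2 ^ t)]
  refine Finset.card_le_card_of_injOn (fun a => a / 2 ^ (w - t)) (fun a _ => ?_) ?_
  · simp only [Finset.coe_range, Set.mem_Iio]
    rw [Nat.div_lt_iff_lt_mul (Nat.two_pow_pos _), ← hwt]
    exact a.2
  · intro a ha a' ha' hdiv
    simp only [Finset.coe_filter, Finset.mem_univ, true_and, Set.mem_ofPred_eq] at ha ha' hdiv
    have hscaled : 2 ^ t * (a * o) ≡ 2 ^ t * (a' * o) [MOD 2 ^ t * 2 ^ (w - t)] := by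
      rw [← hwt, Nat.mul_left_comm, Nat.mul_left_comm _ (a' : ℕ)]
      exact Nat.ModEq.add_left_cancel' c (ha.trans ha'.symm)
    have hmod : a ≡ a' [MOD 2 ^ (w - t)] := Nat.ModEq.cancel_right_of_coprime hcop
      (Nat.ModEq.mul_left_cancel' (Nat.two_pow_pos t).ne' hscaled)
    refine Fin.ext ?_
    rw [← Nat.div_add_mod (a : ℕ) (2 ^ (w - t)), hdiv, hmod, Nat.div_add_mod]

lemma card_div_two_pow_eq_mod_two_pow_eq_le (ht : t ≤ r) (s : Finset ℕ) (β γ : ℕ) :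
    (s.filter fun v => v / 2 ^ r = β ∧ v % 2 ^ t = γ).card ≤ 2 ^ (r - t) := by
  have hrt : 2 ^ r = 2 ^ t * 2 ^ (r - t) := by rw [← pow_add, Nat.add_sub_cancel' ht]
  refine (Finset.card_le_card_of_injOn (t := Finset.range (2 ^ (r - t)))
    (fun v => v / 2 ^ t % 2 ^ (r - t)) (fun v _ => ?_) ?_).trans_eq (Finset.card_range _)
  · simpa using Nat.mod_lt _ (Nat.two_pow_pos _)
  · intro v hv v' hv' hmid
    simp only [Finset.coe_filter, Set.mem_ofPred_eq, hrt, ← Nat.div_div_eq_div_mul] at hv hv' hmid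
    have hhigh : v / 2 ^ t = v' / 2 ^ t := by
      rw [← Nat.div_add_mod (v / 2 ^ t) (2 ^ (r - t)), hv.2.1, hmid, ← hv'.2.1, Nat.div_add_mod]
    rw [← Nat.div_add_mod v (2 ^ t), hhigh, hv.2.2, ← hv'.2.2, Nat.div_add_mod]

lemma card_add_mul_two_pow_mul_odd_div_eq_le (hr : r ≤ w) (ht : t ≤ r) {o : ℕ} (ho : Odd o)
    (c β : ℕ) :
    (Finset.univ.filter fun a : Fin (2 ^ w) =>
      (c + a * (2 ^ t * o)) % 2 ^ w / 2 ^ r = β).card ≤ 2 ^ r := by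
  set value : Fin (2 ^ w) → ℕ := fun a => (c + a * (2 ^ t * o)) % 2 ^ w with hvalue
  have hlow : ∀ a, value a % 2 ^ t = c % 2 ^ t := by
    intro a
    simp only [hvalue]
    rw [Nat.mod_mod_of_dvd _ (pow_dvd_pow 2 (ht.trans hr)), Nat.mul_left_comm,
      Nat.add_mul_mod_self_left]
  calc _ ≤ 2 ^ t * ((Finset.range (2 ^ w)).filter fun v =>
          v / 2 ^ r = β ∧ v % 2 ^ t = c % 2 ^ t).card := by
        refine Finset.card_le_mul_card_image_of_maps_to (f := value)
          (fun a ha => ?_) _ fun v _ => ?_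
        · simp only [Finset.mem_filter, Finset.mem_univ, true_and, Finset.mem_range] at ha ⊢
          exact ⟨Nat.mod_lt _ (Nat.two_pow_pos w), ha, hlow a⟩
        · refine (Finset.card_le_card ?_).trans
            (card_add_mul_two_pow_mul_odd_eq_le (ht.trans hr) ho c v)
          exact Finset.filter_subset_filter _ (Finset.filter_subset _ _)
    _ ≤ 2 ^ t * 2 ^ (r - t) :=
        Nat.mul_le_mul_left _ (card_div_two_pow_eq_mod_two_pow_eq_le ht _ β _)
    _ = 2 ^ r := by rw [← pow_add, Nat.add_sub_cancel' ht]

lemma exists_add_two_pow_sub_eq_two_pow_mul_odd {x y : ℕ} (hr : r ≤ w) (hx : x < 2 ^ r)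
    (hy : y < 2 ^ r) (hxy : x ≠ y) : ∃ t ≤ r, ∃ o, Odd o ∧ x + (2 ^ w - y) = 2 ^ t * o := by
  have hyw : y < 2 ^ w := hy.trans_le (Nat.pow_le_pow_right (by omega) hr)
  obtain ⟨t, o, ho, hd⟩ := Nat.exists_eq_two_pow_mul_odd (n := x + (2 ^ w - y)) (by omega)
  refine ⟨t, ?_, o, ho, hd⟩
  by_contra! hrt
  have hdvd : 2 ^ r ∣ x + (2 ^ w - y) := hd ▸ (pow_dvd_pow 2 hrt.le).trans (dvd_mul_right _ _)
  have hmod : x + 2 ^ w ≡ y [MOD 2 ^ r] := by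
    have := Nat.ModEq.add_right y (Nat.modEq_zero_iff_dvd.2 hdvd)
    rwa [Nat.zero_add, show x + (2 ^ w - y) + y = x + 2 ^ w by omega] at this
  have hpow : x + 2 ^ w ≡ x [MOD 2 ^ r] :=
    Nat.ModEq.add_left x (Nat.modEq_zero_iff_dvd.2 (pow_dvd_pow 2 hr))
  exact hxy (Nat.ModEq.eq_of_lt_of_lt (hpow.symm.trans hmod) hx hy)

lemma seed_eq_of_mul_add_mod_eq {y : ℕ} {q q' : Fin (2 ^ w) × Fin (2 ^ w)}
    (h : (q.1 * y + q.2) % 2 ^ w = (q'.1 * y + q'.2) % 2 ^ w) (hfst : q.1 = q'.1) : q = q' := by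
  refine Prod.ext hfst (Fin.ext ?_)
  rw [hfst] at h
  exact Nat.ModEq.eq_of_lt_of_lt (Nat.ModEq.add_left_cancel' _ h) q.2.2 q'.2.2

/-- Once the value at `y` is fixed, the value at `x` depends only on the multiplier `a`, through
`a * (x - y)`, where `x - y` is a power of two times an odd number. -/
theorem card_mulShift_collision_le {x y : ℕ} (hr : r ≤ w) (hx : x < 2 ^ r) (hy : y < 2 ^ r)
    (hxy : x ≠ y) (c : ℕ) :
    (Finset.univ.filter fun q : Fin (2 ^ w) × Fin (2 ^ w) =>
      mulShift w q.1 q.2 r x = mulShift w q.1 q.2 r y ∧ mulShift w q.1 q.2 r y < c).card ≤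
      2 ^ r * (c * 2 ^ r) := by
  obtain ⟨t, htr, o, ho, hd⟩ := exists_add_two_pow_sub_eq_two_pow_mul_odd hr hx hy hxy
  rw [← Finset.card_range (c * 2 ^ r)]
  refine Finset.card_le_mul_card_image_of_maps_to (f := fun q => (q.1 * y + q.2) % 2 ^ w)
    (fun q hq => ?_) _ fun v _ => ?_
  · have := (Finset.mem_filter.1 hq).2.2
    rw [mulShift, Nat.div_lt_iff_lt_mul (Nat.two_pow_pos r)] at this
    simpa using this
  · refine le_trans ?_ (card_add_mul_two_pow_mul_odd_div_eq_le hr htr ho v (v / 2 ^ r))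
    refine Finset.card_le_card_of_injOn Prod.fst (fun q hq => ?_) fun q hq q' hq' h => ?_
    · simp only [Finset.coe_filter, Finset.mem_filter, Finset.mem_univ, true_and,
        Set.mem_ofPred_eq] at hq ⊢
      obtain ⟨⟨hcoll, -⟩, hv⟩ := hq
      have hshift : q.1 * y + q.2 + q.1 * (x + (2 ^ w - y)) = q.1 * x + q.2 + 2 ^ w * q.1 := by
        have hyw : y + (2 ^ w - y) = 2 ^ w :=
          Nat.add_sub_cancel' (hy.le.trans (Nat.pow_le_pow_right (by omega) hr))
        linear_combination (q.1 : ℕ) * hyw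
      rw [mulShift, mulShift, hv] at hcoll
      rw [← hcoll, ← hd, ← hv, Nat.mod_add_mod, hshift, Nat.add_mul_mod_self_left]
    · simp only [Finset.coe_filter, Set.mem_ofPred_eq] at hq hq'
      exact seed_eq_of_mul_add_mod_eq (hq.2.trans hq'.2.symm) h

theorem card_mulShift_lt {c : ℕ} (hc : c * 2 ^ r ≤ 2 ^ w) (x : ℕ) :
    (Finset.univ.filter fun q : Fin (2 ^ w) × Fin (2 ^ w) =>
      mulShift w q.1 q.2 r x < c).card = 2 ^ w * (c * 2 ^ r) := by
  have hfiber : ∀ a : Fin (2 ^ w), (Finset.univ.filter fun b : Fin (2 ^ w) =>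
      mulShift w a b r x < c).card = c * 2 ^ r := by
    intro a
    have hinj : Function.Injective fun b : Fin (2 ^ w) =>
        (⟨(a * x + b) % 2 ^ w, Nat.mod_lt _ (Nat.two_pow_pos w)⟩ : Fin (2 ^ w)) :=
      fun b b' h => congrArg Prod.snd (seed_eq_of_mul_add_mod_eq (q := (a, b)) (q' := (a, b'))
        (congrArg Fin.val h) rfl)
    rw [Finset.card_bijective _ (Finite.injective_iff_bijective.1 hinj)
      (t := Finset.univ.filter fun b : Fin (2 ^ w) => (b : ℕ) < c * 2 ^ r)]
    · rw [Fin.card_filter_val_lt, min_eq_right hc]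
    · intro b
      simp [mulShift, Nat.div_lt_iff_lt_mul (Nat.two_pow_pos r)]
  rw [← Finset.univ_product_univ, Finset.card_filter, Finset.sum_product]
  simp_rw [← Finset.card_filter, hfiber]
  simp

end Hashing

/-! ## Sketches of a set of ordered pairs -/

/-- The row of a vertex in sketch `t`, whose seeds are the random words `4 * t, …, 4 * t + 3`. -/
def rowOf {w : ℕ} (l : ℕ) (ω : ℕ → Fin (2 ^ w)) (t x : ℕ) : ℕ :=
  mulShift w (ω (4 * t)) (ω (4 * t + 1)) (w - l) x

/-- The column of a vertex in sketch `t`.  Only columns less than `2 ^ l` are stored; the other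
vertices are not sampled.  The sampling rate is `1 / 2 ^ (t % w)`. -/
def colOf {w : ℕ} (l : ℕ) (ω : ℕ → Fin (2 ^ w)) (t z : ℕ) : ℕ :=
  mulShift w (ω (4 * t + 2)) (ω (4 * t + 3)) (w - l - t % w) z

/-- The pairs of `P` that fall into the cell in row `r` and column `b` of sketch `t`. -/
def bucket {w : ℕ} (l : ℕ) (ω : ℕ → Fin (2 ^ w)) (P : Finset (ℕ × ℕ)) (t r b : ℕ) :
    Finset (ℕ × ℕ) :=
  P.filter fun p => rowOf l ω t p.1 = r ∧ colOf l ω t p.2 = b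

/-- Position of a cell in the enumeration of the cells of all sketches. -/
def cellIdx (l t r b : ℕ) : ℕ := (t * 2 ^ l + r) * 2 ^ l + b

/-- Number of cells of the `w * w` sketches. -/
def cells (w l : ℕ) : ℕ := w * w * (2 ^ l * 2 ^ l)

lemma eq_and_eq_of_mul_add_eq {m q q' c c' : ℕ} (hc : c < m) (hc' : c' < m)
    (h : q * m + c = q' * m + c') : q = q' ∧ c = c' := by
  have hm : 0 < m := by omega
  have hdiv := congrArg (· / m) h
  have hmod := congrArg (· % m) h
  simp only [Nat.add_comm (_ * _), Nat.add_mul_mod_self_right, Nat.mod_eq_of_lt hc,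
    Nat.mod_eq_of_lt hc', Nat.add_mul_div_right _ _ hm, Nat.div_eq_of_lt hc,
    Nat.div_eq_of_lt hc'] at hdiv hmod
  omega

lemma cellIdx_inj {l t r b t' r' b' : ℕ} (hr : r < 2 ^ l) (hb : b < 2 ^ l) (hr' : r' < 2 ^ l)
    (hb' : b' < 2 ^ l) (h : cellIdx l t r b = cellIdx l t' r' b') :
    t = t' ∧ r = r' ∧ b = b' := by
  obtain ⟨h', hbb⟩ := eq_and_eq_of_mul_add_eq hb hb' h
  obtain ⟨htt, hrr⟩ := eq_and_eq_of_mul_add_eq hr hr' h'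
  exact ⟨htt, hrr, hbb⟩

lemma mul_add_lt_mul {m q c M : ℕ} (hq : q < M) (hc : c < m) : q * m + c < M * m :=
  calc q * m + c < (q + 1) * m := by rw [Nat.add_one_mul]; omega
    _ ≤ M * m := Nat.mul_le_mul_right _ hq

lemma cellIdx_lt {w l t r b : ℕ} (ht : t < w * w) (hr : r < 2 ^ l) (hb : b < 2 ^ l) :
    cellIdx l t r b < cells w l := by
  rw [cells, ← Nat.mul_assoc]
  exact mul_add_lt_mul (mul_add_lt_mul ht hr) hb

lemma word_sq_le_cells (w l : ℕ) : w * w ≤ cells w l :=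
  Nat.le_mul_of_pos_right _ (Nat.mul_pos (Nat.two_pow_pos l) (Nat.two_pow_pos l))

lemma two_pow_le_cells {w : ℕ} (hw : w ≠ 0) (l : ℕ) : 2 ^ l ≤ cells w l := by
  rw [cells, ← Nat.mul_assoc]
  exact Nat.le_mul_of_pos_left _ (by positivity)

/-- `P'` arises from `P` by inserting `p` (`op = 0`) or deleting `p` (`op = 1`). -/
def Toggle (op : ℕ) (p : ℕ × ℕ) (P P' : Finset (ℕ × ℕ)) : Prop :=
  (op = 0 ∧ p ∉ P ∧ P' = insert p P) ∨ (op = 1 ∧ p ∈ P ∧ P' = P.erase p)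

namespace Toggle

variable {op : ℕ} {p : ℕ × ℕ} {P P' : Finset (ℕ × ℕ)}

lemma op_le (h : Toggle op p P P') : op ≤ 1 := by
  rcases h with h | h <;> omega

/-- The factor `2 * op` makes one formula serve both cases: subtracting `2 * f p` undoes the
addition of `f p` and removes `f p`. -/
lemma sum_filter (h : Toggle op p P P') (q : ℕ × ℕ → Prop) [DecidablePred q] (f : ℕ × ℕ → ℕ) :
    ∑ x ∈ P'.filter q, f x =
      if q p then (∑ x ∈ P.filter q, f x) + f p - 2 * op * f p else ∑ x ∈ P.filter q, f x := by
  rcases h with ⟨rfl, hp, rfl⟩ | ⟨rfl, hp, rfl⟩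
  · rw [Finset.filter_insert]
    split_ifs with hq
    · rw [Finset.sum_insert (by simp [hp])]
      omega
    · rfl
  · rw [Finset.filter_erase]
    split_ifs with hq
    · have := Finset.sum_erase_add (P.filter q) f (a := p) (by simp [hp, hq])
      omega
    · rw [Finset.erase_eq_of_notMem (by simp [hq])]

end Toggle

section CellContents

variable {w l n t r b op x z : ℕ} {ω : ℕ → Fin (2 ^ w)} {P P' : Finset (ℕ × ℕ)}
  {mem mem' : ℕ → ℕ}

lemma sum_bucket_le (hP : P ⊆ Finset.range n ×ˢ Finset.range n) {f : ℕ × ℕ → ℕ} {m : ℕ}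
    (hf : ∀ p ∈ P, f p ≤ m) : ∑ p ∈ bucket l ω P t r b, f p ≤ n * n * m :=
  calc ∑ p ∈ bucket l ω P t r b, f p ≤ ∑ p ∈ P, f p :=
        Finset.sum_le_sum_of_subset (Finset.filter_subset _ _)
    _ ≤ P.card * m := by simpa using Finset.sum_le_card_nsmul _ _ _ hf
    _ ≤ n * n * m := Nat.mul_le_mul_right _ (by simpa using Finset.card_le_card hP)

/-- The memory holds the contents of one cell of the sketches of `P`: the number of its pairs and
the sums of their components, at the addresses that are `8`, `9` and `10` modulo `16`. -/
def CellAt {w : ℕ} (l : ℕ) (ω : ℕ → Fin (2 ^ w)) (P : Finset (ℕ × ℕ)) (mem : ℕ → ℕ)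
    (t r b : ℕ) : Prop :=
  mem (16 * cellIdx l t r b + 8) = (bucket l ω P t r b).card ∧
  mem (16 * cellIdx l t r b + 9) = ∑ p ∈ bucket l ω P t r b, p.1 ∧
  mem (16 * cellIdx l t r b + 10) = ∑ p ∈ bucket l ω P t r b, p.2

/-- The memory holds sketch `t` of the set `P` of ordered pairs. -/
def SketchMem {w : ℕ} (l : ℕ) (ω : ℕ → Fin (2 ^ w)) (P : Finset (ℕ × ℕ)) (mem : ℕ → ℕ)
    (t : ℕ) : Prop :=
  ∀ r < 2 ^ l, ∀ b < 2 ^ l, CellAt l ω P mem t r b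

/-- The memory holds all sketches of the set `P` of ordered pairs. -/
def CellMem {w : ℕ} (l : ℕ) (ω : ℕ → Fin (2 ^ w)) (P : Finset (ℕ × ℕ)) (mem : ℕ → ℕ) : Prop :=
  ∀ t < w * w, SketchMem l ω P mem t

/-- The memory after the pair `(x, z)` has been inserted into (`op = 0`) or deleted from
(`op = 1`) cell number `i`. -/
def toggledCell (op x z i : ℕ) (mem : ℕ → ℕ) (a : ℕ) : ℕ :=
  if a = 16 * i + 8 then mem a + 1 - 2 * op * 1
  else if a = 16 * i + 9 then mem a + x - 2 * op * x
  else if a = 16 * i + 10 then mem a + z - 2 * op * z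
  else mem a

lemma toggledCell_of_mod_lt {i a : ℕ} (ha : a % 16 < 8) :
    toggledCell op x z i mem a = mem a := by
  simp only [toggledCell]
  rw [if_neg (by omega), if_neg (by omega), if_neg (by omega)]

lemma toggledCell_of_ne {i j g : ℕ} (hij : j ≠ i) (hg : g < 16) :
    toggledCell op x z i mem (16 * j + g) = mem (16 * j + g) := by
  simp only [toggledCell]
  rw [if_neg (by omega), if_neg (by omega), if_neg (by omega)]

namespace CellAt

lemma le_cube (h : CellAt l ω P mem t r b) (hP : P ⊆ Finset.range n ×ˢ Finset.range n)
    (hn : 1 ≤ n) :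
    mem (16 * cellIdx l t r b + 8) ≤ n * n * n ∧ mem (16 * cellIdx l t r b + 9) ≤ n * n * n ∧
      mem (16 * cellIdx l t r b + 10) ≤ n * n * n := by
  have hlt : ∀ p ∈ P, p.1 < n ∧ p.2 < n := fun p hp => by simpa using hP hp
  refine ⟨?_, ?_, ?_⟩
  · rw [h.1, Finset.card_eq_sum_ones]
    exact sum_bucket_le hP fun _ _ => hn
  · rw [h.2.1]
    exact sum_bucket_le hP fun p hp => (hlt p hp).1.le
  · rw [h.2.2]
    exact sum_bucket_le hP fun p hp => (hlt p hp).2.le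

lemma congr (h : CellAt l ω P mem t r b)
    (hmem : ∀ g < 16, mem' (16 * cellIdx l t r b + g) = mem (16 * cellIdx l t r b + g)) :
    CellAt l ω P mem' t r b := by
  rw [CellAt, hmem 8 (by omega), hmem 9 (by omega), hmem 10 (by omega)]
  exact h

lemma toggle_of_notMem (h : CellAt l ω P mem t r b) (hT : Toggle op (x, z) P P')
    (hrb : ¬ (rowOf l ω t x = r ∧ colOf l ω t z = b)) : CellAt l ω P' mem t r b := by
  simpa only [CellAt, bucket, Finset.card_eq_sum_ones, hT.sum_filter, if_neg hrb] using h

lemma toggledCell (h : CellAt l ω P mem t (rowOf l ω t x) (colOf l ω t z))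
    (hT : Toggle op (x, z) P P') :
    CellAt l ω P' (toggledCell op x z (cellIdx l t (rowOf l ω t x) (colOf l ω t z)) mem) t
      (rowOf l ω t x) (colOf l ω t z) := by
  simp only [CellAt, bucket, Finset.card_eq_sum_ones, hT.sum_filter] at h ⊢
  simp [DynStream.toggledCell, h]

end CellAt

namespace SketchMem

lemma toggledCell_of_ne {t' : ℕ} (h : SketchMem l ω P mem t') (ht : t' ≠ t) (hr : r < 2 ^ l)
    (hb : b < 2 ^ l) : SketchMem l ω P (toggledCell op x z (cellIdx l t r b) mem) t' :=
  fun _ hr' _ hb' => (h _ hr' _ hb').congr fun _ hg =>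
    DynStream.toggledCell_of_ne (fun hidx => ht (cellIdx_inj hr' hb' hr hb hidx).1) hg

lemma toggledCell (h : SketchMem l ω P mem t) (hT : Toggle op (x, z) P P')
    (hrow : rowOf l ω t x < 2 ^ l) (hcol : colOf l ω t z < 2 ^ l) :
    SketchMem l ω P' (toggledCell op x z (cellIdx l t (rowOf l ω t x) (colOf l ω t z)) mem) t := by
  intro r hr b hb
  by_cases hrb : rowOf l ω t x = r ∧ colOf l ω t z = b
  · obtain ⟨rfl, rfl⟩ := hrb
    exact (h _ hr _ hb).toggledCell hT
  · refine ((h r hr b hb).toggle_of_notMem hT hrb).congr fun g hg =>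
      DynStream.toggledCell_of_ne (fun hidx => hrb ?_) hg
    obtain ⟨-, hrr, hbb⟩ := cellIdx_inj hr hb hrow hcol hidx
    exact ⟨hrr.symm, hbb.symm⟩

lemma toggle_of_not_sampled (h : SketchMem l ω P mem t) (hT : Toggle op (x, z) P P')
    (hcol : ¬ colOf l ω t z < 2 ^ l) : SketchMem l ω P' mem t :=
  fun r hr b hb => (h r hr b hb).toggle_of_notMem hT fun hrb => hcol (hrb.2 ▸ hb)

end SketchMem

lemma CellMem.congr (h : CellMem l ω P mem) (hmem : ∀ a, 8 ≤ a % 16 → mem' a = mem a) :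
    CellMem l ω P mem' :=
  fun t ht r hr b hb => by
    rw [CellAt, hmem _ (by omega), hmem _ (by omega), hmem _ (by omega)]
    exact h t ht r hr b hb

/-- The memory holds the seeds of the hash functions of all sketches, at the addresses that are
`4, …, 7` modulo `16`. -/
def SeedMem {w : ℕ} (ω : ℕ → Fin (2 ^ w)) (mem : ℕ → ℕ) : Prop :=
  ∀ t < w * w, ∀ j < 4, mem (16 * t + 4 + j) = ω (4 * t + j)

lemma SeedMem.congr (h : SeedMem ω mem)
    (hmem : ∀ a, 4 ≤ a % 16 → a % 16 < 8 → mem' a = mem a) : SeedMem ω mem' :=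
  fun t ht j hj => (hmem _ (by omega) (by omega)).trans (h t ht j hj)

end CellContents

/-! ## Registers and memory layout -/

/- The registers of all programs: the arguments of an update; the parameters (number `2 ^ l` of
rows and columns, word length `w`, shift `w - l`, number `w * w` of sketches); the size of the
stored matching and the index of one of its edges; the ordered pair and the sketch at work; the
seeds of that sketch; row, column and index of a cell; its contents; the result of a search. -/

@[simp] abbrev rOp : ℕ := 0
@[simp] abbrev rLeft : ℕ := 1
@[simp] abbrev rRight : ℕ := 2
@[simp] abbrev rWidth : ℕ := 3
@[simp] abbrev rWord : ℕ := 4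
@[simp] abbrev rShift : ℕ := 5
@[simp] abbrev rReps : ℕ := 6
@[simp] abbrev rSize : ℕ := 7
@[simp] abbrev rEdge : ℕ := 8
@[simp] abbrev rFst : ℕ := 10
@[simp] abbrev rSnd : ℕ := 11
@[simp] abbrev rSketch : ℕ := 12
@[simp] abbrev rRowMul : ℕ := 13
@[simp] abbrev rRowAdd : ℕ := 14
@[simp] abbrev rColMul : ℕ := 15
@[simp] abbrev rColAdd : ℕ := 16
@[simp] abbrev rRow : ℕ := 17
@[simp] abbrev rCol : ℕ := 18
@[simp] abbrev rCell : ℕ := 19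
@[simp] abbrev rCount : ℕ := 20
@[simp] abbrev rSumFst : ℕ := 21
@[simp] abbrev rSumSnd : ℕ := 22
@[simp] abbrev rFound : ℕ := 23
@[simp] abbrev rPos : ℕ := 24

/-- Number of memory words: sixteen interleaved arrays with one entry for each cell. -/
def memSize (w l : ℕ) : ℕ := 16 * cells w l

/-- Address of entry `e` of the array with number `tag`. -/
def addr (e : Expr) (tag : ℕ) : Expr := 16 * e + .const tag

/-- The relations between word length `w`, sketch size `2 ^ l`, matching size `k` and number `n`
of vertices under which the programs work without overflow. -/
structure Sizes (w l k n : ℕ) : Prop where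
  one_le_k : 1 ≤ k
  le_width : 256 * k ≤ 2 ^ l
  width_le : 2 ^ l ≤ 512 * k
  le_word : l ≤ w
  four_le_word : 4 ≤ w
  space : 2 * memSize w l ≤ 2 ^ w
  one_le_n : 1 ≤ n
  cube : 16 * (n * n * n) ≤ 2 ^ w

/-- The registers carry the parameters of the algorithm. -/
structure ParamRegs (w l : ℕ) (ρ : ℕ → ℕ) : Prop where
  width : ρ rWidth = 2 ^ l
  word : ρ rWord = w
  shift : ρ rShift = w - l
  reps : ρ rReps = w * w

lemma ParamRegs.congr {w l : ℕ} {ρ ρ' : ℕ → ℕ} (h : ParamRegs w l ρ)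
    (hρ : ∀ r ∈ [rWidth, rWord, rShift, rReps], ρ' r = ρ r) : ParamRegs w l ρ' :=
  ⟨(hρ _ (by decide)).trans h.width, (hρ _ (by decide)).trans h.word,
    (hρ _ (by decide)).trans h.shift, (hρ _ (by decide)).trans h.reps⟩

lemma ParamRegs.frame {w l : ℕ} {a : Cmd} {σ τ : Config} (h : ParamRegs w l σ.regs)
    (hF : Frame a σ τ)
    (ha : ∀ r ∈ [rWidth, rWord, rShift, rReps], a.writes r = false := by decide) :
    ParamRegs w l τ.regs :=
  h.congr fun r hr => hF.regs r (ha r hr)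

lemma ParamRegs.setReg {w l : ℕ} {σ : Config} {i v : ℕ} (h : ParamRegs w l σ.regs)
    (hi : i ∉ [rWidth, rWord, rShift, rReps] := by decide) :
    ParamRegs w l (σ.setReg i v).regs :=
  h.congr fun r hr => by rw [Config.setReg_regs, if_neg (ne_of_mem_of_not_mem hr hi)]

namespace Sizes

variable {w l k n : ℕ} {ω : ℕ → Fin (2 ^ w)} {ρ : ℕ → ℕ} {e f : Expr} {c : List Cmd} {σ : Config}
  {i g T : ℕ} {Q : Config → Prop}

lemma word_ne_zero (h : Sizes w l k n) : w ≠ 0 := by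
  have := h.four_le_word
  omega

lemma n_le_cube (h : Sizes w l k n) : n ≤ n * n * n := by
  have := h.one_le_n
  exact Nat.le_mul_of_pos_left _ (by positivity)

lemma n_lt (h : Sizes w l k n) : n < 2 ^ w := by
  have := h.n_le_cube
  have := h.cube
  have := h.one_le_n
  omega

lemma cells_lt (h : Sizes w l k n) : 32 * cells w l ≤ 2 ^ w := by
  have := h.space
  rw [memSize] at this
  omega

lemma reps_lt (h : Sizes w l k n) : w * w < 2 ^ w := by
  have := word_sq_le_cells w l
  have := h.cells_lt
  have : 0 < w * w := by have := h.four_le_word; positivity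
  omega

lemma width_lt (h : Sizes w l k n) : 2 ^ l < 2 ^ w := by
  have := two_pow_le_cells h.word_ne_zero l
  have := h.cells_lt
  have := Nat.two_pow_pos l
  omega

lemma eval_addr (h : Sizes w l k n) (he : e.eval w ρ = i) (hi : i < cells w l) (hg : g < 16) :
    (addr e g).eval w ρ = 16 * i + g := by
  have := h.cells_lt
  exact eval_add (eval_mul (eval_lit (by omega)) he (by omega))
    (Nat.mod_eq_of_lt (by omega)) (by omega)

lemma reaches_load (h : Sizes w l k n) (r : ℕ) (he : e.eval w σ.regs = i) (hi : i < cells w l)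
    (hg : g < 16 := by omega)
    (hQ : Reaches w (memSize w l) ω (block c) (σ.setReg r (σ.mem (16 * i + g))) T Q) :
    Reaches w (memSize w l) ω (block (.load r (addr e g) :: c)) σ (T + 1) Q :=
  Reaches.load r _ (h.eval_addr he hi hg) (by rw [memSize]; omega) hQ

lemma reaches_store (h : Sizes w l k n) (he : e.eval w σ.regs = i) (hi : i < cells w l)
    {v : ℕ} (hf : f.eval w σ.regs = v) (hg : g < 16 := by omega)
    (hQ : Reaches w (memSize w l) ω (block c) (σ.setMem (16 * i + g) v) T Q) :
    Reaches w (memSize w l) ω (block (.store (addr e g) f :: c)) σ (T + 1) Q :=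
  Reaches.store _ v (h.eval_addr he hi hg) (by rw [memSize]; omega) hf hQ

end Sizes

/-! ## Updating the sketches -/

/-- Load the seeds of the current sketch. -/
def loadSeeds (c : List Cmd) : List Cmd :=
  .load rRowMul (addr (.reg rSketch) 4) :: .load rRowAdd (addr (.reg rSketch) 5) ::
  .load rColMul (addr (.reg rSketch) 6) :: .load rColAdd (addr (.reg rSketch) 7) :: c

/-- The row of a vertex in the current sketch. -/
def rowExpr (x : Expr) : Expr := .bin .shr (.reg rRowMul * x + .reg rRowAdd) (.reg rShift)

/-- The column of a vertex in the current sketch. -/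
def colExpr (z : Expr) : Expr :=
  .bin .shr (.reg rColMul * z + .reg rColAdd) (.reg rShift - .reg rSketch % .reg rWord)

/-- The index of the cell in the current row and the given column of the current sketch. -/
def idxExpr (b : Expr) : Expr :=
  (.reg rSketch * .reg rWidth + .reg rRow) * .reg rWidth + b

/-- Add the value of `f` to an entry of the current cell, or subtract it. -/
def addToCell (tag : ℕ) (f : Expr) (c : List Cmd) : List Cmd :=
  .load rCount (addr (.reg rCell) tag) ::
  .store (addr (.reg rCell) tag) (.reg rCount + f - 2 * .reg rOp * f) :: c

/-- Insert the current pair into the current cell, or delete it. -/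
def toggleCell : Cmd :=
  block (addToCell 8 1 <| addToCell 9 (.reg rFst) <| addToCell 10 (.reg rSnd) [])

/-- Insert the current pair into the current sketch, or delete it. -/
def toggleSketch : Cmd :=
  block <| loadSeeds
    [.set rRow (rowExpr (.reg rFst)), .set rCol (colExpr (.reg rSnd)),
     .cond (.bin .lt (.reg rCol) (.reg rWidth))
      (block [.set rCell (idxExpr (.reg rCol)), toggleCell]) .skip]

/-- Insert the current pair into all sketches, or delete it. -/
def toggleSketches : Cmd := forLoop rSketch rReps toggleSketch

section ToggleSketches

variable {w l k n : ℕ} {ω : ℕ → Fin (2 ^ w)}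

lemma eval_mulShift {ρ : ℕ → ℕ} {ea eb ex er : Expr} {a b x r : ℕ}
    (ha : ea.eval w ρ = a) (hb : eb.eval w ρ = b) (hx : ex.eval w ρ = x) (hr : er.eval w ρ = r) :
    (Expr.bin .shr (ea * ex + eb) er).eval w ρ = mulShift w a b r x := by
  subst ha hb hx hr
  change ((((_ * _) % 2 ^ w + _) % 2 ^ w) >>> _) % 2 ^ w = _
  rw [Nat.mod_add_mod, Nat.shiftRight_eq_div_pow]
  exact Nat.mod_eq_of_lt ((Nat.div_le_self _ _).trans_lt (Nat.mod_lt _ (Nat.two_pow_pos w)))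

lemma reaches_loadSeeds (hS : Sizes w l k n) {c : List Cmd} {σ : Config} {T t : ℕ}
    {Q : Config → Prop} (ht : t < w * w) (hsketch : σ.regs rSketch = t)
    (hseed : SeedMem ω σ.mem)
    (h : Reaches w (memSize w l) ω (block c)
      ((((σ.setReg rRowMul (ω (4 * t))).setReg rRowAdd (ω (4 * t + 1))).setReg rColMul
        (ω (4 * t + 2))).setReg rColAdd (ω (4 * t + 3))) T Q) :
    Reaches w (memSize w l) ω (block (loadSeeds c)) σ (T + 4) Q := by
  have hcell := ht.trans_le (word_sq_le_cells w l)
  refine hS.reaches_load rRowMul (eval_reg hsketch) hcell (hQ := ?_)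
  refine hS.reaches_load rRowAdd (eval_reg (by simp [hsketch])) hcell (hQ := ?_)
  refine hS.reaches_load rColMul (eval_reg (by simp [hsketch])) hcell (hQ := ?_)
  refine hS.reaches_load rColAdd (eval_reg (by simp [hsketch])) hcell (hQ := ?_)
  simp only [Config.setReg_mem]
  rwa [show σ.mem (16 * t + 4) = ω (4 * t) from hseed t ht 0 (by omega),
    show σ.mem (16 * t + 5) = ω (4 * t + 1) from hseed t ht 1 (by omega),
    show σ.mem (16 * t + 6) = ω (4 * t + 2) from hseed t ht 2 (by omega),
    show σ.mem (16 * t + 7) = ω (4 * t + 3) from hseed t ht 3 (by omega)]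

lemma eval_rowExpr {ρ : ℕ → ℕ} {e : Expr} {t x : ℕ} (hρ : ParamRegs w l ρ)
    (hmul : ρ rRowMul = ω (4 * t)) (hadd : ρ rRowAdd = ω (4 * t + 1)) (he : e.eval w ρ = x) :
    (rowExpr e).eval w ρ = rowOf l ω t x :=
  eval_mulShift (eval_reg hmul) (eval_reg hadd) he (eval_reg hρ.shift)

lemma eval_colExpr (hw : w ≠ 0) {ρ : ℕ → ℕ} {e : Expr} {t z : ℕ} (hρ : ParamRegs w l ρ)
    (hmul : ρ rColMul = ω (4 * t + 2)) (hadd : ρ rColAdd = ω (4 * t + 3))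
    (hsketch : ρ rSketch = t) (he : e.eval w ρ = z) : (colExpr e).eval w ρ = colOf l ω t z := by
  have := Nat.mod_lt t (Nat.pos_of_ne_zero hw)
  have : w < 2 ^ w := Nat.lt_two_pow_self
  exact eval_mulShift (eval_reg hmul) (eval_reg hadd) he (eval_sub (eval_reg hρ.shift)
    (eval_mod (eval_reg hsketch) (eval_reg hρ.word) (by omega)) (by omega))

lemma eval_idxExpr (hS : Sizes w l k n) {ρ : ℕ → ℕ} {e : Expr} {t r b : ℕ} (ht : t < w * w)
    (hr : r < 2 ^ l) (hb : b < 2 ^ l) (hρ : ParamRegs w l ρ) (hsketch : ρ rSketch = t)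
    (hrow : ρ rRow = r) (he : e.eval w ρ = b) : (idxExpr e).eval w ρ = cellIdx l t r b := by
  have hcells := hS.cells_lt
  have hlt := cellIdx_lt ht hr hb
  have hidx : cellIdx l t r b = (t * 2 ^ l + r) * 2 ^ l + b := rfl
  have hle : t * 2 ^ l + r ≤ (t * 2 ^ l + r) * 2 ^ l :=
    Nat.le_mul_of_pos_right _ (Nat.two_pow_pos l)
  exact eval_add (eval_mul (eval_add (eval_mul (eval_reg hsketch) (eval_reg hρ.width) (by omega))
    (eval_reg hrow) (by omega)) (eval_reg hρ.width) (by omega)) he (by omega)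

lemma reaches_addToCell (hS : Sizes w l k n) {tag : ℕ} {f : Expr} {c : List Cmd} {σ : Config}
    {T i y x op : ℕ} {Q : Config → Prop} (hi : i < cells w l) (hcell : σ.regs rCell = i)
    (hop : σ.regs rOp = op) (hop1 : op ≤ 1) (hf : ∀ v, f.eval w (σ.setReg rCount v).regs = x)
    (hx : x ≤ n * n * n) (hv : σ.mem (16 * i + tag) = y) (hy : y ≤ n * n * n)
    (htag : tag < 16 := by omega)
    (h : Reaches w (memSize w l) ω (block c)
      ((σ.setReg rCount y).setMem (16 * i + tag) (y + x - 2 * op * x)) T Q) :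
    Reaches w (memSize w l) ω (block (addToCell tag f c)) σ (T + 2) Q := by
  subst hv
  have hcube := hS.cube
  have htwo : 2 * op * x ≤ 2 * x := Nat.mul_le_mul_right _ (by omega)
  have := hS.n_le_cube
  have := hS.one_le_n
  refine hS.reaches_load rCount (eval_reg hcell) hi htag ?_
  refine hS.reaches_store (eval_reg (by simp [hcell])) hi (hg := htag) (hQ := h) ?_
  exact eval_sub (eval_add (eval_reg (by simp)) (hf _) (by omega))
    (eval_mul (eval_mul (eval_lit (by omega)) (eval_reg (by simpa using hop)) (by omega)) (hf _)
      (by omega)) (by omega)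

lemma reaches_toggleCell (hS : Sizes w l k n) {σ : Config} {t r b op x z : ℕ}
    {P : Finset (ℕ × ℕ)} (hP : P ⊆ Finset.range n ×ˢ Finset.range n)
    (hC : CellAt l ω P σ.mem t r b) (ht : t < w * w) (hr : r < 2 ^ l) (hb : b < 2 ^ l)
    (hcell : σ.regs rCell = cellIdx l t r b) (hop : σ.regs rOp = op) (hop1 : op ≤ 1)
    (hfst : σ.regs rFst = x) (hsnd : σ.regs rSnd = z) (hx : x < n) (hz : z < n) :
    Reaches w (memSize w l) ω toggleCell σ 7 fun τ =>
      τ.mem = toggledCell op x z (cellIdx l t r b) σ.mem := by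
  have hi := cellIdx_lt ht hr hb
  have hn := hS.n_le_cube
  have hcube := hS.cube
  obtain ⟨hcount, hsumFst, hsumSnd⟩ := hC.le_cube hP hS.one_le_n
  refine reaches_addToCell hS (op := op) (x := 1) hi hcell hop hop1
    (fun _ => eval_lit (by omega)) (by omega) rfl hcount (h := ?_)
  refine reaches_addToCell hS (op := op) (x := x) hi (by simp [hcell]) (by simp [hop]) hop1
    (fun _ => eval_reg (by simp [hfst])) (by omega) (by simp) hsumFst (h := ?_)
  refine reaches_addToCell hS (op := op) (x := z) hi (by simp [hcell]) (by simp [hop]) hop1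
    (fun _ => eval_reg (by simp [hsnd])) (by omega) (by simp) hsumSnd (h := ?_)
  refine Reaches.nil (funext fun a => ?_)
  simp only [toggledCell, Config.setMem_mem, Config.setReg_mem]
  split_ifs <;> first | omega | simp_all

lemma reaches_toggleSketch (hS : Sizes w l k n) {σ : Config} {t op x z : ℕ}
    {P P' : Finset (ℕ × ℕ)} (hp : ParamRegs w l σ.regs) (hsketch : σ.regs rSketch = t)
    (ht : t < w * w) (hop : σ.regs rOp = op) (hfst : σ.regs rFst = x) (hsnd : σ.regs rSnd = z)
    (hseed : SeedMem ω σ.mem) (hP : P ⊆ Finset.range n ×ˢ Finset.range n) (hx : x < n)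
    (hz : z < n) (hT : Toggle op (x, z) P P') (hmem : SketchMem l ω P σ.mem t) :
    Reaches w (memSize w l) ω toggleSketch σ 17 fun τ =>
      SketchMem l ω P' τ.mem t ∧
      (∀ P₁ t', t' ≠ t → SketchMem l ω P₁ σ.mem t' → SketchMem l ω P₁ τ.mem t') ∧
      ∀ a, a % 16 < 8 → τ.mem a = σ.mem a := by
  have hrow : rowOf l ω t x < 2 ^ l := mulShift_lt hS.le_word _ _ _
  refine reaches_loadSeeds hS (T := 13) ht hsketch hseed ?_
  have hp₁ := (((hp.setReg (i := rRowMul) (v := ω (4 * t))).setReg (i := rRowAdd)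
    (v := ω (4 * t + 1))).setReg (i := rColMul) (v := ω (4 * t + 2))).setReg (i := rColAdd)
    (v := ω (4 * t + 3))
  refine Reaches.set rRow (rowOf l ω t x)
    (eval_rowExpr hp₁ (by simp) (by simp) (eval_reg (by simp [hfst]))) ?_
  refine Reaches.set rCol (colOf l ω t z) (eval_colExpr hS.word_ne_zero hp₁.setReg (by simp)
    (by simp) (by simp [hsketch]) (eval_reg (by simp [hsnd]))) ?_
  have hp₂ := (hp₁.setReg (i := rRow) (v := rowOf l ω t x)).setReg (i := rCol)
    (v := colOf l ω t z)
  refine Reaches.cons (T₁ := 10) (T₂ := 1) (Reaches.cond (T := 9) (eval_lt_ne_zero_iff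
    hS.word_ne_zero (eval_reg (by simp; rfl)) (eval_reg hp₂.width)) (fun hcol => ?_)
    (fun hcol => ?_)) (fun τ _ h => Reaches.nil h)
  · refine Reaches.set rCell _ (eval_idxExpr hS ht hrow hcol hp₂ (by simp [hsketch]) (by simp)
      (eval_reg (by simp))) ?_
    refine Reaches.cons (T₂ := 1) (reaches_toggleCell hS hP (hmem _ hrow _ hcol) ht hrow hcol
      (by simp) (by simp [hop]) hT.op_le (by simp [hfst]) (by simp [hsnd]) hx hz)
      fun τ _ hτ => Reaches.nil ?_
    rw [hτ]
    exact ⟨hmem.toggledCell hT hrow hcol, fun P₁ t' ht' h => h.toggledCell_of_ne ht' hrow hcol,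
      fun a ha => toggledCell_of_mod_lt ha⟩
  · exact Reaches.skip ⟨hmem.toggle_of_not_sampled hT hcol, fun _ _ _ h => h, fun _ _ => rfl⟩

theorem reaches_toggleSketches (hS : Sizes w l k n) {σ : Config} {op x z : ℕ}
    {P P' : Finset (ℕ × ℕ)} (hp : ParamRegs w l σ.regs) (hop : σ.regs rOp = op)
    (hfst : σ.regs rFst = x) (hsnd : σ.regs rSnd = z) (hseed : SeedMem ω σ.mem)
    (hP : P ⊆ Finset.range n ×ˢ Finset.range n) (hx : x < n) (hz : z < n)
    (hT : Toggle op (x, z) P P') (hmem : CellMem l ω P σ.mem) :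
    Reaches w (memSize w l) ω toggleSketches σ (w * w * 20 + 3) fun τ =>
      CellMem l ω P' τ.mem ∧ ∀ a, a % 16 < 8 → τ.mem a = σ.mem a := by
  refine (Reaches.forLoop hS.word_ne_zero (w * w) hp.reps hS.reps_lt rfl rfl (by decide)
    (fun t τ => (∀ t' < w * w, SketchMem l ω (if t' < t then P' else P) τ.mem t') ∧
      ∀ a, a % 16 < 8 → τ.mem a = σ.mem a) ?_ ?_).weaken le_rfl ?_
  · exact ⟨fun t' ht' => by simpa using hmem t' ht', fun _ _ => rfl⟩
  · rintro t ht τ hF hsketch ⟨hI, hlow⟩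
    refine (reaches_toggleSketch hS (hp.frame hF) hsketch ht ((hF.regs rOp rfl).trans hop)
      ((hF.regs rFst rfl).trans hfst) ((hF.regs rSnd rfl).trans hsnd)
      (hseed.congr fun a _ => hlow a) hP hx hz hT (by simpa using hI t ht)).weaken le_rfl ?_
    rintro υ - ⟨hsame, hother, hlow'⟩
    refine ⟨fun t' ht' => ?_, fun a ha => (hlow' a ha).trans (hlow a ha)⟩
    rcases eq_or_ne t' t with rfl | hne
    · simpa using hsame
    · have hiff : t' < t + 1 ↔ t' < t := by omega
      simp only [hiff]
      exact hother _ t' hne (hI t' ht')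
  · rintro τ - ⟨h, hlow⟩
    exact ⟨fun t ht => by simpa [ht] using h t ht, hlow⟩

end ToggleSketches

/-! ## Searching for a free neighbour -/

/-- In sketch `t` the neighbour `y` of `u` can be read off from its cell. -/
def Recovered {w : ℕ} (l : ℕ) (ω : ℕ → Fin (2 ^ w)) (P : Finset (ℕ × ℕ)) (t u y : ℕ) : Prop :=
  colOf l ω t y < 2 ^ l ∧ bucket l ω P t (rowOf l ω t u) (colOf l ω t y) = {(u, y)}

/-- The result of decoding the cell in column `b` and the row of `u`: one more than the recovered
neighbour of `u`, or `0`. -/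
def candidate {w : ℕ} (l : ℕ) (ω : ℕ → Fin (2 ^ w)) (P : Finset (ℕ × ℕ)) (t u b : ℕ) : ℕ :=
  (if (bucket l ω P t (rowOf l ω t u) b).card = 1 then 1 else 0) *
  (if ∑ p ∈ bucket l ω P t (rowOf l ω t u) b, p.1 = u then 1 else 0) *
  (∑ p ∈ bucket l ω P t (rowOf l ω t u) b, p.2 + 1)

/-- The array `c` of candidates after removal of the vertices `y 0, …, y (m - 1)`. -/
def unmarked (y : ℕ → ℕ) (m : ℕ) (c : ℕ → ℕ) (b : ℕ) : ℕ :=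
  if ∃ i < m, c b = y i + 1 then 0 else c b

/-- The edge number `i` of the stored matching. -/
def storedEdge (mem : ℕ → ℕ) (i : ℕ) : ℕ × ℕ := (mem (16 * i + 2), mem (16 * i + 3))

/-- The set of end points of an edge. -/
def ends (e : ℕ × ℕ) : Finset ℕ := {e.1, e.2}

/-- The set of end points of the first `m` edges of the sequence `M`. -/
def matched (M : ℕ → ℕ × ℕ) (m : ℕ) : Finset ℕ := (Finset.range m).biUnion fun i => ends (M i)

lemma storedEdge_congr {mem mem' : ℕ → ℕ}
    (h : ∀ a, a % 16 = 2 ∨ a % 16 = 3 → mem' a = mem a) : storedEdge mem' = storedEdge mem :=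
  funext fun _ => Prod.ext (h _ (by omega)) (h _ (by omega))

section Decoding

variable {w l t u b x y m : ℕ} {ω : ℕ → Fin (2 ^ w)} {P : Finset (ℕ × ℕ)}

lemma Recovered.mem (h : Recovered l ω P t u y) : (u, y) ∈ P :=
  Finset.filter_subset _ _ (h.2.symm ▸ Finset.mem_singleton_self _ :
    (u, y) ∈ bucket l ω P t (rowOf l ω t u) (colOf l ω t y))

lemma candidate_eq_succ_iff (hb : b < 2 ^ l) :
    candidate l ω P t u b = y + 1 ↔ colOf l ω t y = b ∧ Recovered l ω P t u y := by
  refine ⟨fun h => ?_, ?_⟩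
  · rw [candidate] at h
    split_ifs at h with hcard hfst
    · obtain ⟨p, hp⟩ := Finset.card_eq_one.1 hcard
      simp only [hp, Finset.sum_singleton, one_mul, Nat.add_right_cancel_iff] at hfst h
      have hmem : p ∈ bucket l ω P t (rowOf l ω t u) b := hp ▸ Finset.mem_singleton_self _
      have hcol : colOf l ω t y = b := h ▸ (Finset.mem_filter.1 hmem).2.2
      exact ⟨hcol, by rwa [hcol], by rw [hcol, hp, ← hfst, ← h]⟩
    all_goals omega
  · rintro ⟨rfl, h⟩
    simp [candidate, h.2]

lemma unmarked_zero (y : ℕ → ℕ) (c : ℕ → ℕ) : unmarked y 0 c = c := by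
  funext b
  simp [unmarked]

lemma unmarked_eq_succ_iff {y : ℕ → ℕ} {c : ℕ → ℕ} :
    unmarked y m c b = x + 1 ↔ c b = x + 1 ∧ ∀ i < m, y i ≠ x := by
  rw [unmarked]
  split_ifs with h
  · obtain ⟨i, hi, hb⟩ := h
    have : c b = x + 1 → y i = x := by omega
    simpa using fun hx => ⟨i, hi, this hx⟩
  · refine ⟨fun hx => ⟨hx, fun i hi hy => h ⟨i, hi, by omega⟩⟩, And.left⟩

lemma unmarked_succ (y : ℕ → ℕ) (m : ℕ) (c : ℕ → ℕ) :
    unmarked y (m + 1) c =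
      fun b => if unmarked y m c b = y m + 1 then 0 else unmarked y m c b := by
  funext b
  simp only [unmarked, Nat.exists_lt_succ_right]
  split_ifs <;> first | omega | simp_all

lemma unmarked_unmarked_eq_succ_iff {M : ℕ → ℕ × ℕ} {c : ℕ → ℕ} :
    unmarked (fun i => (M i).2) m (unmarked (fun i => (M i).1) m c) b = x + 1 ↔
      c b = x + 1 ∧ x ∉ matched M m := by
  simp only [unmarked_eq_succ_iff, matched, ends, Finset.mem_biUnion, Finset.mem_range]
  grind

end Decoding

/-- Decode the current cell into the temporary array. -/
def collectStep : Cmd :=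
  block [.set rCell (idxExpr (.reg rCol)), .load rCount (addr (.reg rCell) 8),
    .load rSumFst (addr (.reg rCell) 9), .load rSumSnd (addr (.reg rCell) 10),
    .store (addr (.reg rCol) 1)
      (.bin .eq (.reg rCount) 1 * .bin .eq (.reg rSumFst) (.reg rFst) * (.reg rSumSnd + 1))]

/-- Remove an end point of the current stored edge from the temporary array. -/
def unmarkStep (tag : ℕ) : Cmd :=
  block [.load rSnd (addr (.reg rEdge) tag), .set rCol (colExpr (.reg rSnd)),
    .cond (.bin .lt (.reg rCol) (.reg rWidth))
      (block [.load rCount (addr (.reg rCol) 1),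
        .cond (.bin .eq (.reg rCount) (.reg rSnd + 1)) (block [.store (addr (.reg rCol) 1) 0])
          .skip])
      .skip]

/-- Take over a remaining candidate. -/
def pickStep : Cmd :=
  block [.load rCount (addr (.reg rCol) 1), .cond (.reg rCount) (block [.set rFound (.reg rCount)])
    .skip]

/-- Look for a free neighbour of the vertex in `rFst` in the current sketch. -/
def findStep : Cmd :=
  block <| loadSeeds [.set rRow (rowExpr (.reg rFst)), forLoop rCol rWidth collectStep,
    forLoop rEdge rSize (unmarkStep 2), forLoop rEdge rSize (unmarkStep 3),
    forLoop rCol rWidth pickStep]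

/-- Put one more than a free neighbour of the vertex in `rFst` into `rFound`, or `0` if none is
found. -/
def findFree : Cmd := block [.set rFound 0, forLoop rSketch rReps findStep]

/-- The temporary array holds the values of `c`. -/
def TempMem (l : ℕ) (c mem : ℕ → ℕ) : Prop := ∀ b < 2 ^ l, mem (16 * b + 1) = c b

/-- The seeds of sketch `t` have been loaded. -/
structure SeedRegs {w : ℕ} (ω : ℕ → Fin (2 ^ w)) (t : ℕ) (ρ : ℕ → ℕ) : Prop where
  sketch : ρ rSketch = t
  colMul : ρ rColMul = ω (4 * t + 2)
  colAdd : ρ rColAdd = ω (4 * t + 3)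

lemma SeedRegs.frame {w : ℕ} {ω : ℕ → Fin (2 ^ w)} {t : ℕ} {a : Cmd} {σ τ : Config}
    (h : SeedRegs ω t σ.regs) (hF : Frame a σ τ)
    (ha : ∀ r ∈ [rSketch, rColMul, rColAdd], a.writes r = false := by decide) :
    SeedRegs ω t τ.regs :=
  ⟨(hF.regs _ (ha _ (by decide))).trans h.sketch, (hF.regs _ (ha _ (by decide))).trans h.colMul,
    (hF.regs _ (ha _ (by decide))).trans h.colAdd⟩

section FindFree

variable {w l k n m t u : ℕ} {ω : ℕ → Fin (2 ^ w)} {P : Finset (ℕ × ℕ)} {σ : Config}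
  {c : ℕ → ℕ}

lemma Sizes.two_pow_lt_cells (hS : Sizes w l k n) {b : ℕ} (hb : b < 2 ^ l) : b < cells w l :=
  hb.trans_le (two_pow_le_cells hS.word_ne_zero l)

lemma reaches_collectStep (hS : Sizes w l k n) {b : ℕ} (hp : ParamRegs w l σ.regs)
    (hsketch : σ.regs rSketch = t) (ht : t < w * w) (hfst : σ.regs rFst = u)
    (hrow : σ.regs rRow = rowOf l ω t u) (hcol : σ.regs rCol = b) (hb : b < 2 ^ l)
    (hP : P ⊆ Finset.range n ×ˢ Finset.range n) (hmem : CellMem l ω P σ.mem) :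
    Reaches w (memSize w l) ω collectStep σ 6 fun τ =>
      τ.mem = Function.update σ.mem (16 * b + 1) (candidate l ω P t u b) := by
  have hr : rowOf l ω t u < 2 ^ l := mulShift_lt hS.le_word _ _ _
  have hcube := hS.cube
  have hn := hS.n_le_cube
  have hn1 := hS.one_le_n
  have hidx := cellIdx_lt ht hr hb
  obtain ⟨hcount, hsumFst, hsumSnd⟩ := hmem t ht _ hr b hb
  have hle := ((hmem t ht _ hr b hb).le_cube hP hn1).2.2
  have hite : ∀ (p q : Prop) [Decidable p] [Decidable q],
      (if p then 1 else 0) * (if q then 1 else 0) ≤ 1 := by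
    intros
    split_ifs <;> simp
  refine Reaches.set rCell _
    (eval_idxExpr hS ht hr hb hp hsketch hrow (eval_reg hcol)) ?_
  refine hS.reaches_load rCount (eval_reg (by simp)) hidx (hQ := ?_)
  refine hS.reaches_load rSumFst (eval_reg (by simp)) hidx (hQ := ?_)
  refine hS.reaches_load rSumSnd (eval_reg (by simp)) hidx (hQ := ?_)
  refine hS.reaches_store (v := candidate l ω P t u b) (eval_reg (by simp [hcol]))
    (hS.two_pow_lt_cells hb) ?_ (hQ := Reaches.nil (T := 0) rfl)
  rw [candidate, ← hcount, ← hsumFst, ← hsumSnd]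
  refine eval_mul (eval_mul
    (eval_eq hS.word_ne_zero (eval_reg (by simp)) (eval_lit (by omega)))
    (eval_eq hS.word_ne_zero (eval_reg (by simp)) (eval_reg (by simp [hfst])))
    ((hite _ _).trans_lt (by omega))) (eval_add (eval_reg (by simp)) (eval_lit (by omega))
    (by omega)) ((Nat.mul_le_mul_right _ (hite _ _)).trans_lt (by omega))

lemma reaches_collect (hS : Sizes w l k n) (hp : ParamRegs w l σ.regs)
    (hsketch : σ.regs rSketch = t) (ht : t < w * w) (hfst : σ.regs rFst = u)
    (hrow : σ.regs rRow = rowOf l ω t u) (hP : P ⊆ Finset.range n ×ˢ Finset.range n)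
    (hmem : CellMem l ω P σ.mem) :
    Reaches w (memSize w l) ω (forLoop rCol rWidth collectStep) σ (2 ^ l * 9 + 3) fun τ =>
      TempMem l (candidate l ω P t u) τ.mem ∧ ∀ a, a % 16 ≠ 1 → τ.mem a = σ.mem a := by
  refine Reaches.forLoop hS.word_ne_zero (2 ^ l) hp.width hS.width_lt rfl rfl (by decide)
    (fun i τ => (∀ b < i, τ.mem (16 * b + 1) = candidate l ω P t u b) ∧
      ∀ a, a % 16 ≠ 1 → τ.mem a = σ.mem a) ⟨fun _ h => absurd h (by omega), fun _ _ => rfl⟩ ?_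
  rintro i hi τ hF hcol ⟨hI, hlow⟩
  refine (reaches_collectStep hS (hp.frame hF) ((hF.regs _ rfl).trans hsketch) ht
    ((hF.regs _ rfl).trans hfst) ((hF.regs _ rfl).trans hrow) hcol hi hP
    (CellMem.congr hmem fun a ha => hlow a (by omega))).weaken le_rfl fun υ _ hυ => ?_
  simp only [Config.setReg_mem, hυ, Function.update_apply]
  refine ⟨fun b hb => ?_, fun a ha => ?_⟩
  · rcases eq_or_ne b i with rfl | hne
    · simp
    · rw [if_neg (by omega)]
      exact hI b (by omega)
  · rw [if_neg (by omega)]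
    exact hlow a ha

/-- A candidate can only stand in its own column, so one look-up suffices to remove a vertex. -/
lemma reaches_unmarkStep (hS : Sizes w l k n) {i g x : ℕ} (hp : ParamRegs w l σ.regs)
    (hs : SeedRegs ω t σ.regs) (hedge : σ.regs rEdge = i) (hi : i < 2 ^ l)
    (hx : σ.mem (16 * i + g) = x) (hxn : x < n)
    (hcol : ∀ b < 2 ^ l, ∀ y, c b = y + 1 → colOf l ω t y = b) (hmem : TempMem l c σ.mem)
    (hg : g < 16 := by omega) :
    Reaches w (memSize w l) ω (unmarkStep g) σ 9 fun τ =>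
      TempMem l (fun b => if c b = x + 1 then 0 else c b) τ.mem ∧
      ∀ a, a % 16 ≠ 1 → τ.mem a = σ.mem a := by
  have hn := hS.n_lt
  have hlt := hS.two_pow_lt_cells hi
  have keep (h : ∀ b < 2 ^ l, c b ≠ x + 1) :
      TempMem l (fun b => if c b = x + 1 then 0 else c b) σ.mem ∧
        ∀ a, a % 16 ≠ 1 → σ.mem a = σ.mem a :=
    ⟨fun b hb => by simpa [h b hb] using hmem b hb, fun _ _ => rfl⟩
  refine hS.reaches_load rSnd (eval_reg hedge) hlt (hg := hg) (hQ := ?_)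
  rw [hx]
  refine Reaches.set rCol (colOf l ω t x) (eval_colExpr hS.word_ne_zero hp.setReg
    (by simp [hs.colMul]) (by simp [hs.colAdd]) (by simp [hs.sketch]) (eval_reg (by simp))) ?_
  refine Reaches.cons (T₁ := 6) (T₂ := 1) (Reaches.cond (T := 5) (eval_lt_ne_zero_iff
    hS.word_ne_zero (eval_reg (by simp)) (eval_reg (by simpa using hp.width)))
    (fun hq => ?_) (fun hq => Reaches.skip (keep fun b hb hc => hq (hcol b hb x hc ▸ hb))))
    fun τ _ h => Reaches.nil h
  refine hS.reaches_load rCount (eval_reg (by simp)) (hS.two_pow_lt_cells hq) (hQ := ?_)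
  refine Reaches.cons (T₁ := 3) (T₂ := 1) (Reaches.cond (T := 2) (eval_eq_ne_zero_iff
    hS.word_ne_zero (eval_reg (a := c (colOf l ω t x)) (by simp [hmem _ hq]))
    (eval_add (a := x) (eval_reg (by simp)) (eval_lit (by omega)) (by omega)))
    (fun heq => ?_) (fun hne => Reaches.skip (keep fun b hb hc => hne (hcol b hb x hc ▸ hc))))
    fun τ _ h => Reaches.nil h
  refine hS.reaches_store (v := 0) (eval_reg (by simp)) (hS.two_pow_lt_cells hq)
    (eval_lit (by omega)) (hQ := Reaches.nil ⟨fun b hb => ?_, fun a ha => ?_⟩)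
  · rcases eq_or_ne b (colOf l ω t x) with rfl | hne
    · simp [heq]
    · simp [hne, hmem b hb, show c b ≠ x + 1 from fun hc => hne (hcol b hb x hc).symm]
  · simp only [Config.setMem_mem]
    exact if_neg (by omega)

lemma reaches_unmark (hS : Sizes w l k n) {g : ℕ} (hp : ParamRegs w l σ.regs)
    (hs : SeedRegs ω t σ.regs) (hsize : σ.regs rSize = m) (hm : m ≤ 2 ^ l)
    (hn : ∀ i < m, σ.mem (16 * i + g) < n)
    (hcol : ∀ b < 2 ^ l, ∀ y, c b = y + 1 → colOf l ω t y = b) (hmem : TempMem l c σ.mem)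
    (hg : g = 2 ∨ g = 3) :
    Reaches w (memSize w l) ω (forLoop rEdge rSize (unmarkStep g)) σ (m * 12 + 3) fun τ =>
      TempMem l (unmarked (fun i => σ.mem (16 * i + g)) m c) τ.mem ∧
      ∀ a, a % 16 ≠ 1 → τ.mem a = σ.mem a := by
  refine Reaches.forLoop hS.word_ne_zero m hsize (hm.trans_lt hS.width_lt) rfl rfl (by decide)
    (fun j τ => TempMem l (unmarked (fun i => σ.mem (16 * i + g)) j c) τ.mem ∧
      ∀ a, a % 16 ≠ 1 → τ.mem a = σ.mem a)
    ⟨by rwa [unmarked_zero], fun _ _ => rfl⟩ ?_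
  rintro j hj τ hF hedge ⟨hI, hlow⟩
  refine (reaches_unmarkStep hS (hp.frame hF (by rcases hg with rfl | rfl <;> decide))
    (hs.frame hF (by rcases hg with rfl | rfl <;> decide)) hedge (by omega)
    (hlow (16 * j + g) (by omega)) (hn j hj)
    (fun b hb y h => hcol b hb y (unmarked_eq_succ_iff.1 h).1) hI).weaken le_rfl ?_
  rintro υ - ⟨h, hlow'⟩
  exact ⟨by rwa [unmarked_succ], fun a ha => (hlow' a ha).trans (hlow a ha)⟩

lemma reaches_pick (hS : Sizes w l k n) (hp : ParamRegs w l σ.regs)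
    (hmem : TempMem l c σ.mem) :
    Reaches w (memSize w l) ω (forLoop rCol rWidth pickStep) σ (2 ^ l * 8 + 3) fun τ =>
      (τ.regs rFound = σ.regs rFound ∧ ∀ b < 2 ^ l, c b = 0) ∨
      ∃ b < 2 ^ l, c b ≠ 0 ∧ τ.regs rFound = c b := by
  refine Reaches.forLoop hS.word_ne_zero (2 ^ l) hp.width hS.width_lt rfl rfl (by decide)
    (fun i τ => (τ.regs rFound = σ.regs rFound ∧ ∀ b < i, c b = 0) ∨
      ∃ b < i, c b ≠ 0 ∧ τ.regs rFound = c b) (.inl ⟨by simp, fun _ h => absurd h (by omega)⟩) ?_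
  intro i hi τ hF hcol hI
  refine hS.reaches_load rCount (eval_reg hcol) (hS.two_pow_lt_cells hi) (hQ := ?_)
  rw [show τ.mem = σ.mem from hF.mem rfl, hmem i hi]
  refine Reaches.cons (T₁ := 3) (T₂ := 1) (Reaches.cond (T := 2) (p := c i ≠ 0)
    (by rw [eval_reg (a := c i) (by simp)]) (fun hne => ?_) (fun h0 => Reaches.skip ?_))
    (fun τ _ h => Reaches.nil h)
  · exact Reaches.set rFound (c i) (eval_reg (by simp))
      (Reaches.nil (.inr ⟨i, by omega, hne, by simp⟩))
  · rcases hI with ⟨hsame, hzero⟩ | ⟨b, hb, h⟩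
    · refine .inl ⟨by simpa using hsame, fun b hb => ?_⟩
      rcases Nat.lt_succ_iff_lt_or_eq.1 hb with hb | rfl
      · exact hzero b hb
      · exact not_not.1 h0
    · exact .inr ⟨b, by omega, by simpa using h⟩

/-- The array left by the two passes over the stored matching holds the free candidates. -/
lemma reaches_freeCandidates (hS : Sizes w l k n) {M : ℕ → ℕ × ℕ} {c' : List Cmd}
    {T : ℕ} {Q : Config → Prop} (hp : ParamRegs w l σ.regs) (hs : SeedRegs ω t σ.regs)
    (hsize : σ.regs rSize = m) (hm : m ≤ 2 ^ l) (hM : storedEdge σ.mem = M)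
    (hn : ∀ i < m, (M i).1 < n ∧ (M i).2 < n)
    (hcol : ∀ b < 2 ^ l, ∀ y, c b = y + 1 → colOf l ω t y = b) (hmem : TempMem l c σ.mem)
    (h : ∀ τ, ParamRegs w l τ.regs → τ.regs rFound = σ.regs rFound →
      TempMem l (unmarked (fun i => (M i).2) m (unmarked (fun i => (M i).1) m c)) τ.mem →
      (∀ a, a % 16 ≠ 1 → τ.mem a = σ.mem a) → Reaches w (memSize w l) ω (block c') τ T Q) :
    Reaches w (memSize w l) ω
      (block (forLoop rEdge rSize (unmarkStep 2) :: forLoop rEdge rSize (unmarkStep 3) :: c')) σ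
      ((m * 12 + 3) + ((m * 12 + 3) + T)) Q := by
  subst hM
  refine Reaches.cons (reaches_unmark hS hp hs hsize hm (fun i hi => (hn i hi).1) hcol hmem
    (.inl rfl)) ?_
  rintro τ₁ hF₁ ⟨hmem₁, hlow₁⟩
  refine Reaches.cons (reaches_unmark hS (hp.frame hF₁) (hs.frame hF₁)
    ((hF₁.regs _ rfl).trans hsize) hm (fun i hi => ?_)
    (fun b hb y hy => hcol b hb y (unmarked_eq_succ_iff.1 hy).1) hmem₁ (.inr rfl)) ?_
  · rw [hlow₁ _ (by omega)]
    exact (hn i hi).2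
  rintro τ₂ hF₂ ⟨hmem₂, hlow₂⟩
  refine h τ₂ ((hp.frame hF₁).frame hF₂) ((hF₂.regs _ rfl).trans (hF₁.regs _ rfl)) ?_
    fun a ha => (hlow₂ a ha).trans (hlow₁ a ha)
  have hsnd : (fun i => τ₁.mem (16 * i + 3)) = fun i => (storedEdge σ.mem i).2 :=
    funext fun i => hlow₁ _ (by omega)
  rwa [hsnd] at hmem₂

lemma reaches_findStep (hS : Sizes w l k n) {M : ℕ → ℕ × ℕ} (hp : ParamRegs w l σ.regs)
    (hsketch : σ.regs rSketch = t) (ht : t < w * w) (hsize : σ.regs rSize = m)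
    (hm : m ≤ 2 ^ l) (hfst : σ.regs rFst = u) (hP : P ⊆ Finset.range n ×ˢ Finset.range n)
    (hseed : SeedMem ω σ.mem) (hmem : CellMem l ω P σ.mem) (hM : storedEdge σ.mem = M)
    (hn : ∀ i < m, (M i).1 < n ∧ (M i).2 < n) :
    Reaches w (memSize w l) ω findStep σ (2 ^ l * 17 + m * 24 + 18) fun τ =>
      ((τ.regs rFound = σ.regs rFound ∧ ∀ y, Recovered l ω P t u y → y ∈ matched M m) ∨
        ∃ y, τ.regs rFound = y + 1 ∧ Recovered l ω P t u y ∧ y ∉ matched M m) ∧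
      ∀ a, a % 16 ≠ 1 → τ.mem a = σ.mem a := by
  have hT : 2 ^ l * 17 + m * 24 + 18 =
      2 ^ l * 9 + 3 + (m * 12 + 3 + (m * 12 + 3 + (2 ^ l * 8 + 3 + 1))) + 1 + 4 := by omega
  rw [hT]
  refine reaches_loadSeeds hS ht hsketch hseed ?_
  have hp₀ := (((hp.setReg (i := rRowMul) (v := ω (4 * t))).setReg (i := rRowAdd)
    (v := ω (4 * t + 1))).setReg (i := rColMul) (v := ω (4 * t + 2))).setReg (i := rColAdd)
    (v := ω (4 * t + 3))
  refine Reaches.set rRow (rowOf l ω t u)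
    (eval_rowExpr hp₀ (by simp) (by simp) (eval_reg (by simp [hfst]))) ?_
  refine Reaches.cons (reaches_collect (u := u) hS hp₀.setReg (by simp [hsketch]) ht
    (by simp [hfst]) (by simp) hP hmem) ?_
  rintro τ₁ hF₁ ⟨hmem₁, hlow₁⟩
  refine reaches_freeCandidates hS (hp₀.setReg.frame hF₁)
    (SeedRegs.frame ⟨by simp [hsketch], by simp, by simp⟩ hF₁)
    ((hF₁.regs _ rfl).trans (by simp [hsize])) hm
    ((storedEdge_congr fun a ha => hlow₁ a (by omega)).trans hM) hn
    (fun b hb y hy => ((candidate_eq_succ_iff hb).1 hy).1) hmem₁ fun τ₂ hp₂ hfound hmem₂ hlow₂ => ?_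
  refine Reaches.cons (reaches_pick hS hp₂ hmem₂) fun τ₃ hF₃ h₃ => Reaches.nil (T := 0) ⟨?_, ?_⟩
  · rcases h₃ with ⟨hsame, hzero⟩ | ⟨b, hb, hne, hfound₃⟩
    · refine .inl ⟨?_, fun y hy => ?_⟩
      · rw [hsame, hfound, hF₁.regs _ rfl]
        simp
      · by_contra hfree
        have := unmarked_unmarked_eq_succ_iff.2
          ⟨(candidate_eq_succ_iff hy.1).2 ⟨rfl, hy⟩, hfree⟩
        exact absurd (this.symm.trans (hzero _ hy.1)) y.succ_ne_zero
    · obtain ⟨y, hy⟩ := Nat.exists_eq_succ_of_ne_zero hne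
      obtain ⟨hcand, hfree⟩ := unmarked_unmarked_eq_succ_iff.1 hy
      exact .inr ⟨y, hfound₃.trans hy, ((candidate_eq_succ_iff hb).1 hcand).2, hfree⟩
  · intro a ha
    rw [hF₃.mem rfl, hlow₂ a ha, hlow₁ a ha]
    simp

theorem reaches_findFree (hS : Sizes w l k n) {M : ℕ → ℕ × ℕ} (hp : ParamRegs w l σ.regs)
    (hsize : σ.regs rSize = m) (hm : m ≤ 2 ^ l) (hfst : σ.regs rFst = u)
    (hP : P ⊆ Finset.range n ×ˢ Finset.range n) (hseed : SeedMem ω σ.mem)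
    (hmem : CellMem l ω P σ.mem) (hM : storedEdge σ.mem = M)
    (hn : ∀ i < m, (M i).1 < n ∧ (M i).2 < n) :
    Reaches w (memSize w l) ω findFree σ (w * w * (2 ^ l * 17 + m * 24 + 21) + 5) fun τ =>
      ((τ.regs rFound = 0 ∧ ∀ t < w * w, ∀ y, Recovered l ω P t u y → y ∈ matched M m) ∨
        ∃ t < w * w, ∃ y, τ.regs rFound = y + 1 ∧ Recovered l ω P t u y ∧ y ∉ matched M m) ∧
      ∀ a, a % 16 ≠ 1 → τ.mem a = σ.mem a := by
  refine Reaches.set (T := w * w * (2 ^ l * 17 + m * 24 + 21) + 4) rFound 0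
    (eval_lit (Nat.two_pow_pos w)) ?_
  refine Reaches.cons (T₁ := w * w * (2 ^ l * 17 + m * 24 + 21) + 3) (T₂ := 1)
    (Reaches.forLoop (T := 2 ^ l * 17 + m * 24 + 18) hS.word_ne_zero (w * w) (by simp [hp.reps])
      hS.reps_lt rfl rfl (by decide) (fun j τ =>
        ((τ.regs rFound = 0 ∧ ∀ t < j, ∀ y, Recovered l ω P t u y → y ∈ matched M m) ∨
          ∃ t < j, ∃ y, τ.regs rFound = y + 1 ∧ Recovered l ω P t u y ∧ y ∉ matched M m) ∧
        ∀ a, a % 16 ≠ 1 → τ.mem a = σ.mem a)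
      ⟨.inl ⟨by simp, fun _ h => absurd h (by omega)⟩, fun _ _ => rfl⟩ ?_)
    (fun _ _ h => Reaches.nil (T := 0) h)
  rintro t ht τ hF hsketch ⟨hI, hlow⟩
  refine (reaches_findStep (u := u) hS (hp.setReg.frame hF) hsketch ht
    ((hF.regs _ rfl).trans (by simp [hsize])) hm ((hF.regs _ rfl).trans (by simp [hfst])) hP
    (SeedMem.congr hseed fun a ha _ => hlow a (by omega))
    (CellMem.congr hmem fun a ha => hlow a (by omega))
    ((storedEdge_congr fun a ha => hlow a (by omega)).trans hM) hn).weaken le_rfl ?_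
  rintro υ - ⟨h, hlow'⟩
  refine ⟨?_, fun a ha => (hlow' a ha).trans (hlow a ha)⟩
  rcases h with ⟨hsame, hmatched⟩ | ⟨y, hy⟩
  · rcases hI with ⟨hzero, hall⟩ | ⟨t', ht', y, hfound, h⟩
    · refine .inl ⟨by simp [hsame, hzero], fun t' ht' y hy => ?_⟩
      rcases Nat.lt_succ_iff_lt_or_eq.1 ht' with ht' | rfl
      · exact hall t' ht' y hy
      · exact hmatched y hy
    · exact .inr ⟨t', by omega, y, by simp [hsame, hfound], h⟩
  · exact .inr ⟨t, by omega, y, by simpa using hy⟩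

end FindFree

/-! ## Matchings as sequences of edges -/

/-- The edges `M 0, …, M (m - 1)` form a matching in `P`. -/
structure IsMatchingSeq (P : Finset (ℕ × ℕ)) (M : ℕ → ℕ × ℕ) (m : ℕ) : Prop where
  edge : ∀ i < m, M i ∈ P
  disjoint : (Finset.range m : Set ℕ).PairwiseDisjoint fun i => ends (M i)

/-- `X` meets all edges of `P`. -/
def VertexCover (P : Finset (ℕ × ℕ)) (X : Finset ℕ) : Prop :=
  ∀ x y, (x, y) ∈ P → x ∈ X ∨ y ∈ X

/-- Simple graphs on `{0, …, n - 1}` with a vertex cover of size at most `2 * k`, given by their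
ordered pairs of adjacent vertices. -/
structure CoveredGraph (n k : ℕ) (P : Finset (ℕ × ℕ)) : Prop where
  subset : P ⊆ Finset.range n ×ˢ Finset.range n
  symm : ∀ x y, (x, y) ∈ P → (y, x) ∈ P
  irrefl : ∀ x, (x, x) ∉ P
  cover : ∃ X : Finset ℕ, X.card ≤ 2 * k ∧ VertexCover P X

section Matchings

variable {P P' : Finset (ℕ × ℕ)} {M M' : ℕ → ℕ × ℕ} {m p x : ℕ}

lemma mem_ends {e : ℕ × ℕ} : x ∈ ends e ↔ x = e.1 ∨ x = e.2 := by simp [ends]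

lemma mem_matched : x ∈ matched M m ↔ ∃ i < m, x ∈ ends (M i) := by simp [matched]

lemma matched_congr (h : ∀ i < m, M' i = M i) : matched M' m = matched M m :=
  Finset.biUnion_congr rfl fun i hi => by rw [h i (Finset.mem_range.1 hi)]

lemma matched_succ (M : ℕ → ℕ × ℕ) (m : ℕ) : matched M (m + 1) = ends (M m) ∪ matched M m := by
  rw [matched, Finset.range_add_one, Finset.biUnion_insert, matched]

lemma card_matched_le (M : ℕ → ℕ × ℕ) (m : ℕ) : (matched M m).card ≤ m * 2 := by
  simpa [matched] using Finset.card_biUnion_le_card_mul (Finset.range m) (fun i => ends (M i)) 2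
    fun _ _ => Finset.card_le_two

lemma IsMatchingSeq.le_card_of_vertexCover (h : IsMatchingSeq P M m) {X : Finset ℕ}
    (hX : VertexCover P X) : m ≤ X.card := by
  have hdisj : (Finset.range m : Set ℕ).PairwiseDisjoint fun i => ends (M i) ∩ X :=
    h.disjoint.mono fun _ => Finset.inter_subset_left
  have hne (i) (hi : i ∈ Finset.range m) : (ends (M i) ∩ X).Nonempty :=
    (hX _ _ (h.edge i (Finset.mem_range.1 hi))).elim
      (fun hx => ⟨_, Finset.mem_inter.2 ⟨mem_ends.2 (.inl rfl), hx⟩⟩)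
      (fun hy => ⟨_, Finset.mem_inter.2 ⟨mem_ends.2 (.inr rfl), hy⟩⟩)
  calc m = (Finset.range m).card := (Finset.card_range m).symm
    _ ≤ _ := Finset.card_le_card_biUnion hdisj hne
    _ ≤ X.card := Finset.card_le_card (Finset.biUnion_subset.2 fun _ _ => Finset.inter_subset_right)

lemma IsMatchingSeq.le_of_coveredGraph {n k : ℕ} (h : IsMatchingSeq P M m)
    (hP : CoveredGraph n k P) : m ≤ 2 * k := by
  obtain ⟨X, hcard, hX⟩ := hP.cover
  exact (h.le_card_of_vertexCover hX).trans hcard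

lemma IsMatchingSeq.mono (h : IsMatchingSeq P M m) (hP : ∀ i < m, M i ∈ P') :
    IsMatchingSeq P' M m :=
  ⟨hP, h.disjoint⟩

lemma IsMatchingSeq.append (h : IsMatchingSeq P M m) (hM : ∀ i < m, M' i = M i)
    (he : M' m ∈ P) (hfree : Disjoint (ends (M' m)) (matched M m)) :
    IsMatchingSeq P M' (m + 1) := by
  refine ⟨fun i hi => ?_, ?_⟩
  · rcases Nat.lt_succ_iff_lt_or_eq.1 hi with hi | rfl
    · exact hM i hi ▸ h.edge i hi
    · exact he
  · rw [Finset.range_add_one, Finset.coe_insert, Set.pairwiseDisjoint_insert]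
    refine ⟨fun i hi j hj hij => ?_, fun j hj _ => ?_⟩
    · simp only [Function.onFun, hM i (by simpa using hi), hM j (by simpa using hj)]
      exact h.disjoint hi hj hij
    · rw [hM j (by simpa using hj)]
      exact (Finset.disjoint_biUnion_right ..).1 hfree j hj

section SwapRemove

variable (hM : IsMatchingSeq P M (m + 1)) (hp : p < m + 1)
  (hM' : ∀ i < m, M' i = M (if i = p then m else i))

include hM hp hM'

lemma matched_swapRemove : matched M' m = matched M (m + 1) \ ends (M p) := by
  ext z
  simp only [Finset.mem_sdiff, mem_matched]
  constructor
  · rintro ⟨i, hi, hz⟩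
    rw [hM' i hi] at hz
    refine ⟨⟨_, by split_ifs <;> omega, hz⟩, Finset.disjoint_left.1 (hM.disjoint ?_ ?_ ?_) hz⟩ <;>
    grind
  · rintro ⟨⟨i, hi, hz⟩, hzp⟩
    have hip : i ≠ p := by
      rintro rfl
      exact hzp hz
    rcases Nat.lt_succ_iff_lt_or_eq.1 hi with hi | rfl
    · exact ⟨i, hi, by rwa [hM' i hi, if_neg hip]⟩
    · exact ⟨p, by omega, by rwa [hM' p (by omega), if_pos rfl]⟩

lemma IsMatchingSeq.swapRemove (hP : ∀ e ∈ P, Disjoint (ends e) (ends (M p)) → e ∈ P') :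
    IsMatchingSeq P' M' m := by
  refine ⟨fun i hi => ?_, fun i hi j hj hij => ?_⟩
  · rw [hM' i hi]
    refine hP _ (hM.edge _ ?_) (hM.disjoint ?_ ?_ ?_) <;> grind
  · simp only [Function.onFun, hM' i (by simpa using hi), hM' j (by simpa using hj)]
    refine hM.disjoint ?_ ?_ ?_ <;> grind

end SwapRemove

end Matchings

/-! ## Repairing a matching after a deletion -/

/-- The neighbours of a vertex. -/
def nbrs (P : Finset (ℕ × ℕ)) (u : ℕ) : Finset ℕ := (P.filter fun p => p.1 = u).image Prod.snd

open Classical in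
/-- The sketches suffice for finding a new partner of `u`: together they recover all neighbours of
small degree, or a single one recovers more neighbours than there are matched vertices. -/
def Informative {w : ℕ} (l k : ℕ) (ω : ℕ → Fin (2 ^ w)) (P : Finset (ℕ × ℕ)) (u : ℕ) : Prop :=
  (∀ y ∈ nbrs P u, (nbrs P y).card ≤ 4 * k → ∃ t < w * w, Recovered l ω P t u y) ∨
  ∃ t < w * w, 4 * k < ((nbrs P u).filter fun y => Recovered l ω P t u y).card

/-- Effect on the set `V` of matched vertices of the attempt to match `u` with a recovered
neighbour. -/
def Rematch {w : ℕ} (l : ℕ) (ω : ℕ → Fin (2 ^ w)) (P : Finset (ℕ × ℕ)) (u : ℕ)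
    (V V' : Finset ℕ) : Prop :=
  (V' = V ∧ ∀ t < w * w, ∀ y, Recovered l ω P t u y → y ∈ V) ∨
  ∃ y ∉ V, (u, y) ∈ P ∧ V' = {u, y} ∪ V

section Rematching

variable {w l k u v y : ℕ} {ω : ℕ → Fin (2 ^ w)} {P P' : Finset (ℕ × ℕ)} {V V' V₁ V₂ : Finset ℕ}

lemma mem_nbrs : y ∈ nbrs P u ↔ (u, y) ∈ P := by simp [nbrs]

lemma VertexCover.nbrs_subset (h : VertexCover P V) (hy : y ∉ V) : nbrs P y ⊆ V :=
  fun _ hx => (h _ _ (mem_nbrs.1 hx)).resolve_left hy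

lemma VertexCover.mono (h : VertexCover P V) (hP : P' ⊆ P) (hV : V ⊆ V') : VertexCover P' V' :=
  fun x y hxy => (h x y (hP hxy)).imp (@hV _) (@hV _)

lemma Rematch.subset (h : Rematch l ω P u V V') : V ⊆ V' := by
  rcases h with ⟨rfl, -⟩ | ⟨y, -, -, rfl⟩
  · exact subset_rfl
  · exact Finset.subset_union_right

lemma Rematch.notMem (h : Rematch l ω P u V V') (hv : v ∉ V) (huv : v ≠ u) (hP : (u, v) ∉ P) :
    v ∉ V' := by
  rcases h with ⟨rfl, -⟩ | ⟨y, -, hy, rfl⟩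
  · exact hv
  · have : v ≠ y := by rintro rfl; exact hP hy
    simp [huv, this, hv]

lemma Rematch.mem_or_mem_of_informative (h : Rematch l ω P u V V') (hu : Informative l k ω P u)
    (hV : V.card ≤ 4 * k) (hy : (u, y) ∈ P) (hdeg : (nbrs P y).card ≤ 4 * k) :
    u ∈ V' ∨ y ∈ V' := by
  classical
  rcases h with ⟨rfl, hall⟩ | ⟨z, -, -, rfl⟩
  · rcases hu with hu | ⟨t, ht, hmany⟩
    · obtain ⟨t, ht, hrec⟩ := hu y (mem_nbrs.2 hy) hdeg
      exact .inr (hall t ht y hrec)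
    · have := Finset.card_le_card (s := (nbrs P u).filter fun y => Recovered l ω P t u y)
        fun y hy => hall t ht y (Finset.mem_filter.1 hy).2
      omega
  · simp

/-- A vertex outside the vertex cover `V` has all its neighbours in `V`, hence small degree. So an
edge at `u` or `v` that remains uncovered would have been found in the search for a partner. -/
theorem VertexCover.rematch (hV : VertexCover P V) (hP : P' ⊆ P)
    (hsymm : ∀ x y, (x, y) ∈ P' → (y, x) ∈ P') (hirrefl : ∀ x, (x, x) ∉ P') (huv : (u, v) ∉ P')
    (h₁ : Rematch l ω P' u (V \ {u, v}) V₁) (h₂ : Rematch l ω P' v V₁ V₂)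
    (hV₀ : V.card ≤ 4 * k) (hV₁ : V₁.card ≤ 4 * k)
    (hu : Informative l k ω P' u) (hv : Informative l k ω P' v) : VertexCover P' V₂ := by
  have hsub : V \ {u, v} ⊆ V₂ := h₁.subset.trans h₂.subset
  have at_freed (x y) (hxy : (x, y) ∈ P') (hx : x = u ∨ x = v) : x ∈ V₂ ∨ y ∈ V₂ := by
    by_cases hy : y ∈ V
    · have hyu : y ≠ u := by grind
      have hyv : y ≠ v := by grind
      exact .inr (hsub (by simp [hy, hyu, hyv]))
    have hdeg : (nbrs P' y).card ≤ 4 * k :=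
      (Finset.card_le_card ((hV.mono hP subset_rfl).nbrs_subset hy)).trans hV₀
    rcases hx with rfl | rfl
    · exact (h₁.mem_or_mem_of_informative hu
        ((Finset.card_le_card Finset.sdiff_subset).trans hV₀) hxy hdeg).imp
        (fun h => h₂.subset h) fun h => h₂.subset h
    · exact h₂.mem_or_mem_of_informative hv hV₁ hxy hdeg
  have of_mem (x y) (hxy : (x, y) ∈ P') (hx : x ∈ V) : x ∈ V₂ ∨ y ∈ V₂ := by
    by_cases hxuv : x = u ∨ x = v
    · exact at_freed x y hxy hxuv
    · exact .inl (hsub (by simpa [hx] using hxuv))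
  intro x y hxy
  exact (hV x y (hP hxy)).elim (of_mem x y hxy) fun hy => (of_mem y x (hsymm _ _ hxy) hy).symm

end Rematching

/-! ## The update program -/

/-- Append an edge to the stored matching. -/
def appendEdge (x y : Expr) : Cmd :=
  block [.store (addr (.reg rSize) 2) x, .store (addr (.reg rSize) 3) y,
    .set rSize (.reg rSize + 1), .store 48 (.reg rSize)]

/-- Try to match the vertex in register `r`. -/
def rematch (r : ℕ) : Cmd :=
  block [.set rFst (.reg r), findFree,
    .cond (.reg rFound) (appendEdge (.reg rFst) (.reg rFound - 1)) .skip]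

/-- Put the current index plus one into `rPos` if the stored edge passes the test. -/
def searchStep (test : Expr) : Cmd :=
  block [.load rFst (addr (.reg rEdge) 2), .load rSnd (addr (.reg rEdge) 3),
    .cond test (block [.set rPos (.reg rEdge + 1)]) .skip]

/-- Put one more than the index of a stored edge that passes the test into `rPos`, or `0` if there
is none. -/
def search (test : Expr) : Cmd := block [.set rPos 0, forLoop rEdge rSize (searchStep test)]

/-- Does the stored edge have an end point in common with the updated edge? -/
def touches : Expr :=
  .bin .eq (.reg rFst) (.reg rLeft) + .bin .eq (.reg rFst) (.reg rRight) +
    (.bin .eq (.reg rSnd) (.reg rLeft) + .bin .eq (.reg rSnd) (.reg rRight))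

/-- Is the stored edge the updated edge? -/
def coincides : Expr :=
  .bin .eq (.reg rFst) (.reg rLeft) * .bin .eq (.reg rSnd) (.reg rRight) +
    .bin .eq (.reg rFst) (.reg rRight) * .bin .eq (.reg rSnd) (.reg rLeft)

/-- Match the end points of a new edge if both are free. -/
def insertEdge : Cmd :=
  block [search touches, .cond (.reg rPos) .skip (appendEdge (.reg rLeft) (.reg rRight))]

/-- Overwrite the stored edge number `rPos - 1` with the last one. -/
def removeEdge : Cmd :=
  block [.set rSize (.reg rSize - 1), .load rFst (addr (.reg rSize) 2),
    .load rSnd (addr (.reg rSize) 3), .store (addr (.reg rPos - 1) 2) (.reg rFst),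
    .store (addr (.reg rPos - 1) 3) (.reg rSnd), .store 48 (.reg rSize)]

/-- Repair the matching after the deletion of an edge. -/
def deleteEdge : Cmd :=
  block [search coincides,
    .cond (.reg rPos) (block [removeEdge, rematch rLeft, rematch rRight]) .skip]

/-- Insert or delete an edge, in both orientations, in the sketches. -/
def updateSketches : Cmd :=
  block [.set rFst (.reg rLeft), .set rSnd (.reg rRight), toggleSketches,
    .set rFst (.reg rRight), .set rSnd (.reg rLeft), toggleSketches]

/-- Adapt the matching to the update of the graph. -/
def updateMatching : Cmd := .cond (.reg rOp) deleteEdge insertEdge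

/-- The update program. -/
def updateProgram : Cmd :=
  block [.load rWidth 0, .load rWord 16, .load rShift 32, .load rSize 48,
    .set rReps (.reg rWord * .reg rWord), updateSketches, updateMatching]

/-- Everything in memory but the matching and the temporary array. -/
structure BaseMem {w : ℕ} (l : ℕ) (ω : ℕ → Fin (2 ^ w)) (P : Finset (ℕ × ℕ)) (mem : ℕ → ℕ) :
    Prop where
  width : mem 0 = 2 ^ l
  word : mem 16 = w
  shift : mem 32 = w - l
  seeds : SeedMem ω mem
  cells : CellMem l ω P mem

/-- The memory between updates: it represents the graph `P` and a matching of size `m` in it. -/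
structure Invariant {w : ℕ} (l : ℕ) (ω : ℕ → Fin (2 ^ w)) (P : Finset (ℕ × ℕ)) (mem : ℕ → ℕ)
    (m : ℕ) : Prop where
  base : BaseMem l ω P mem
  size : mem 48 = m
  stored : IsMatchingSeq P (storedEdge mem) m

/-- The invariant together with the contents of the registers during an update. -/
structure Live {w : ℕ} (l : ℕ) (ω : ℕ → Fin (2 ^ w)) (P : Finset (ℕ × ℕ)) (σ : Config) (m : ℕ) :
    Prop extends Invariant l ω P σ.mem m where
  params : ParamRegs w l σ.regs
  count : σ.regs rSize = m

section Update

variable {w l k n m u v : ℕ} {ω : ℕ → Fin (2 ^ w)} {P : Finset (ℕ × ℕ)} {σ τ : Config}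
  {mem mem' : ℕ → ℕ}

lemma BaseMem.congr (h : BaseMem l ω P mem)
    (h' : ∀ a, a % 16 = 0 ∨ 4 ≤ a % 16 → a ≠ 48 → mem' a = mem a) : BaseMem l ω P mem' :=
  ⟨(h' _ (by omega) (by omega)).trans h.width, (h' _ (by omega) (by omega)).trans h.word,
    (h' _ (by omega) (by omega)).trans h.shift,
    SeedMem.congr h.seeds fun a _ _ => h' a (by omega) (by omega),
    CellMem.congr h.cells fun a _ => h' a (by omega) (by omega)⟩

lemma Live.frame {a : Cmd} (h : Live l ω P σ m) (hF : Frame a σ τ)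
    (hmem : ∀ a, a % 16 ≠ 1 → τ.mem a = σ.mem a)
    (ha : ∀ r ∈ [rWidth, rWord, rShift, rReps], a.writes r = false := by decide)
    (ha' : a.writes rSize = false := by decide) : Live l ω P τ m :=
  ⟨⟨h.base.congr fun a _ _ => hmem a (by omega), (hmem 48 (by omega)).trans h.size,
    (storedEdge_congr fun a _ => hmem a (by omega)) ▸ h.stored⟩,
    h.params.frame hF ha, (hF.regs _ ha').trans h.count⟩

namespace Sizes

lemma const_lt_memSize (hS : Sizes w l k n) {c : ℕ} (hc : c < 4096 := by omega) :
    c < memSize w l := by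
  have := two_pow_le_cells hS.word_ne_zero l
  have := hS.le_width
  have := hS.one_le_k
  rw [memSize]
  omega

lemma const_lt (hS : Sizes w l k n) {c : ℕ} (hc : c < 4096 := by omega) : c < 2 ^ w := by
  have := hS.const_lt_memSize hc
  have := hS.space
  omega

lemma matching_lt_width (hS : Sizes w l k n) (hm : m ≤ 2 * k) : m < 2 ^ l := by
  have := hS.le_width
  have := hS.one_le_k
  omega

lemma matching_lt_cells (hS : Sizes w l k n) (hm : m ≤ 2 * k) : m < cells w l :=
  hS.two_pow_lt_cells (hS.matching_lt_width hm)

lemma succ_matching_lt (hS : Sizes w l k n) (hm : m ≤ 2 * k) : m + 1 < 2 ^ w := by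
  have := hS.matching_lt_width hm
  have := hS.cells_lt
  have := hS.matching_lt_cells hm
  omega

end Sizes

lemma reaches_appendEdge (hS : Sizes w l k n) (hP : CoveredGraph n k P) (h : Live l ω P σ m)
    {x y : ℕ} {ex ey : Expr} (hx : ex.eval w σ.regs = x) (hy : ey.eval w σ.regs = y)
    (hxy : (x, y) ∈ P) (hfree : Disjoint {x, y} (matched (storedEdge σ.mem) m)) :
    Reaches w (memSize w l) ω (appendEdge ex ey) σ 5 fun τ =>
      Live l ω P τ (m + 1) ∧
        matched (storedEdge τ.mem) (m + 1) = {x, y} ∪ matched (storedEdge σ.mem) m := by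
  have hm := h.stored.le_of_coveredGraph hP
  have hcell := hS.matching_lt_cells hm
  refine hS.reaches_store (eval_reg h.count) hcell hx (hQ := ?_)
  refine hS.reaches_store (eval_reg (by simp [h.count])) hcell hy (hQ := ?_)
  refine Reaches.set rSize (m + 1) (eval_add (eval_reg (by simp [h.count]))
    (eval_lit hS.const_lt) (hS.succ_matching_lt hm)) ?_
  refine Reaches.store 48 (m + 1) (eval_lit hS.const_lt) hS.const_lt_memSize
    (eval_reg (by simp)) ?_
  refine Reaches.nil (T := 0) ?_
  set τ := ((((σ.setMem (16 * m + 2) x).setMem (16 * m + 3) y).setReg rSize (m + 1)).setMem 48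
    (m + 1)) with hτ
  have hmem (a) (h₂ : a ≠ 16 * m + 2) (h₃ : a ≠ 16 * m + 3) (h₄₈ : a ≠ 48) :
      τ.mem a = σ.mem a := by simp [hτ, h₂, h₃, h₄₈]
  have hsame : ∀ i < m, storedEdge τ.mem i = storedEdge σ.mem i := fun i hi =>
    Prod.ext (hmem _ (by omega) (by omega) (by omega)) (hmem _ (by omega) (by omega) (by omega))
  have hnew : storedEdge τ.mem m = (x, y) := by
    have h₂ : 16 * m + 2 ≠ 48 := by omega
    have h₃ : 16 * m + 3 ≠ 48 := by omega
    simp [storedEdge, hτ, h₂, h₃]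
  refine ⟨⟨⟨h.base.congr fun a ha h₄₈ => hmem a (by omega) (by omega) h₄₈, by simp [hτ],
    h.stored.append hsame (hnew ▸ hxy) (by rwa [hnew])⟩, h.params.setReg, by simp [hτ]⟩, ?_⟩
  rw [matched_succ, hnew, matched_congr hsame, ends]

lemma reaches_rematch (hS : Sizes w l k n) {r : ℕ} (hP : CoveredGraph n k P)
    (h : Live l ω P σ m) (hr : σ.regs r = u) (hu : u ∉ matched (storedEdge σ.mem) m) :
    Reaches w (memSize w l) ω (rematch r) σ (w * w * (2 ^ l * 17 + 2 * k * 24 + 21) + 13)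
      fun τ => ∃ m', Live l ω P τ m' ∧
        Rematch l ω P u (matched (storedEdge σ.mem) m) (matched (storedEdge τ.mem) m') := by
  have hm := h.stored.le_of_coveredGraph hP
  have hbound (i) (hi : i < m) : (storedEdge σ.mem i).1 < n ∧ (storedEdge σ.mem i).2 < n := by
    simpa using hP.subset (h.stored.edge i hi)
  have htime : w * w * (2 ^ l * 17 + m * 24 + 21) ≤ w * w * (2 ^ l * 17 + 2 * k * 24 + 21) := by
    gcongr
  refine Reaches.weaken (T₁ := w * w * (2 ^ l * 17 + m * 24 + 21) + 5 + 7 + 1) ?_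
    (by omega) fun _ _ h => h
  refine Reaches.set (T := w * w * (2 ^ l * 17 + m * 24 + 21) + 12) rFst u (eval_reg hr) ?_
  refine Reaches.cons (T₁ := w * w * (2 ^ l * 17 + m * 24 + 21) + 5) (T₂ := 7)
    (reaches_findFree hS (u := u) h.params.setReg (by simp [h.count])
    (hS.matching_lt_width hm).le (by simp) hP.subset h.base.seeds h.base.cells rfl hbound) ?_
  rintro τ hF ⟨hfound, hmem⟩
  have hlive : Live l ω P τ m :=
    (Live.frame (σ := σ.setReg rFst u) ⟨h.toInvariant, h.params.setReg, by simp [h.count]⟩ hF hmem)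
  have hM : storedEdge τ.mem = storedEdge σ.mem := storedEdge_congr fun a _ => hmem a (by omega)
  refine Reaches.cons (T₁ := 6) (T₂ := 1) (Reaches.cond Iff.rfl (fun hne => ?_) fun hne => ?_)
    (fun τ _ h => Reaches.nil (T := 0) h)
  · obtain ⟨t, -, y, hy, hrec, hfree⟩ := hfound.resolve_left fun h => hne h.1
    refine (reaches_appendEdge hS hP hlive (x := u) (y := y)
      (eval_reg ((hF.regs _ rfl).trans (by simp))) ?_ hrec.mem ?_).weaken le_rfl ?_
    · have hyn : y < n := by simpa using (Finset.mem_product.1 (hP.subset hrec.mem)).2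
      have := hS.n_lt
      exact eval_sub (a := y + 1) (eval_reg hy) (eval_lit hS.const_lt) (by omega)
    · rw [hM, Finset.disjoint_insert_left, Finset.disjoint_singleton_left]
      exact ⟨hu, hfree⟩
    · rintro υ - ⟨hlive', hmatched⟩
      exact ⟨m + 1, hlive', .inr ⟨y, hfree, hrec.mem, hM ▸ hmatched⟩⟩
  · rcases hfound with ⟨-, hall⟩ | ⟨t, -, y, hy, -⟩
    · exact Reaches.skip ⟨m, hlive, .inl ⟨by rw [hM], hall⟩⟩
    · exact absurd (by simp [Expr.eval, hy]) hne

lemma reaches_search (hS : Sizes w l k n) {test : Expr} (hsize : σ.regs rSize = m)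
    (hm : m ≤ 2 * k) (hu : σ.regs rLeft = u) (hv : σ.regs rRight = v) {p : ℕ × ℕ → Prop}
    (htest : ∀ ρ e, ρ rLeft = u → ρ rRight = v → ρ rFst = e.1 → ρ rSnd = e.2 →
      (test.eval w ρ ≠ 0 ↔ p e)) :
    Reaches w (memSize w l) ω (search test) σ (m * 9 + 5) fun τ =>
      (τ.regs rPos = 0 ∧ ∀ i < m, ¬ p (storedEdge σ.mem i)) ∨
        ∃ i < m, τ.regs rPos = i + 1 ∧ p (storedEdge σ.mem i) := by
  have hm' := hS.succ_matching_lt hm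
  refine Reaches.set (T := m * 9 + 4) rPos 0 (eval_lit hS.const_lt) ?_
  refine Reaches.cons (T₁ := m * 9 + 3) (T₂ := 1) (Reaches.forLoop (T := 6) hS.word_ne_zero m
    (by simp [hsize]) (by omega) rfl rfl (by decide) (fun j τ =>
      (τ.regs rPos = 0 ∧ ∀ i < j, ¬ p (storedEdge σ.mem i)) ∨
        ∃ i < j, τ.regs rPos = i + 1 ∧ p (storedEdge σ.mem i))
    (.inl ⟨by simp, fun _ h => absurd h (by omega)⟩) ?_) fun _ _ h => Reaches.nil (T := 0) h
  rintro i hi τ hF hedge hI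
  have hmem : τ.mem = σ.mem := hF.mem rfl
  have hleft : τ.regs rLeft = u := (hF.regs _ rfl).trans (by simp [hu])
  have hright : τ.regs rRight = v := (hF.regs _ rfl).trans (by simp [hv])
  have hcell := hS.matching_lt_cells (hi.le.trans hm)
  refine hS.reaches_load rFst (eval_reg hedge) hcell (hQ := ?_)
  refine hS.reaches_load rSnd (eval_reg (by simp [hedge])) hcell (hQ := ?_)
  refine Reaches.cons (T₁ := 3) (T₂ := 1) (Reaches.cond (T := 2)
    (htest _ (storedEdge σ.mem i) (by simp [hleft]) (by simp [hright])
      (by simp [storedEdge, hmem]) (by simp [storedEdge, hmem])) (fun hp => ?_) fun hp => ?_)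
    fun _ _ h => Reaches.nil (T := 0) h
  · refine Reaches.set rPos (i + 1)
      (eval_add (eval_reg (by simp [hedge])) (eval_lit hS.const_lt) (by omega)) ?_
    exact Reaches.nil (T := 0) (.inr ⟨i, by omega, by simp, hp⟩)
  · refine Reaches.skip ?_
    rcases hI with ⟨hzero, hall⟩ | ⟨j, hj, hpos, hpj⟩
    · refine .inl ⟨by simpa using hzero, fun j hj => ?_⟩
      rcases Nat.lt_succ_iff_lt_or_eq.1 hj with hj | rfl
      · exact hall j hj
      · exact hp
    · exact .inr ⟨j, by omega, by simpa using hpos, hpj⟩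

lemma eval_touches_ne_zero_iff (hS : Sizes w l k n) {ρ : ℕ → ℕ} {e : ℕ × ℕ} (hu : ρ rLeft = u)
    (hv : ρ rRight = v) (hfst : ρ rFst = e.1) (hsnd : ρ rSnd = e.2) :
    touches.eval w ρ ≠ 0 ↔ ¬ Disjoint (ends e) {u, v} := by
  have heq (a b : ℕ) : (if a = b then 1 else 0) ≤ 1 := by split_ifs <;> omega
  have eval_pair (a : ℕ) (f : Expr) (hf : f.eval w ρ = a) :
      (.bin .eq f (.reg rLeft) + .bin .eq f (.reg rRight) : Expr).eval w ρ =
        (if a = u then 1 else 0) + (if a = v then 1 else 0) :=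
    eval_add (eval_eq hS.word_ne_zero hf (eval_reg hu))
      (eval_eq hS.word_ne_zero hf (eval_reg hv))
      ((Nat.add_le_add (heq a u) (heq a v)).trans_lt hS.const_lt)
  rw [touches, eval_add (eval_pair _ _ (eval_reg hfst)) (eval_pair _ _ (eval_reg hsnd))
    (lt_of_le_of_lt (Nat.add_le_add (Nat.add_le_add (heq _ _) (heq _ _))
      (Nat.add_le_add (heq _ _) (heq _ _))) hS.const_lt)]
  simp only [ends, Finset.disjoint_insert_left, Finset.disjoint_singleton_left,
    Finset.mem_insert, Finset.mem_singleton]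
  split_ifs <;> simp_all

lemma eval_coincides_ne_zero_iff (hS : Sizes w l k n) {ρ : ℕ → ℕ} {e : ℕ × ℕ}
    (hu : ρ rLeft = u) (hv : ρ rRight = v) (hfst : ρ rFst = e.1) (hsnd : ρ rSnd = e.2) :
    coincides.eval w ρ ≠ 0 ↔ e = (u, v) ∨ e = (v, u) := by
  have heq (a b c d : ℕ) : (if a = b then 1 else 0) * (if c = d then 1 else 0) ≤ 1 := by
    split_ifs <;> omega
  have eval_both (r r' a b : ℕ) (hr : ρ r = a) (hr' : ρ r' = b) :
      (.bin .eq (.reg rFst) (.reg r) * .bin .eq (.reg rSnd) (.reg r') : Expr).eval w ρ =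
        (if e.1 = a then 1 else 0) * (if e.2 = b then 1 else 0) :=
    eval_mul (eval_eq hS.word_ne_zero (eval_reg hfst) (eval_reg hr))
      (eval_eq hS.word_ne_zero (eval_reg hsnd) (eval_reg hr')) ((heq ..).trans_lt hS.const_lt)
  rw [coincides, eval_add (eval_both _ _ _ _ hu hv) (eval_both _ _ _ _ hv hu)
    ((Nat.add_le_add (heq ..) (heq ..)).trans_lt hS.const_lt), Prod.ext_iff, Prod.ext_iff]
  split_ifs <;> simp_all

lemma reaches_insertEdge (hS : Sizes w l k n) (hP : CoveredGraph n k P) (h : Live l ω P σ m)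
    (hu : σ.regs rLeft = u) (hv : σ.regs rRight = v) (huv : (u, v) ∈ P) :
    Reaches w (memSize w l) ω insertEdge σ (m * 9 + 12) fun τ =>
      ∃ m', Live l ω P τ m' ∧ matched (storedEdge σ.mem) m ⊆ matched (storedEdge τ.mem) m' ∧
        ¬ Disjoint (matched (storedEdge τ.mem) m') {u, v} := by
  refine Reaches.cons (T₁ := m * 9 + 5) (T₂ := 7) (reaches_search hS h.count
    (h.stored.le_of_coveredGraph hP) hu hv fun _ _ => eval_touches_ne_zero_iff hS) ?_
  rintro τ hF hpos
  have hmem : τ.mem = σ.mem := hF.mem rfl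
  have hlive : Live l ω P τ m := h.frame hF fun a _ => congrFun hmem a
  refine Reaches.cons (T₁ := 6) (T₂ := 1) (Reaches.cond (T := 5) Iff.rfl (fun hne => ?_)
    fun hzero => ?_) fun _ _ h => Reaches.nil (T := 0) h
  · rcases hpos with ⟨hzero, -⟩ | ⟨i, hi, -, htouch⟩
    · exact absurd hzero hne
    · refine Reaches.skip ⟨m, hlive, by rw [hmem], fun hdisj => htouch (hdisj.mono_left ?_)⟩
      exact hmem ▸ Finset.subset_biUnion_of_mem (fun i => ends (storedEdge σ.mem i))
        (Finset.mem_range.2 hi)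
  · rcases hpos with ⟨-, hall⟩ | ⟨i, -, hpos, -⟩
    · refine (reaches_appendEdge hS hP hlive (eval_reg ((hF.regs _ rfl).trans hu))
        (eval_reg ((hF.regs _ rfl).trans hv)) huv ?_).weaken le_rfl ?_
      · rw [hmem, matched, Finset.disjoint_biUnion_right]
        exact fun i hi => (not_not.1 (hall i (Finset.mem_range.1 hi))).symm
      · rintro υ - ⟨hlive', hmatched⟩
        refine ⟨m + 1, hlive', ?_, ?_⟩ <;> rw [hmatched]
        · rw [hmem]
          exact Finset.subset_union_right
        · simp
    · exact absurd (by simp [Expr.eval, hpos]) hzero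

end Update

/-- The state in the middle of an update of the graph `P` to `P'`: the sketches are those of `P'`,
the stored matching is still one in `P`. -/
structure Pending {w : ℕ} (l : ℕ) (ω : ℕ → Fin (2 ^ w)) (P P' : Finset (ℕ × ℕ)) (σ : Config)
    (m : ℕ) : Prop where
  base : BaseMem l ω P' σ.mem
  size : σ.mem 48 = m
  stored : IsMatchingSeq P (storedEdge σ.mem) m
  params : ParamRegs w l σ.regs
  count : σ.regs rSize = m

section Deletion

variable {w l k n m p u v : ℕ} {ω : ℕ → Fin (2 ^ w)} {P P' : Finset (ℕ × ℕ)} {σ τ : Config}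

lemma Pending.live (h : Pending l ω P P' σ m)
    (hM : ∀ i < m, storedEdge σ.mem i ∈ P') : Live l ω P' σ m :=
  ⟨⟨h.base, h.size, h.stored.mono hM⟩, h.params, h.count⟩

lemma Pending.frame {a : Cmd} (h : Pending l ω P P' σ m) (hF : Frame a σ τ)
    (hmem : τ.mem = σ.mem)
    (ha : ∀ r ∈ [rWidth, rWord, rShift, rReps], a.writes r = false := by decide)
    (ha' : a.writes rSize = false := by decide) : Pending l ω P P' τ m :=
  ⟨hmem ▸ h.base, hmem ▸ h.size, hmem ▸ h.stored, h.params.frame hF ha,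
    (hF.regs _ ha').trans h.count⟩

lemma reaches_removeEdge (hS : Sizes w l k n) (h : Pending l ω P (P \ {(u, v), (v, u)}) σ (m + 1))
    (hm : m + 1 ≤ 2 * k)
    (hpos : σ.regs rPos = p + 1) (hp : p < m + 1)
    (huv : storedEdge σ.mem p = (u, v) ∨ storedEdge σ.mem p = (v, u)) :
    Reaches w (memSize w l) ω removeEdge σ 7 fun τ =>
      Live l ω (P \ {(u, v), (v, u)}) τ m ∧
        matched (storedEdge τ.mem) m = matched (storedEdge σ.mem) (m + 1) \ {u, v} := by
  have hlt := hS.succ_matching_lt hm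
  have hcell (i) (hi : i ≤ m) : i < cells w l := hS.matching_lt_cells (by omega)
  have eval_pos (ρ : ℕ → ℕ) (hρ : ρ rPos = p + 1) : (.reg rPos - 1 : Expr).eval w ρ = p :=
    eval_sub (a := p + 1) (eval_reg hρ) (eval_lit hS.const_lt) (by omega)
  refine Reaches.set rSize m
    (eval_sub (a := m + 1) (eval_reg h.count) (eval_lit hS.const_lt) (by omega)) ?_
  refine hS.reaches_load rFst (eval_reg (by simp)) (hcell m le_rfl) (hQ := ?_)
  refine hS.reaches_load rSnd (eval_reg (by simp)) (hcell m le_rfl) (hQ := ?_)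
  refine hS.reaches_store (eval_pos _ (by simp [hpos])) (hcell p (by omega)) (eval_reg rfl)
    (hQ := ?_)
  refine hS.reaches_store (eval_pos _ (by simp [hpos])) (hcell p (by omega)) (eval_reg rfl)
    (hQ := ?_)
  refine Reaches.store 48 m (eval_lit hS.const_lt) hS.const_lt_memSize (eval_reg (by simp)) ?_
  refine Reaches.nil (T := 0) ?_
  generalize hτ : Config.setMem _ 48 m = τ
  have hregs : ParamRegs w l τ.regs ∧ τ.regs rSize = m := by
    subst hτ
    exact ⟨h.params.setReg.setReg.setReg, by simp⟩
  have hmem (a) (h₂ : a ≠ 16 * p + 2) (h₃ : a ≠ 16 * p + 3) (h₄₈ : a ≠ 48) :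
      τ.mem a = σ.mem a := by simp [← hτ, h₂, h₃, h₄₈]
  have hM' (i) (_ : i < m) : storedEdge τ.mem i = storedEdge σ.mem (if i = p then m else i) := by
    split_ifs with hip
    · have h₂ : 16 * p + 2 ≠ 48 := by omega
      have h₃ : 16 * p + 3 ≠ 48 := by omega
      simp [storedEdge, ← hτ, hip, h₂, h₃]
    · exact Prod.ext (hmem _ (by omega) (by omega) (by omega))
        (hmem _ (by omega) (by omega) (by omega))
  have hends : ends (storedEdge σ.mem p) = {u, v} := by
    rcases huv with huv | huv <;> rw [huv, ends]
    exact Finset.pair_comm v u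
  refine ⟨⟨⟨h.base.congr fun a ha h₄₈ => hmem a (by omega) (by omega) h₄₈, by simp [← hτ],
    h.stored.swapRemove hp hM' fun e he hdisj => ?_⟩, hregs.1, hregs.2⟩,
    by rw [matched_swapRemove h.stored hp hM', hends]⟩
  simp only [ends, Finset.disjoint_left, Finset.mem_insert, Finset.mem_singleton] at hdisj
  grind

lemma reaches_rematch_both (hS : Sizes w l k n) (hP : CoveredGraph n k P) (h : Live l ω P σ m)
    (hleft : σ.regs rLeft = u) (hright : σ.regs rRight = v)
    (hu : u ∉ matched (storedEdge σ.mem) m) (hv : v ∉ matched (storedEdge σ.mem) m)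
    (hne : v ≠ u) (huv : (u, v) ∉ P) :
    Reaches w (memSize w l) ω (block [rematch rLeft, rematch rRight]) σ
      (2 * (w * w * (2 ^ l * 17 + 2 * k * 24 + 21)) + 27) fun τ =>
        ∃ m', Live l ω P τ m' ∧ ∃ V, V.card ≤ 4 * k ∧
          Rematch l ω P u (matched (storedEdge σ.mem) m) V ∧
          Rematch l ω P v V (matched (storedEdge τ.mem) m') := by
  generalize hR : w * w * (2 ^ l * 17 + 2 * k * 24 + 21) = R
  refine Reaches.weaken (T₁ := R + 13 + (R + 13 + 1)) ?_ (by omega) fun _ _ h => h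
  refine Reaches.cons (T₁ := R + 13) (T₂ := R + 13 + 1)
    (hR ▸ reaches_rematch hS hP h hleft hu) ?_
  rintro τ hF ⟨m', hτ, hrematch⟩
  refine Reaches.cons (T₁ := R + 13) (T₂ := 1) (hR ▸ reaches_rematch hS hP hτ
    ((hF.regs _ rfl).trans hright) (hrematch.notMem hv hne huv)) ?_
  rintro υ - ⟨m'', hυ, hrematch'⟩
  have := card_matched_le (storedEdge τ.mem) m'
  have := hτ.stored.le_of_coveredGraph hP
  exact Reaches.nil (T := 0) ⟨m'', hυ, _, by omega, hrematch, hrematch'⟩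

/-- A bound for the time of `deleteEdge`. -/
def repairTime (w l k : ℕ) : ℕ := 2 * (w * w * (2 ^ l * 17 + 2 * k * 24 + 21)) + 2 * k * 9 + 50

lemma reaches_deleteEdge (hS : Sizes w l k n) (hP : CoveredGraph n k P)
    (hP' : CoveredGraph n k (P \ {(u, v), (v, u)}))
    (h : Pending l ω P (P \ {(u, v), (v, u)}) σ m) (hleft : σ.regs rLeft = u)
    (hright : σ.regs rRight = v) (hne : v ≠ u) :
    Reaches w (memSize w l) ω deleteEdge σ (repairTime w l k) fun τ =>
      ∃ m', Live l ω (P \ {(u, v), (v, u)}) τ m' ∧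
        (VertexCover P (matched (storedEdge σ.mem) m) →
          Informative l k ω (P \ {(u, v), (v, u)}) u →
          Informative l k ω (P \ {(u, v), (v, u)}) v →
          VertexCover (P \ {(u, v), (v, u)}) (matched (storedEdge τ.mem) m')) := by
  have hm := h.stored.le_of_coveredGraph hP
  generalize hR : 2 * (w * w * (2 ^ l * 17 + 2 * k * 24 + 21)) = R
  refine Reaches.weaken (T₁ := m * 9 + 5 + (R + 34 + 1 + 1)) ?_
    (by rw [repairTime]; omega) fun _ _ h => h
  refine Reaches.cons (T₁ := m * 9 + 5) (T₂ := R + 34 + 1 + 1) (reaches_search hS h.count hm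
    hleft hright fun _ _ => eval_coincides_ne_zero_iff hS) ?_
  rintro τ hF hpos
  have hmem : τ.mem = σ.mem := hF.mem rfl
  have hτ := h.frame hF hmem
  refine Reaches.cons (T₁ := R + 34 + 1) (T₂ := 1) (Reaches.cond (T := R + 34) Iff.rfl
    (fun hfound => ?_) fun hzero => ?_) fun _ _ h => Reaches.nil (T := 0) h
  · obtain ⟨p, hp, hrPos, hedge⟩ := hpos.resolve_left fun h => hfound h.1
    obtain ⟨m, rfl⟩ : ∃ m', m = m' + 1 := ⟨m - 1, by omega⟩
    refine Reaches.weaken (T₁ := 7 + (R + 27)) ?_ (by omega) fun _ _ h => h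
    refine Reaches.cons (T₁ := 7) (T₂ := R + 27)
      (reaches_removeEdge hS hτ hm hrPos hp (hmem ▸ hedge)) ?_
    rintro υ hF' ⟨hυ, hmatched⟩
    rw [hmem] at hmatched
    refine (hR ▸ reaches_rematch_both hS hP' hυ
      ((hF'.regs _ rfl).trans ((hF.regs _ rfl).trans hleft))
      ((hF'.regs _ rfl).trans ((hF.regs _ rfl).trans hright)) (by simp [hmatched])
      (by simp [hmatched]) hne (by simp)).weaken le_rfl ?_
    rintro φ - ⟨m', hφ, V, hV, hu, hv⟩
    refine ⟨m', hφ, fun hcover hinf hinf' => ?_⟩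
    have := card_matched_le (storedEdge σ.mem) (m + 1)
    exact hcover.rematch Finset.sdiff_subset hP'.symm hP'.irrefl (by simp) (hmatched ▸ hu) hv
      (by omega) hV hinf hinf'
  · rcases hpos with ⟨-, hall⟩ | ⟨p, -, hpos, -⟩
    · refine Reaches.skip ⟨m, hτ.live fun i hi => ?_, fun hcover _ _ => ?_⟩
      · rw [hmem]
        simpa [h.stored.edge i hi] using hall i hi
      · exact hmem ▸ hcover.mono Finset.sdiff_subset subset_rfl
    · exact absurd (by simp [Expr.eval, hpos]) hzero

end Deletion

/-- The update of the edge `uv` (`op = 0`: insertion, `op = 1`: deletion) turns `P` into `P'`. -/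
def EdgeStep (op u v : ℕ) (P P' : Finset (ℕ × ℕ)) : Prop :=
  (op = 0 ∧ (u, v) ∉ P ∧ P' = {(u, v), (v, u)} ∪ P) ∨
    (op = 1 ∧ (u, v) ∈ P ∧ P' = P \ {(u, v), (v, u)})

/-- A bound for the time of `updateProgram`. -/
def updateTime (w l k : ℕ) : ℕ := 2 * (w * w * 20) + repairTime w l k + 30

section UpdateProgram

variable {w l k n m op u v : ℕ} {ω : ℕ → Fin (2 ^ w)} {P P' : Finset (ℕ × ℕ)} {σ : Config}

namespace EdgeStep

lemma mem_or_mem (h : EdgeStep op u v P P') : (u, v) ∈ P ∨ (u, v) ∈ P' := by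
  rcases h with ⟨-, -, rfl⟩ | ⟨-, huv, -⟩
  · simp
  · exact .inl huv

lemma lt_and_lt (h : EdgeStep op u v P P') (hP : CoveredGraph n k P) (hP' : CoveredGraph n k P') :
    u < n ∧ v < n := by
  simpa using h.mem_or_mem.elim (@hP.subset _) (@hP'.subset _)

lemma ne (h : EdgeStep op u v P P') (hP : CoveredGraph n k P) (hP' : CoveredGraph n k P') :
    v ≠ u := by
  rintro rfl
  exact h.mem_or_mem.elim (hP.irrefl v) (hP'.irrefl v)

lemma exists_toggle (h : EdgeStep op u v P P') (hP : CoveredGraph n k P)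
    (hP' : CoveredGraph n k P') : ∃ P₁ ⊆ Finset.range n ×ˢ Finset.range n,
      Toggle op (u, v) P P₁ ∧ Toggle op (v, u) P₁ P' := by
  have hne : (v, u) ≠ (u, v) := fun heq => h.ne hP hP' (Prod.mk.inj heq).1
  rcases h with ⟨rfl, huv, rfl⟩ | ⟨rfl, huv, rfl⟩
  · refine ⟨insert (u, v) P, fun e he => hP'.subset (by grind), .inl ⟨rfl, huv, rfl⟩,
      .inl ⟨rfl, ?_, by grind⟩⟩
    have hvu : (v, u) ∉ P := fun hvu => huv (hP.symm _ _ hvu)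
    simp [hne, hvu]
  · refine ⟨P.erase (u, v), (Finset.erase_subset _ _).trans hP.subset, .inr ⟨rfl, huv, rfl⟩,
      .inr ⟨rfl, ?_, by grind⟩⟩
    exact Finset.mem_erase.2 ⟨hne, hP.symm _ _ huv⟩

end EdgeStep

lemma reaches_updateSketches (hS : Sizes w l k n) (hP : CoveredGraph n k P)
    (hP' : CoveredGraph n k P') (hstep : EdgeStep op u v P P') (h : Live l ω P σ m)
    (hop : σ.regs rOp = op) (hleft : σ.regs rLeft = u) (hright : σ.regs rRight = v) :
    Reaches w (memSize w l) ω updateSketches σ (2 * (w * w * 20) + 11) fun τ =>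
      Pending l ω P P' τ m ∧ storedEdge τ.mem = storedEdge σ.mem := by
  obtain ⟨hu, hv⟩ := hstep.lt_and_lt hP hP'
  obtain ⟨P₁, hP₁, hT, hT'⟩ := hstep.exists_toggle hP hP'
  generalize hR : w * w * 20 + 3 = R
  refine Reaches.weaken (T₁ := R + (R + 1 + 2) + 2) ?_ (by omega) fun _ _ h => h
  refine Reaches.set (T := R + (R + 1 + 2) + 1) rFst u (eval_reg hleft) ?_
  refine Reaches.set (T := R + (R + 1 + 2)) rSnd v (eval_reg (by simp [hright])) ?_
  refine Reaches.cons (T₁ := R) (T₂ := R + 1 + 2) (hR ▸ reaches_toggleSketches hS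
    h.params.setReg.setReg (by simp [hop]) (by simp) (by simp) h.base.seeds hP.subset hu hv hT
    h.base.cells) ?_
  rintro τ hF ⟨hcells, hlow⟩
  have hop' : τ.regs rOp = op := (hF.regs _ rfl).trans (by simp [hop])
  have hleft' : τ.regs rLeft = u := (hF.regs _ rfl).trans (by simp [hleft])
  have hright' : τ.regs rRight = v := (hF.regs _ rfl).trans (by simp [hright])
  refine Reaches.set (T := R + 1 + 1) rFst v (eval_reg hright') ?_
  refine Reaches.set (T := R + 1) rSnd u (eval_reg (by simp [hleft'])) ?_
  refine Reaches.cons (T₁ := R) (T₂ := 1) (hR ▸ reaches_toggleSketches hS (P := P₁) (op := op)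
    (h.params.setReg.setReg.frame hF).setReg.setReg (by simp [hop'])
    (by simp) (by simp) (h.base.seeds.congr fun a _ ha => hlow a ha) hP₁ hv hu hT' hcells) ?_
  rintro υ hF' ⟨hcells', hlow'⟩
  have hmem (a) (ha : a % 16 < 8) : υ.mem a = σ.mem a := (hlow' a ha).trans (hlow a ha)
  have hstored : storedEdge υ.mem = storedEdge σ.mem :=
    storedEdge_congr fun a _ => hmem a (by omega)
  exact Reaches.nil (T := 0) ⟨⟨⟨(hmem _ (by simp)).trans h.base.width,
    (hmem _ (by simp)).trans h.base.word, (hmem _ (by simp)).trans h.base.shift,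
    h.base.seeds.congr fun a _ ha => hmem a ha, hcells'⟩, (hmem _ (by simp)).trans h.size,
    hstored ▸ h.stored, (h.params.setReg.setReg.frame hF).setReg.setReg.frame hF',
    (hF'.regs _ rfl).trans ((hF.regs _ rfl).trans (by simp [h.count]))⟩, hstored⟩

lemma reaches_updateMatching (hS : Sizes w l k n) (hP : CoveredGraph n k P)
    (hP' : CoveredGraph n k P') (hstep : EdgeStep op u v P P') (h : Pending l ω P P' σ m)
    (hop : σ.regs rOp = op) (hleft : σ.regs rLeft = u) (hright : σ.regs rRight = v) :
    Reaches w (memSize w l) ω updateMatching σ (repairTime w l k + 1) fun τ =>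
      ∃ m', Invariant l ω P' τ.mem m' ∧
        (VertexCover P (matched (storedEdge σ.mem) m) →
          (op = 1 → Informative l k ω P' u ∧ Informative l k ω P' v) →
          VertexCover P' (matched (storedEdge τ.mem) m')) := by
  refine Reaches.cond (p := op ≠ 0) (by simp [Expr.eval, hop]) (fun hne => ?_) fun hzero => ?_
  · obtain ⟨rfl, -, rfl⟩ := hstep.resolve_left fun h => hne h.1
    refine (reaches_deleteEdge hS hP hP' h hleft hright (hstep.ne hP hP')).weaken le_rfl ?_
    rintro τ - ⟨m', hτ, hcover⟩
    exact ⟨m', hτ.toInvariant, fun hV hinf => hcover hV (hinf rfl).1 (hinf rfl).2⟩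
  · obtain ⟨rfl, -, rfl⟩ := hstep.resolve_right fun h => hzero (by simp [h.1])
    have hm := h.stored.le_of_coveredGraph hP
    refine (reaches_insertEdge hS hP' (h.live fun i hi =>
      Finset.mem_union_right _ (h.stored.edge i hi)) hleft hright (by simp)).weaken
      (by rw [repairTime]; omega) ?_
    rintro τ - ⟨m', hτ, hsub, hnew⟩
    refine ⟨m', hτ.toInvariant, fun hV _ x y hxy => ?_⟩
    by_cases hxy' : (x, y) ∈ P
    · exact hV.mono subset_rfl hsub x y hxy'
    · simp only [Finset.disjoint_insert_right, Finset.disjoint_singleton_right] at hnew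
      grind

theorem reaches_updateProgram (hS : Sizes w l k n) (hP : CoveredGraph n k P)
    (hP' : CoveredGraph n k P') (hstep : EdgeStep op u v P P') (h : Invariant l ω P σ.mem m)
    (hop : σ.regs rOp = op) (hleft : σ.regs rLeft = u) (hright : σ.regs rRight = v) :
    Reaches w (memSize w l) ω updateProgram σ (updateTime w l k) fun τ =>
      ∃ m', Invariant l ω P' τ.mem m' ∧
        (VertexCover P (matched (storedEdge σ.mem) m) →
          (op = 1 → Informative l k ω P' u ∧ Informative l k ω P' v) →
          VertexCover P' (matched (storedEdge τ.mem) m')) := by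
  generalize hR : repairTime w l k = R
  generalize hU : 2 * (w * w * 20) + 11 = U
  refine Reaches.weaken (T₁ := U + (R + 1 + 1) + 5) ?_ (by rw [updateTime]; omega) fun _ _ h => h
  refine Reaches.load (T := U + (R + 1 + 1) + 4) rWidth 0 (eval_lit hS.const_lt)
    hS.const_lt_memSize ?_
  refine Reaches.load (T := U + (R + 1 + 1) + 3) rWord 16 (eval_lit hS.const_lt)
    hS.const_lt_memSize ?_
  refine Reaches.load (T := U + (R + 1 + 1) + 2) rShift 32 (eval_lit hS.const_lt)
    hS.const_lt_memSize ?_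
  refine Reaches.load (T := U + (R + 1 + 1) + 1) rSize 48 (eval_lit hS.const_lt)
    hS.const_lt_memSize ?_
  simp only [Config.setReg_mem, h.base.width, h.base.word, h.base.shift, h.size]
  refine Reaches.set (T := U + (R + 1 + 1)) rReps (w * w)
    (eval_mul (eval_reg (by simp)) (eval_reg (by simp)) hS.reps_lt) ?_
  have hlive : Live l ω P (((((σ.setReg rWidth (2 ^ l)).setReg rWord w).setReg rShift
      (w - l)).setReg rSize m).setReg rReps (w * w)) m :=
    ⟨h, ⟨by simp, by simp, by simp, by simp⟩, by simp⟩
  refine Reaches.cons (T₁ := U) (T₂ := R + 1 + 1) (hU ▸ reaches_updateSketches hS hP hP' hstep hlive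
    (by simp [hop]) (by simp [hleft]) (by simp [hright])) ?_
  rintro τ hF ⟨hpending, hstored⟩
  replace hstored : storedEdge τ.mem = storedEdge σ.mem := hstored
  refine Reaches.cons (T₁ := R + 1) (T₂ := 1) (hR ▸ reaches_updateMatching hS hP hP' hstep hpending
    ((hF.regs _ rfl).trans (by simp [hop])) ((hF.regs _ rfl).trans (by simp [hleft]))
    ((hF.regs _ rfl).trans (by simp [hright]))) fun υ _ h => Reaches.nil (T := 0) ?_
  exact hstored ▸ h

end UpdateProgram

/-! ## The query and setup programs -/

/-- Output a stored edge. -/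
def emitEdge : Cmd :=
  block [.load rFst (addr (.reg rEdge) 2), .emit (.reg rFst), .load rFst (addr (.reg rEdge) 3),
    .emit (.reg rFst)]

/-- The query program. -/
def queryProgram : Cmd := block [.load rSize 48, forLoop rEdge rSize emitEdge]

/-- Draw the four seeds of a sketch. -/
def drawSeed : Cmd :=
  block [.rand rFst, .store (addr (.reg rSketch) 4) (.reg rFst),
    .rand rFst, .store (addr (.reg rSketch) 5) (.reg rFst),
    .rand rFst, .store (addr (.reg rSketch) 6) (.reg rFst),
    .rand rFst, .store (addr (.reg rSketch) 7) (.reg rFst)]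

/-- Compute the width `2 ^ l` of the sketches, where `l` is least with `256 * k ≤ 2 ^ l`, and the
shift `w - l`. Register `1` holds `k`. -/
def computeWidth : Cmd :=
  block [.set rWidth 1, .set rShift (.reg rWord),
    .loop (.bin .lt (.reg rWidth) (256 * .reg 1))
      (block [.set rWidth (.reg rWidth + .reg rWidth), .set rShift (.reg rShift - 1)])]

/-- The setup program. On entry, register `3` holds the word length. -/
def setupProgram : Cmd :=
  block [.set rWord (.reg 3), computeWidth, .store 0 (.reg rWidth), .store 16 (.reg rWord),
    .store 32 (.reg rShift), .set rReps (.reg rWord * .reg rWord),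
    forLoop rSketch rReps drawSeed]

section QuerySetup

variable {w l k n m t : ℕ} {ω : ℕ → Fin (2 ^ w)} {σ : Config}

theorem reaches_queryProgram (hS : Sizes w l k n) (hm : m ≤ 2 * k) (hsize : σ.mem 48 = m)
    (hout : σ.out = []) :
    Reaches w (memSize w l) ω queryProgram σ (m * 8 + 5) fun τ =>
      τ.out = (List.range m).flatMap fun i => [(storedEdge σ.mem i).1, (storedEdge σ.mem i).2] := by
  have hlt := hS.succ_matching_lt hm
  refine Reaches.load (T := m * 8 + 4) rSize 48 (eval_lit hS.const_lt) hS.const_lt_memSize ?_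
  refine Reaches.cons (T₁ := m * 8 + 3) (T₂ := 1) (Reaches.forLoop (T := 5) hS.word_ne_zero m
    (by simp [hsize]) (by omega) rfl rfl (by decide) (fun j τ => τ.out = (List.range j).flatMap
      fun i => [(storedEdge σ.mem i).1, (storedEdge σ.mem i).2]) (by simp [hout]) ?_)
    fun _ _ h => Reaches.nil (T := 0) h
  intro i hi τ hF hedge hI
  have hmem : τ.mem = σ.mem := hF.mem rfl
  have hcell := hS.matching_lt_cells (hi.le.trans hm)
  refine hS.reaches_load rFst (eval_reg hedge) hcell (hQ := ?_)
  refine Reaches.emit (storedEdge σ.mem i).1 (eval_reg (by simp [hmem, storedEdge])) ?_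
  refine hS.reaches_load rFst (eval_reg (by simp [hedge])) hcell (hQ := ?_)
  refine Reaches.emit (storedEdge σ.mem i).2 (eval_reg (by simp [hmem, storedEdge])) ?_
  exact Reaches.nil (T := 0) (by simp [hI, List.range_succ])

lemma reaches_drawSeed (hS : Sizes w l k n) (hsketch : σ.regs rSketch = t) (ht : t < w * w)
    (hpos : σ.pos = 4 * t) :
    Reaches w (memSize w l) ω drawSeed σ 9 fun τ =>
      τ.pos = 4 * (t + 1) ∧ (∀ j < 4, τ.mem (16 * t + 4 + j) = ω (4 * t + j)) ∧
        ∀ a, a < 16 * t + 4 ∨ 16 * t + 8 ≤ a → τ.mem a = σ.mem a := by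
  have hcell : t < cells w l := ht.trans_le (word_sq_le_cells w l)
  refine Reaches.rand rFst ?_
  refine hS.reaches_store (eval_reg (by simp [hsketch])) hcell (eval_reg rfl) (hQ := ?_)
  refine Reaches.rand rFst ?_
  refine hS.reaches_store (eval_reg (by simp [hsketch])) hcell (eval_reg rfl) (hQ := ?_)
  refine Reaches.rand rFst ?_
  refine hS.reaches_store (eval_reg (by simp [hsketch])) hcell (eval_reg rfl) (hQ := ?_)
  refine Reaches.rand rFst ?_
  refine hS.reaches_store (eval_reg (by simp [hsketch])) hcell (eval_reg rfl) (hQ := ?_)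
  refine Reaches.nil (T := 0) ⟨by simp [hpos]; omega, fun j hj => ?_, fun a ha => ?_⟩
  · interval_cases j <;> simp [hpos]
  · simp only [Config.setMem_mem]
    rw [if_neg (by omega), if_neg (by omega), if_neg (by omega), if_neg (by omega)]

lemma reaches_drawSeeds (hS : Sizes w l k n) (hreps : σ.regs rReps = w * w) (hpos : σ.pos = 0) :
    Reaches w (memSize w l) ω (forLoop rSketch rReps drawSeed) σ (w * w * 12 + 3) fun τ =>
      SeedMem ω τ.mem ∧ ∀ a, a % 16 < 4 ∨ 8 ≤ a % 16 → τ.mem a = σ.mem a := by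
  refine (Reaches.forLoop (T := 9) hS.word_ne_zero (w * w) hreps hS.reps_lt rfl rfl (by decide)
    (fun t τ => τ.pos = 4 * t ∧ (∀ t' < t, ∀ j < 4, τ.mem (16 * t' + 4 + j) = ω (4 * t' + j)) ∧
      ∀ a, a % 16 < 4 ∨ 8 ≤ a % 16 → τ.mem a = σ.mem a)
    ⟨by simp [hpos], by simp, fun _ _ => rfl⟩ ?_).weaken le_rfl fun τ _ h => h.2
  rintro t ht τ - hsketch ⟨hpos, hseeds, hrest⟩
  refine (reaches_drawSeed hS hsketch ht hpos).weaken le_rfl ?_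
  rintro υ - ⟨hpos', hdrawn, hsame⟩
  refine ⟨hpos', fun t' ht' j hj => ?_, fun a ha => (hsame a (by omega)).trans (hrest a ha)⟩
  rcases Nat.lt_succ_iff_lt_or_eq.1 ht' with ht' | rfl
  · exact (hsame _ (by omega)).trans (hseeds t' ht' j hj)
  · exact hdrawn j hj

lemma reaches_computeWidth (hS : Sizes w l k n) (hl : l = Nat.clog 2 (256 * k))
    (hk : σ.regs 1 = k) (hword : σ.regs rWord = w) :
    Reaches w (memSize w l) ω computeWidth σ (w * 4 + 4) fun τ =>
      τ.regs rWidth = 2 ^ l ∧ τ.regs rShift = w - l := by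
  have hwidth := hS.width_lt
  have hkl := hS.le_width
  have hlw := hS.le_word
  have hword_lt : w < 2 ^ w := Nat.lt_two_pow_self
  have eval_test {i : ℕ} {ρ : ℕ → ℕ} (hρ : ρ rWidth = 2 ^ i) (hρk : ρ 1 = k) :
      (.bin .lt (.reg rWidth) (256 * .reg 1) : Expr).eval w ρ ≠ 0 ↔ i < l := by
    rw [eval_lt_ne_zero_iff hS.word_ne_zero (eval_reg hρ)
      (eval_mul (eval_lit hS.const_lt) (eval_reg hρk) (by omega)), hl,
      Nat.lt_clog_iff_pow_lt (by omega)]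
  refine Reaches.weaken (T₁ := l * 4 + 1 + 1 + 2) ?_ (by omega) fun _ _ h => h
  refine Reaches.set (T := l * 4 + 1 + 1 + 1) rWidth 1 (eval_lit hS.const_lt) ?_
  refine Reaches.set (T := l * 4 + 1 + 1) rShift w (eval_reg (by simp [hword])) ?_
  refine Reaches.cons (T₁ := l * 4 + 1) (T₂ := 1) (Reaches.loop (T := 3) l
    (fun i τ => τ.regs rWidth = 2 ^ i ∧ τ.regs rShift = w - i) (by simp) ?_ ?_)
    fun _ _ h => Reaches.nil (T := 0) h
  · rintro i hi τ hF ⟨hwid, hshift⟩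
    have hdouble : 2 ^ (i + 1) = 2 ^ i + 2 ^ i := by rw [pow_succ, Nat.mul_two]
    have hle : 2 ^ (i + 1) ≤ 2 ^ l := Nat.pow_le_pow_right (by omega) hi
    refine ⟨(eval_test hwid ((hF.regs _ rfl).trans (by simp [hk]))).2 hi, ?_⟩
    refine Reaches.set rWidth (2 ^ (i + 1))
      (hdouble ▸ eval_add (eval_reg hwid) (eval_reg hwid) (by omega)) ?_
    refine Reaches.set rShift (w - (i + 1)) (eval_sub (a := w - i) (eval_reg (by simp [hshift]))
      (eval_lit hS.const_lt) (by omega)) ?_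
    exact Reaches.nil (T := 0) (by simp)
  · rintro τ hF ⟨hwid, -⟩
    exact not_not.1 fun h =>
      (lt_irrefl l) ((eval_test hwid ((hF.regs _ rfl).trans (by simp [hk]))).1 h)

theorem reaches_setupProgram (hS : Sizes w l k n) (hl : l = Nat.clog 2 (256 * k))
    (hk : σ.regs 1 = k) (hword : σ.regs 3 = w) (hmem : ∀ a, σ.mem a = 0) (hpos : σ.pos = 0) :
    Reaches w (memSize w l) ω setupProgram σ (w * 4 + w * w * 12 + 20) fun τ =>
      Invariant l ω ∅ τ.mem 0 := by
  refine Reaches.weaken (T₁ := w * 4 + 4 + (w * w * 12 + 3 + 1 + 4) + 1) ?_ (by omega)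
    fun _ _ h => h
  refine Reaches.set (T := w * 4 + 4 + (w * w * 12 + 3 + 1 + 4)) rWord w (eval_reg hword) ?_
  refine Reaches.cons (T₁ := w * 4 + 4) (T₂ := w * w * 12 + 3 + 1 + 4)
    (reaches_computeWidth hS hl (by simp [hk]) (by simp)) ?_
  rintro τ hF ⟨hwidth, hshift⟩
  have hword' : τ.regs rWord = w := (hF.regs _ rfl).trans (by simp)
  have hmem' (a) : τ.mem a = 0 := (congrFun (hF.mem rfl) a).trans (hmem a)
  refine Reaches.store (T := w * w * 12 + 3 + 1 + 3) 0 (2 ^ l) (eval_lit hS.const_lt)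
    hS.const_lt_memSize (eval_reg hwidth) ?_
  refine Reaches.store (T := w * w * 12 + 3 + 1 + 2) 16 w (eval_lit hS.const_lt)
    hS.const_lt_memSize (eval_reg (by simp [hword'])) ?_
  refine Reaches.store (T := w * w * 12 + 3 + 1 + 1) 32 (w - l) (eval_lit hS.const_lt)
    hS.const_lt_memSize (eval_reg (by simp [hshift])) ?_
  refine Reaches.set (T := w * w * 12 + 3 + 1) rReps (w * w) (eval_mul
    (eval_reg (by simp [hword'])) (eval_reg (by simp [hword'])) hS.reps_lt) ?_
  refine Reaches.cons (T₁ := w * w * 12 + 3) (T₂ := 1) (reaches_drawSeeds hS (by simp)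
    ((hF.pos rfl).trans hpos)) ?_
  rintro υ - ⟨hseeds, hsame⟩
  have hzero (a) (ha : 8 ≤ a % 16) : υ.mem a = 0 := by
    have h₀ : a ≠ 0 := by omega
    have h₁₆ : a ≠ 16 := by omega
    have h₃₂ : a ≠ 32 := by omega
    simp [hsame a (.inr ha), hmem', h₀, h₁₆, h₃₂]
  refine Reaches.nil (T := 0) ⟨⟨(hsame _ (by simp)).trans (by simp),
    (hsame _ (by simp)).trans (by simp), (hsame _ (by simp)).trans (by simp), hseeds, ?_⟩,
    (hsame _ (by simp)).trans (by simp [hmem']), ⟨by simp, by simp⟩⟩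
  intro t _ r _ b _
  simp [CellAt, bucket, hzero]

end QuerySetup

/-! ## Independence of the sketches -/

open MeasureTheory
open scoped ENNReal

/-- The random words used by one sketch: the seeds of its row hash and of its column hash. -/
abbrev Seed (w : ℕ) : Type := (Fin (2 ^ w) × Fin (2 ^ w)) × (Fin (2 ^ w) × Fin (2 ^ w))

/-- The seeds of sketch `t`. -/
def seedOf {w : ℕ} (ω : ℕ → Fin (2 ^ w)) (t : ℕ) : Seed w :=
  ((ω (4 * t), ω (4 * t + 1)), (ω (4 * t + 2), ω (4 * t + 3)))

section Independence

variable {w : ℕ}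

lemma card_univ_seed : (Finset.univ : Finset (Seed w)).card = (2 ^ w) ^ 4 := by
  simp only [Finset.card_univ, Fintype.card_prod, Fintype.card_fin]
  ring

lemma pi_uniformOfFintype_finset {ι α : Type*} [Fintype ι] [Fintype α] [Nonempty α]
    [MeasurableSpace α] [MeasurableSingletonClass α] (F : Finset (ι → α)) :
    Measure.pi (fun _ : ι => (PMF.uniformOfFintype α).toMeasure) F =
      F.card * ((Fintype.card α : ℝ≥0∞)⁻¹) ^ Fintype.card ι := by
  have hsingleton (x : α) : (PMF.uniformOfFintype α).toMeasure {x} = (Fintype.card α : ℝ≥0∞)⁻¹ := by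
    rw [PMF.toMeasure_apply_singleton _ _ (measurableSet_singleton x),
      PMF.uniformOfFintype_apply]
  rw [← sum_measure_singleton, Finset.sum_congr rfl fun f _ => Measure.pi_singleton _ f]
  simp only [hsingleton, Finset.prod_const, Finset.card_univ, Finset.sum_const, nsmul_eq_mul]

lemma map_coins_blocks :
    (coins w).map (fun ω (t : ℕ) (i : Fin 4) => ω (4 * t + i)) =
      Measure.infinitePi fun _ : ℕ =>
        Measure.pi fun _ : Fin 4 => (PMF.uniformOfFintype (Fin (2 ^ w))).toMeasure := by
  have hinj : Function.Injective fun p : ℕ × Fin 4 => 4 * p.1 + (p.2 : ℕ) := by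
    rintro ⟨t, i⟩ ⟨t', i'⟩ h
    simp only [Prod.mk.injEq, Fin.ext_iff] at h ⊢
    omega
  simp_rw [← Measure.infinitePi_eq_pi]
  rw [← Measure.infinitePi_map_curry fun _ _ => (PMF.uniformOfFintype (Fin (2 ^ w))).toMeasure,
    ← Measure.map_infinitePi_infinitePi_of_inj
      (P := fun _ => (PMF.uniformOfFintype (Fin (2 ^ w))).toMeasure) hinj,
    Measure.map_map (by fun_prop) (by fun_prop)]
  rfl

theorem coins_forall_seedOf_mem (T : Finset ℕ) (F : Finset (Seed w)) :
    coins w {ω | ∀ t ∈ T, seedOf ω t ∈ F} =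
      (F.card * ((2 ^ w : ℕ) : ℝ≥0∞)⁻¹ ^ 4) ^ T.card := by
  classical
  let seed (f : Fin 4 → Fin (2 ^ w)) : Seed w := ((f 0, f 1), (f 2, f 3))
  set G : Finset (Fin 4 → Fin (2 ^ w)) := Finset.univ.filter fun f => seed f ∈ F with hG
  have hcard : G.card = F.card := by
    refine Finset.card_bij (fun f _ => seed f) (fun f hf => (Finset.mem_filter.1 hf).2)
      (fun f _ g _ h => ?_) fun q hq => ⟨![q.1.1, q.1.2, q.2.1, q.2.2], by simpa [hG, seed], rfl⟩
    simp only [seed, Prod.mk.injEq] at h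
    ext i
    fin_cases i <;> simp [h]
  have hblocks : {ω : ℕ → Fin (2 ^ w) | ∀ t ∈ T, seedOf ω t ∈ F} =
      (fun ω (t : ℕ) (i : Fin 4) => ω (4 * t + i)) ⁻¹' Set.pi T fun _ => G := by
    ext ω
    simp [Set.mem_pi, hG, seed, seedOf]
  have hmeas : MeasurableSet (Set.pi (T : Set ℕ) fun _ => (G : Set (Fin 4 → Fin (2 ^ w)))) :=
    .pi T.countable_toSet fun _ _ => G.measurableSet
  rw [hblocks, ← Measure.map_apply (by fun_prop) hmeas, map_coins_blocks,
    Measure.infinitePi_pi _ fun _ _ => G.measurableSet]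
  simp [pi_uniformOfFintype_finset, hcard]

theorem coins_forall_seedOf_mem_le {T : Finset ℕ} {F : Finset (Seed w)}
    (hF : 100 * F.card ≤ 99 * (2 ^ w) ^ 4) :
    coins w {ω | ∀ t ∈ T, seedOf ω t ∈ F} ≤ ENNReal.ofReal ((99 / 100) ^ T.card) := by
  have hfrac : (F.card : ℝ) * ((2 : ℝ) ^ w)⁻¹ ^ 4 ≤ 99 / 100 := by
    rw [inv_pow, ← div_eq_mul_inv, div_le_iff₀ (by positivity)]
    have : 100 * (F.card : ℝ) ≤ 99 * (2 ^ w) ^ 4 := by exact_mod_cast hF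
    linarith
  have hinv : ((2 ^ w : ℕ) : ℝ≥0∞)⁻¹ = ENNReal.ofReal ((2 : ℝ) ^ w)⁻¹ := by
    rw [ENNReal.ofReal_inv_of_pos (by positivity), ← ENNReal.ofReal_natCast]
    push_cast
    rfl
  rw [coins_forall_seedOf_mem, hinv, ← ENNReal.ofReal_natCast, ← ENNReal.ofReal_pow (by positivity),
    ← ENNReal.ofReal_mul (by positivity), ← ENNReal.ofReal_pow (by positivity)]
  exact ENNReal.ofReal_le_ofReal (pow_le_pow_left₀ (by positivity) hfrac _)

theorem coins_level_le {j : ℕ} (hj : j < w) {F : Finset (Seed w)}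
    (hF : 100 * F.card ≤ 99 * (2 ^ w) ^ 4) :
    coins w {ω | ∀ t < w * w, t % w = j → seedOf ω t ∈ F} ≤ ENNReal.ofReal ((99 / 100) ^ w) := by
  set T := (Finset.range w).image fun i => i * w + j with hT
  have hcard : T.card = w := by
    rw [hT, Finset.card_image_of_injective, Finset.card_range]
    exact fun i i' h => Nat.eq_of_mul_eq_mul_right (j.zero_le.trans_lt hj) (Nat.add_right_cancel h)
  have hlevel : ∀ t ∈ T, t < w * w ∧ t % w = j := by
    simp only [hT, Finset.mem_image, Finset.mem_range]
    rintro _ ⟨i, hi, rfl⟩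
    exact ⟨mul_add_lt_mul hi hj, by rw [Nat.mul_add_mod', Nat.mod_eq_of_lt hj]⟩
  calc coins w {ω | ∀ t < w * w, t % w = j → seedOf ω t ∈ F}
      ≤ coins w {ω | ∀ t ∈ T, seedOf ω t ∈ F} :=
        measure_mono fun ω hω t ht => hω t (hlevel t ht).1 (hlevel t ht).2
    _ ≤ ENNReal.ofReal ((99 / 100) ^ T.card) := coins_forall_seedOf_mem_le hF
    _ = ENNReal.ofReal ((99 / 100) ^ w) := by rw [hcard]

end Independence

/-! ## Recovery with random seeds -/

/-- The seeds with which a sketch of sampling rate `1 / 2 ^ j` recovers the neighbour `y` of `u`. -/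
def RecoveredBy {w : ℕ} (l j : ℕ) (P : Finset (ℕ × ℕ)) (u y : ℕ) (q : Seed w) : Prop :=
  mulShift w q.2.1 q.2.2 (w - l - j) y < 2 ^ l ∧
  ∀ p ∈ P, mulShift w q.1.1 q.1.2 (w - l) p.1 = mulShift w q.1.1 q.1.2 (w - l) u →
    mulShift w q.2.1 q.2.2 (w - l - j) p.2 = mulShift w q.2.1 q.2.2 (w - l - j) y → p = (u, y)

section Recovery

variable {w l j n k u y : ℕ} {P : Finset (ℕ × ℕ)} {X : Finset ℕ}

lemma recovered_iff_recoveredBy {ω : ℕ → Fin (2 ^ w)} {t : ℕ} (h : (u, y) ∈ P) :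
    Recovered l ω P t u y ↔ RecoveredBy l (t % w) P u y (seedOf ω t) := by
  simp only [Recovered, RecoveredBy, bucket, Finset.eq_singleton_iff_unique_mem,
    Finset.mem_filter, h, true_and, and_true, and_imp]
  rfl

lemma CoveredGraph.nbrs_subset_range (hP : CoveredGraph n k P) (u : ℕ) :
    nbrs P u ⊆ Finset.range n :=
  fun _ hy => (Finset.mem_product.1 (hP.subset (mem_nbrs.1 hy))).2

lemma CoveredGraph.exists_cover_subset_range (hP : CoveredGraph n k P) :
    ∃ X ⊆ Finset.range n, X.card ≤ 2 * k ∧ VertexCover P X := by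
  obtain ⟨X, hcard, hX⟩ := hP.cover
  refine ⟨X ∩ Finset.range n, Finset.inter_subset_right,
    (Finset.card_le_card Finset.inter_subset_left).trans hcard, fun x y hxy => ?_⟩
  have hlt := Finset.mem_product.1 (hP.subset hxy)
  exact (hX x y hxy).imp (Finset.mem_inter.2 ⟨·, hlt.1⟩) (Finset.mem_inter.2 ⟨·, hlt.2⟩)

/-- A pair in the cell of `(u, y)` has a component in the cover `X`: hence only the few vertices of
`X` and the neighbours of `u` and `y` can prevent the recovery. -/
lemma recoveredBy_of_forall_ne (hsymm : ∀ x z, (x, z) ∈ P → (z, x) ∈ P) (hX : VertexCover P X)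
    {q : Seed w} (hsampled : mulShift w q.2.1 q.2.2 (w - l - j) y < 2 ^ l)
    (hrow : ∀ x ∈ (X ∪ nbrs P y).erase u,
      mulShift w q.1.1 q.1.2 (w - l) x ≠ mulShift w q.1.1 q.1.2 (w - l) u)
    (hcol : ∀ z ∈ (X ∪ nbrs P u).erase y,
      mulShift w q.2.1 q.2.2 (w - l - j) z ≠ mulShift w q.2.1 q.2.2 (w - l - j) y) :
    RecoveredBy l j P u y q := by
  refine ⟨hsampled, ?_⟩
  rintro ⟨x, z⟩ hxz hx hz
  have hxu : x = u ∨ x ∉ X ∪ nbrs P y := by grind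
  have hzy : z = y ∨ z ∉ X ∪ nbrs P u := by grind
  simp only [Finset.mem_union, mem_nbrs, not_or] at hxu hzy
  have hcov := hX x z hxz
  have := hsymm x z hxz
  grind

lemma two_pow_mul_two_pow_sub_le (hlj : l + j ≤ w) : 2 ^ l * 2 ^ (w - l - j) ≤ 2 ^ w := by
  rw [← pow_add]
  exact Nat.pow_le_pow_right two_pos (by omega)

lemma card_filter_rowCollision_le {x : ℕ} (hl : l ≤ w) (hlj : l + j ≤ w) (hx : x < 2 ^ (w - l))
    (hu : u < 2 ^ (w - l)) (hxu : x ≠ u) :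
    (Finset.univ.filter fun q : Seed w =>
        mulShift w q.1.1 q.1.2 (w - l) x = mulShift w q.1.1 q.1.2 (w - l) u ∧
          mulShift w q.2.1 q.2.2 (w - l - j) y < 2 ^ l).card ≤
      2 ^ (w - l) * (2 ^ w * (2 ^ w * (2 ^ l * 2 ^ (w - l - j)))) := by
  have hcollision := card_mulShift_collision_le (Nat.sub_le w l) hx hu hxu (2 ^ l)
  simp only [mulShift_lt hl, and_true] at hcollision
  rw [← Finset.univ_product_univ, Finset.filter_product
    (fun q : Fin (2 ^ w) × Fin (2 ^ w) =>
      mulShift w q.1 q.2 (w - l) x = mulShift w q.1 q.2 (w - l) u)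
    (fun q : Fin (2 ^ w) × Fin (2 ^ w) => mulShift w q.1 q.2 (w - l - j) y < 2 ^ l),
    Finset.card_product, card_mulShift_lt (two_pow_mul_two_pow_sub_le hlj)]
  refine (Nat.mul_le_mul_right _ hcollision).trans_eq ?_
  rw [← pow_add 2 l (w - l), Nat.add_sub_cancel' hl, Nat.mul_assoc]

lemma card_filter_snd_seed (p : Fin (2 ^ w) × Fin (2 ^ w) → Prop) [DecidablePred p] :
    (Finset.univ.filter fun q : Seed w => p q.2).card =
      2 ^ w * 2 ^ w * (Finset.univ.filter p).card := by
  rw [← Finset.univ_product_univ, Finset.filter_product_right, Finset.card_product,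
    Finset.card_univ, Fintype.card_prod, Fintype.card_fin]

lemma card_filter_colCollision_le {z : ℕ} (hz : z < 2 ^ (w - l - j)) (hy : y < 2 ^ (w - l - j))
    (hzy : z ≠ y) :
    (Finset.univ.filter fun q : Seed w =>
        mulShift w q.2.1 q.2.2 (w - l - j) z = mulShift w q.2.1 q.2.2 (w - l - j) y ∧
          mulShift w q.2.1 q.2.2 (w - l - j) y < 2 ^ l).card ≤
      2 ^ (w - l - j) * (2 ^ w * (2 ^ w * (2 ^ l * 2 ^ (w - l - j)))) := by
  have hcollision := card_mulShift_collision_le (w := w) (by omega) hz hy hzy (2 ^ l)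
  rw [card_filter_snd_seed fun q : Fin (2 ^ w) × Fin (2 ^ w) =>
    mulShift w q.1 q.2 (w - l - j) z = mulShift w q.1 q.2 (w - l - j) y ∧
      mulShift w q.1 q.2 (w - l - j) y < 2 ^ l]
  refine (Nat.mul_le_mul_left _ hcollision).trans_eq ?_
  ring

open Classical in
lemma card_sampled_le (hl : l ≤ w) (hlj : l + j ≤ w) (hn : n ≤ 2 ^ (w - l - j))
    (hsymm : ∀ x z, (x, z) ∈ P → (z, x) ∈ P) (hX : VertexCover P X) (hXn : X ⊆ Finset.range n)
    (hun : nbrs P u ⊆ Finset.range n) (hyn : nbrs P y ⊆ Finset.range n) (hu : u < n) (hy : y < n) :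
    2 ^ w * 2 ^ w * (2 ^ w * (2 ^ l * 2 ^ (w - l - j))) ≤
      (Finset.univ.filter fun q : Seed w => RecoveredBy l j P u y q).card +
      ((X ∪ nbrs P y).card * 2 ^ (w - l) + (X ∪ nbrs P u).card * 2 ^ (w - l - j)) *
        (2 ^ w * (2 ^ w * (2 ^ l * 2 ^ (w - l - j)))) := by
  have hnl : n ≤ 2 ^ (w - l) := hn.trans (Nat.pow_le_pow_right two_pos (by omega))
  have hrow : ∀ x ∈ (X ∪ nbrs P y).erase u, _ := fun x hx =>
    card_filter_rowCollision_le (y := y) hl hlj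
      ((Finset.mem_range.1 (Finset.union_subset hXn hyn (Finset.mem_of_mem_erase hx))).trans_le hnl)
      (hu.trans_le hnl) (Finset.ne_of_mem_erase hx)
  have hcol : ∀ z ∈ (X ∪ nbrs P u).erase y, _ := fun z hz =>
    card_filter_colCollision_le
      ((Finset.mem_range.1 (Finset.union_subset hXn hun (Finset.mem_of_mem_erase hz))).trans_le hn)
      (hy.trans_le hn) (Finset.ne_of_mem_erase hz)
  calc 2 ^ w * 2 ^ w * (2 ^ w * (2 ^ l * 2 ^ (w - l - j)))
      = (Finset.univ.filter fun q : Seed w =>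
          mulShift w q.2.1 q.2.2 (w - l - j) y < 2 ^ l).card := by
        rw [card_filter_snd_seed fun q : Fin (2 ^ w) × Fin (2 ^ w) =>
          mulShift w q.1 q.2 (w - l - j) y < 2 ^ l,
          card_mulShift_lt (two_pow_mul_two_pow_sub_le hlj)]
    _ ≤ ((Finset.univ.filter fun q : Seed w => RecoveredBy l j P u y q) ∪
          (((X ∪ nbrs P y).erase u).biUnion (fun x => Finset.univ.filter fun q : Seed w =>
            mulShift w q.1.1 q.1.2 (w - l) x = mulShift w q.1.1 q.1.2 (w - l) u ∧
              mulShift w q.2.1 q.2.2 (w - l - j) y < 2 ^ l) ∪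
          ((X ∪ nbrs P u).erase y).biUnion fun z => Finset.univ.filter fun q : Seed w =>
            mulShift w q.2.1 q.2.2 (w - l - j) z = mulShift w q.2.1 q.2.2 (w - l - j) y ∧
              mulShift w q.2.1 q.2.2 (w - l - j) y < 2 ^ l)).card := by
        refine Finset.card_le_card fun q hq => ?_
        have hs := (Finset.mem_filter.1 hq).2
        by_contra hcon
        simp only [Finset.mem_union, Finset.mem_biUnion, not_or, not_exists, not_and,
          Finset.mem_filter, Finset.mem_univ, true_and, hs, and_true] at hcon
        exact hcon.1 (recoveredBy_of_forall_ne hsymm hX hs hcon.2.1 hcon.2.2)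
    _ ≤ _ := (Finset.card_union_le _ _).trans
        (Nat.add_le_add_left ((Finset.card_union_le _ _).trans (Nat.add_le_add
          (Finset.card_biUnion_le_card_mul _ _ _ hrow)
          (Finset.card_biUnion_le_card_mul _ _ _ hcol))) _)
    _ ≤ _ := by
        rw [Nat.add_mul, Nat.mul_assoc, Nat.mul_assoc]
        gcongr <;> exact Finset.erase_subset _ _

open Classical in
lemma CoveredGraph.three_mul_le_card_recoveredBy (hP : CoveredGraph n k P) (hk : 256 * k ≤ 2 ^ l)
    (hlj : l + j ≤ w) (hn : n ≤ 2 ^ (w - l - j)) (hy : y ∈ nbrs P u)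
    (hdy : (nbrs P y).card ≤ 4 * k) (hdu : 8 * (nbrs P u).card ≤ 2 ^ (l + j)) :
    3 * (2 ^ w) ^ 4 ≤
      4 * (2 ^ j * (Finset.univ.filter fun q : Seed w => RecoveredBy l j P u y q).card) := by
  obtain ⟨X, hXn, hXcard, hX⟩ := hP.exists_cover_subset_range
  have huy := Finset.mem_product.1 (hP.subset (mem_nbrs.1 hy))
  have hsampled := card_sampled_le (by omega) hlj hn (fun _ _ => hP.symm _ _) hX hXn
    (hP.nbrs_subset_range u) (hP.nbrs_subset_range y) (Finset.mem_range.1 huy.1)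
    (Finset.mem_range.1 huy.2)
  have hrow := Finset.card_union_le X (nbrs P y)
  have hcol := Finset.card_union_le X (nbrs P u)
  have hwl : 2 ^ (w - l) = 2 ^ j * 2 ^ (w - l - j) := by rw [← pow_add]; congr 1; omega
  have hw : 2 ^ w = 2 ^ l * 2 ^ j * 2 ^ (w - l - j) := by rw [← pow_add, ← pow_add]; congr 1; omega
  have hfew : 4 * ((X ∪ nbrs P y).card * 2 ^ (w - l) + (X ∪ nbrs P u).card * 2 ^ (w - l - j)) ≤
      2 ^ w := by
    have hcells : 4 * ((X ∪ nbrs P y).card * 2 ^ j + (X ∪ nbrs P u).card) ≤ 2 ^ l * 2 ^ j := by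
      rw [pow_add] at hdu
      nlinarith [Nat.one_le_two_pow (n := j)]
    rw [hw, hwl]
    nlinarith [Nat.mul_le_mul_right (2 ^ (w - l - j)) hcells]
  have hscaled := Nat.mul_le_mul_left (4 * 2 ^ j) hsampled
  have hfailed := Nat.mul_le_mul_right ((2 ^ w) ^ 3) hfew
  generalize Finset.card (Finset.univ.filter fun q : Seed w => RecoveredBy l j P u y q) = recovered
    at hscaled ⊢
  rw [hwl, hw] at hscaled hfailed
  rw [hw]
  linarith

open Classical in
lemma CoveredGraph.card_not_recoveredBy_le (hP : CoveredGraph n k P) (hk : 256 * k ≤ 2 ^ l)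
    (hl : l ≤ w) (hn : n ≤ 2 ^ (w - l)) (hy : y ∈ nbrs P u) (hdy : (nbrs P y).card ≤ 4 * k)
    (hdu : 8 * (nbrs P u).card ≤ 2 ^ l) :
    100 * (Finset.univ.filter fun q : Seed w => ¬RecoveredBy l 0 P u y q).card ≤
      99 * (2 ^ w) ^ 4 := by
  have hrec := hP.three_mul_le_card_recoveredBy (j := 0) hk hl hn hy hdy hdu
  have hsplit := Finset.card_filter_add_card_filter_not (s := (Finset.univ : Finset (Seed w)))
    fun q => RecoveredBy l 0 P u y q
  rw [card_univ_seed] at hsplit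
  omega

open Classical in
lemma card_filter_recoveredBy_le (q : Seed w) :
    ((nbrs P u).filter fun y => RecoveredBy l j P u y q).card ≤ 2 ^ l := by
  conv_rhs => rw [← Finset.card_range (2 ^ l)]
  refine Finset.card_le_card_of_injOn (mulShift w q.2.1 q.2.2 (w - l - j))
    (fun y hy => Finset.mem_coe.2 (Finset.mem_range.2 (Finset.mem_filter.1 hy).2.1))
    fun y hy y' hy' h => ?_
  simp only [Finset.coe_filter, Set.mem_ofPred_eq, mem_nbrs] at hy hy'
  exact (congrArg Prod.snd (hy.2.2 (u, y') hy'.1 rfl h.symm)).symm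

open Classical in
lemma CoveredGraph.three_mul_card_nbrs_le (hP : CoveredGraph n k P) (hk : 256 * k ≤ 2 ^ l)
    (hlj : l + j ≤ w) (hn : n ≤ 2 ^ (w - l - j)) (hdu : 8 * (nbrs P u).card ≤ 2 ^ (l + j)) :
    3 * (2 ^ w) ^ 4 * (nbrs P u).card ≤ 3 * (2 ^ w) ^ 4 * (2 * k) +
      4 * 2 ^ j * ∑ q : Seed w, ((nbrs P u).filter fun y => RecoveredBy l j P u y q).card := by
  obtain ⟨X, hXcard, hX⟩ := hP.cover
  have hsdiff : (nbrs P u).card ≤ 2 * k + (nbrs P u \ X).card := by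
    have := Finset.le_card_sdiff X (nbrs P u)
    omega
  have hrecovered : ∀ y ∈ nbrs P u \ X, 3 * (2 ^ w) ^ 4 ≤
      4 * 2 ^ j * (Finset.univ.filter fun q : Seed w => RecoveredBy l j P u y q).card := by
    intro y hy
    obtain ⟨hyu, hyX⟩ := Finset.mem_sdiff.1 hy
    rw [Nat.mul_assoc 4]
    exact hP.three_mul_le_card_recoveredBy hk hlj hn hyu
      ((Finset.card_le_card (hX.nbrs_subset hyX)).trans (by omega)) hdu
  have hcomm : ∑ q : Seed w, ((nbrs P u).filter fun y => RecoveredBy l j P u y q).card =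
      ∑ y ∈ nbrs P u, (Finset.univ.filter fun q : Seed w => RecoveredBy l j P u y q).card := by
    simp only [Finset.card_filter]
    exact Finset.sum_comm
  calc 3 * (2 ^ w) ^ 4 * (nbrs P u).card
      ≤ 3 * (2 ^ w) ^ 4 * (2 * k) + (nbrs P u \ X).card • (3 * (2 ^ w) ^ 4) := by
        rw [smul_eq_mul, Nat.mul_comm (nbrs P u \ X).card, ← Nat.mul_add]
        exact Nat.mul_le_mul_left _ hsdiff
    _ ≤ _ := by
        rw [hcomm, Finset.mul_sum]
        exact Nat.add_le_add_left ((Finset.card_nsmul_le_sum _ _ _ hrecovered).trans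
          (Finset.sum_le_sum_of_subset Finset.sdiff_subset)) _

lemma sum_le_card_mul_add_card_filter_lt_mul {ι : Type*} (s : Finset ι) {f : ι → ℕ} {b : ℕ}
    (hf : ∀ i ∈ s, f i ≤ b) (a : ℕ) :
    ∑ i ∈ s, f i ≤ s.card * a + (s.filter fun i => a < f i).card * b := by
  rw [Finset.card_filter, Finset.sum_mul, ← smul_eq_mul, ← Finset.sum_const,
    ← Finset.sum_add_distrib]
  refine Finset.sum_le_sum fun i hi => ?_
  have := hf i hi
  split_ifs <;> omega

open Classical in
/-- At a rate that samples between `2 ^ l / 16` and `2 ^ l / 8` neighbours of `u` on average, a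
sketch recovers more than `10 * k` neighbours on average, and it never recovers more than `2 ^ l`,
which is at most `512 * k`. -/
lemma CoveredGraph.card_few_recoveredBy_le (hP : CoveredGraph n k P) (hk : 256 * k ≤ 2 ^ l)
    (hlj : l + j ≤ w) (hn : n ≤ 2 ^ (w - l - j)) (hk1 : 1 ≤ k) (hk' : 2 ^ l ≤ 512 * k)
    (hdu : 8 * (nbrs P u).card ≤ 2 ^ (l + j)) (hdu' : 2 ^ (l + j) ≤ 16 * (nbrs P u).card) :
    100 * (Finset.univ.filter fun q : Seed w =>
      ((nbrs P u).filter fun y => RecoveredBy l j P u y q).card ≤ 4 * k).card ≤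
      99 * (2 ^ w) ^ 4 := by
  have hlower := hP.three_mul_card_nbrs_le hk hlj hn hdu
  have hupper := sum_le_card_mul_add_card_filter_lt_mul (Finset.univ : Finset (Seed w))
    (fun q _ => card_filter_recoveredBy_le (l := l) (j := j) (P := P) (u := u) q) (4 * k)
  have hsplit := Finset.card_filter_add_card_filter_not (s := (Finset.univ : Finset (Seed w)))
    fun q => ((nbrs P u).filter fun y => RecoveredBy l j P u y q).card ≤ 4 * k
  simp only [not_le] at hsplit
  rw [card_univ_seed] at hsplit hupper
  set many := (Finset.univ.filter fun q : Seed w =>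
    4 * k < ((nbrs P u).filter fun y => RecoveredBy l j P u y q).card).card
  have hdeg : 2 ^ j * (16 * k) ≤ (nbrs P u).card := by
    rw [pow_add, Nat.mul_comm] at hdu'
    have := Nat.mul_le_mul_left (2 ^ j) hk
    linarith
  have hmany : 26 * (2 ^ w) ^ 4 ≤ 2048 * many := by
    have hpos : 0 < 2 ^ j * k := by positivity
    refine Nat.le_of_mul_le_mul_left ?_ hpos
    have hbound := Nat.mul_le_mul_left (4 * 2 ^ j)
      (hupper.trans (Nat.add_le_add_left (Nat.mul_le_mul_left many hk') _))
    have hdeg' := Nat.mul_le_mul_left (3 * (2 ^ w) ^ 4) hdeg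
    have hone := Nat.mul_le_mul_left (6 * k * (2 ^ w) ^ 4) (Nat.one_le_two_pow (n := j))
    linarith
  omega

lemma CoveredGraph.coins_not_informative_le_of_light (hP : CoveredGraph n k P)
    (hk : 256 * k ≤ 2 ^ l) (hw : 0 < w) (hl : l ≤ w) (hn : n ≤ 2 ^ (w - l))
    (hdu : 8 * (nbrs P u).card ≤ 2 ^ l) :
    coins w {ω | ¬Informative l k ω P u} ≤ n * ENNReal.ofReal ((99 / 100) ^ w) := by
  classical
  set light := (nbrs P u).filter fun y => (nbrs P y).card ≤ 4 * k
  have hlight : light.card ≤ n :=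
    (Finset.card_filter_le _ _).trans (by simpa using Finset.card_le_card (hP.nbrs_subset_range u))
  have hsub : {ω : ℕ → Fin (2 ^ w) | ¬Informative l k ω P u} ⊆
      ⋃ y ∈ light, {ω | ∀ t < w * w, t % w = 0 →
        seedOf ω t ∈ Finset.univ.filter fun q : Seed w => ¬RecoveredBy l 0 P u y q} := by
    intro ω hω
    obtain ⟨hunrecovered, -⟩ := not_or.1 hω
    push Not at hunrecovered
    obtain ⟨y, hy, hdy, hrec⟩ := hunrecovered
    simp only [Set.mem_iUnion]
    refine ⟨y, Finset.mem_filter.2 ⟨hy, hdy⟩, fun t ht ht0 =>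
      Finset.mem_filter.2 ⟨Finset.mem_univ _, fun h => hrec t ht ?_⟩⟩
    rwa [recovered_iff_recoveredBy (mem_nbrs.1 hy), ht0]
  calc coins w {ω | ¬Informative l k ω P u}
      ≤ ∑ y ∈ light, coins w {ω | ∀ t < w * w, t % w = 0 →
        seedOf ω t ∈ Finset.univ.filter fun q : Seed w => ¬RecoveredBy l 0 P u y q} :=
        (measure_mono hsub).trans (measure_biUnion_finset_le _ _)
    _ ≤ light.card • ENNReal.ofReal ((99 / 100) ^ w) :=
        Finset.sum_le_card_nsmul _ _ _ fun y hy => coins_level_le hw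
          (hP.card_not_recoveredBy_le hk hl hn (Finset.mem_filter.1 hy).1
            (Finset.mem_filter.1 hy).2 hdu)
    _ ≤ n * ENNReal.ofReal ((99 / 100) ^ w) := by
        rw [nsmul_eq_mul]
        gcongr

lemma CoveredGraph.coins_not_informative_le_of_heavy (hP : CoveredGraph n k P)
    (hk : 256 * k ≤ 2 ^ l) (hj : j < w) (hlj : l + j ≤ w) (hn : n ≤ 2 ^ (w - l - j))
    (hk1 : 1 ≤ k) (hk' : 2 ^ l ≤ 512 * k) (hdu : 8 * (nbrs P u).card ≤ 2 ^ (l + j))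
    (hdu' : 2 ^ (l + j) ≤ 16 * (nbrs P u).card) :
    coins w {ω | ¬Informative l k ω P u} ≤ ENNReal.ofReal ((99 / 100) ^ w) := by
  classical
  refine (measure_mono fun ω hω t ht htj => ?_).trans
    (coins_level_le hj (hP.card_few_recoveredBy_le hk hlj hn hk1 hk' hdu hdu'))
  refine Finset.mem_filter.2 ⟨Finset.mem_univ _, ?_⟩
  by_contra! hmany
  refine hω (.inr ⟨t, ht, hmany.trans_le (Finset.card_le_card fun y hy => ?_)⟩)
  rw [Finset.mem_filter] at hy ⊢
  rw [recovered_iff_recoveredBy (mem_nbrs.1 hy.1), htj]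
  exact hy

lemma exists_sampling_rate {d : ℕ} (hd : 2 ^ l < 8 * d) :
    ∃ j, 8 * d ≤ 2 ^ (l + j) ∧ 2 ^ (l + j) ≤ 16 * d := by
  have := Nat.two_pow_pos l
  have hle := Nat.pow_log_le_self 2 (x := 16 * d) (by omega)
  have hlt := Nat.lt_pow_succ_log_self one_lt_two (16 * d)
  have hl : l ≤ Nat.log 2 (16 * d) := Nat.le_log_of_pow_le one_lt_two (by omega)
  refine ⟨Nat.log 2 (16 * d) - l, ?_⟩
  rw [Nat.add_sub_cancel' hl]
  omega

lemma Sizes.n_mul_two_pow_le (hS : Sizes w l k n) : n * 2 ^ l ≤ 2 ^ w := by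
  have hspace := hS.space
  have hcube := hS.cube
  have hsq : n * n ≤ n * n * n := Nat.le_mul_of_pos_right _ hS.one_le_n
  rcases le_total n (2 ^ l) with h | h
  · have hcells : 2 ^ l * 2 ^ l ≤ cells w l :=
      Nat.le_mul_of_pos_left _ (by have := hS.word_ne_zero; positivity)
    have := Nat.mul_le_mul_right (2 ^ l) h
    simp only [memSize] at hspace
    omega
  · have := Nat.mul_le_mul_left n h
    omega

lemma le_two_pow_sub {i : ℕ} (hi : i ≤ w) (h : n * 2 ^ i ≤ 2 ^ w) : n ≤ 2 ^ (w - i) := by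
  rw [← Nat.sub_add_cancel hi, pow_add] at h
  simpa using Nat.le_of_mul_le_mul_right h (Nat.two_pow_pos i)

theorem coins_not_informative_le (hS : Sizes w l k n) (hP : CoveredGraph n k P) (u : ℕ) :
    coins w {ω | ¬Informative l k ω P u} ≤ n * ENNReal.ofReal ((99 / 100) ^ w) := by
  rcases le_or_gt (8 * (nbrs P u).card) (2 ^ l) with hdu | hdu
  · exact hP.coins_not_informative_le_of_light hS.le_width (Nat.pos_of_ne_zero hS.word_ne_zero)
      hS.le_word (le_two_pow_sub hS.le_word hS.n_mul_two_pow_le) hdu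
  · obtain ⟨j, hj, hj'⟩ := exists_sampling_rate hdu
    have hdeg : (nbrs P u).card ≤ n := by simpa using Finset.card_le_card (hP.nbrs_subset_range u)
    have hn : n * 2 ^ (l + j) ≤ 2 ^ w :=
      calc n * 2 ^ (l + j) ≤ n * (16 * n) := Nat.mul_le_mul_left _ (hj'.trans (by omega))
        _ = 16 * (n * n) := by ring
        _ ≤ 16 * (n * n * n) :=
          Nat.mul_le_mul_left _ (Nat.le_mul_of_pos_right _ hS.one_le_n)
        _ ≤ 2 ^ w := hS.cube
    have hlj : l + j ≤ w := (Nat.pow_le_pow_iff_right one_lt_two).1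
      ((Nat.le_mul_of_pos_left _ hS.one_le_n).trans hn)
    have hl : l ≠ 0 := by
      rintro rfl
      have := hS.le_width
      have := hS.one_le_k
      omega
    refine (hP.coins_not_informative_le_of_heavy hS.le_width (by omega) hlj
      (Nat.sub_sub w l j ▸ le_two_pow_sub hlj hn) hS.one_le_k hS.width_le hj hj').trans
      (le_mul_of_one_le_left' ?_)
    exact_mod_cast hS.one_le_n

end Recovery

/-! ## Streams -/

/-- The ordered pairs of adjacent vertices. -/
def pairs {n : ℕ} (E : Finset (Sym2 (Fin n))) : Finset (ℕ × ℕ) :=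
  (Finset.univ.filter fun p : Fin n × Fin n => s(p.1, p.2) ∈ E).image
    fun p => ((p.1 : ℕ), (p.2 : ℕ))

section MaximalMatchings

variable {n k m : ℕ} {E M : Finset (Sym2 (Fin n))}

lemma mem_pairs {p : ℕ × ℕ} :
    p ∈ pairs E ↔ ∃ x y : Fin n, s(x, y) ∈ E ∧ ((x : ℕ), (y : ℕ)) = p := by
  simp [pairs]

lemma coe_mem_pairs {x y : Fin n} : ((x : ℕ), (y : ℕ)) ∈ pairs E ↔ s(x, y) ∈ E := by
  simp [mem_pairs, ← Fin.ext_iff]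

lemma pairs_empty : pairs (∅ : Finset (Sym2 (Fin n))) = ∅ := by simp [pairs]

lemma pairs_insert (u v : Fin n) :
    pairs (insert s(u, v) E) = {((u : ℕ), (v : ℕ)), ((v : ℕ), (u : ℕ))} ∪ pairs E := by
  ext p
  simp only [mem_pairs, Finset.mem_union, Finset.mem_insert, Finset.mem_singleton, Sym2.eq_iff]
  grind

lemma pairs_erase (u v : Fin n) :
    pairs (E.erase s(u, v)) = pairs E \ {((u : ℕ), (v : ℕ)), ((v : ℕ), (u : ℕ))} := by
  ext p
  simp only [mem_pairs, Finset.mem_sdiff, Finset.mem_insert, Finset.mem_singleton,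
    Finset.mem_erase, ne_eq, Sym2.eq_iff]
  grind

lemma IsMatching.insert {e : Sym2 (Fin n)} (hM : IsMatching E M) (he : e ∈ E)
    (hfree : ∀ f ∈ M, ∀ v ∈ e, v ∉ f) : IsMatching E (insert e M) := by
  refine ⟨Finset.insert_subset he hM.1, fun f hf g hg v hvf hvg => ?_⟩
  rcases Finset.mem_insert.1 hf with rfl | hfM <;>
    rcases Finset.mem_insert.1 hg with rfl | hgM
  · rfl
  · exact absurd hvg (hfree g hgM v hvf)
  · exact absurd hvf (hfree f hfM v hvg)
  · exact hM.2 f hfM g hgM v hvf hvg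

lemma isMaximalMatching_iff :
    IsMaximalMatching E M ↔ IsMatching E M ∧ ∀ e ∈ E, ∃ f ∈ M, ∃ v ∈ e, v ∈ f := by
  refine ⟨fun h => ⟨h.prop, fun e he => ?_⟩, fun ⟨hM, hcover⟩ => ⟨hM, fun M' hM' hle e he => ?_⟩⟩
  · by_contra! hfree
    have hmem : e ∈ M := h.le_of_ge (h.prop.insert he hfree) (Finset.subset_insert e M)
      (Finset.mem_insert_self e M)
    exact hfree e hmem _ e.out_fst_mem e.out_fst_mem
  · obtain ⟨f, hf, v, hve, hvf⟩ := hcover e (hM'.1 he)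
    rwa [hM'.2 e he f (hle hf) v hve hvf]

theorem coveredGraph_pairs (hloop : ∀ x, s(x, x) ∉ E) (hM : IsMaximalMatching E M)
    (hk : M.card ≤ k) : CoveredGraph n k (pairs E) := by
  refine ⟨fun p hp => ?_, fun x y h => ?_, fun x h => ?_,
    M.biUnion fun e => e.toFinset.image Fin.val, ?_, fun x y h => ?_⟩
  · obtain ⟨x, y, -, rfl⟩ := mem_pairs.1 hp
    simp
  · obtain ⟨x, y, hxy, ⟨⟩⟩ := mem_pairs.1 h
    rwa [coe_mem_pairs, Sym2.eq_swap]
  · obtain ⟨y, z, hyz, heq⟩ := mem_pairs.1 h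
    obtain rfl : y = z := Fin.ext (by grind)
    exact hloop y hyz
  · refine (Finset.card_biUnion_le_card_mul M _ 2 fun e _ => ?_).trans (by omega)
    refine Finset.card_image_le.trans ?_
    rw [Sym2.card_toFinset]
    split_ifs <;> omega
  · obtain ⟨x, y, hxy, ⟨⟩⟩ := mem_pairs.1 h
    obtain ⟨f, hf, v, hv, hvf⟩ := (isMaximalMatching_iff.1 hM).2 _ hxy
    have hcover : (v : ℕ) ∈ M.biUnion fun e => e.toFinset.image Fin.val :=
      Finset.mem_biUnion.2 ⟨f, hf, Finset.mem_image_of_mem _ (Sym2.mem_toFinset.2 hvf)⟩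
    rcases Sym2.mem_iff.1 hv with rfl | rfl
    · exact .inl hcover
    · exact .inr hcover

theorem listsMaximalMatching_of_vertexCover {N : ℕ → ℕ × ℕ} (hN : IsMatchingSeq (pairs E) N m)
    (hcover : VertexCover (pairs E) (matched N m)) :
    ListsMaximalMatching E ((List.range m).flatMap fun i => [(N i).1, (N i).2]) := by
  choose a b hab heq using fun i : Fin m => mem_pairs.1 (hN.edge i i.2)
  have hends (i : Fin m) (v : Fin n) : v ∈ s(a i, b i) ↔ (v : ℕ) ∈ ends (N i) := by
    rw [Sym2.mem_iff, mem_ends, ← heq i, Fin.ext_iff, Fin.ext_iff]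
  have hshare (i j : Fin m) (v) (hi : v ∈ s(a i, b i)) (hj : v ∈ s(a j, b j)) : i = j := by
    by_contra hne
    exact Finset.disjoint_left.1 (hN.disjoint (by simp) (by simp) (Fin.val_injective.ne hne))
      ((hends i v).1 hi) ((hends j v).1 hj)
  refine ⟨(List.finRange m).map fun i => (a i, b i), ?_, ?_, isMaximalMatching_iff.2 ⟨⟨?_, ?_⟩, ?_⟩⟩
  · simp only [← List.map_coe_finRange_eq_range, List.flatMap_map, ← heq]
  · rw [List.map_map]
    refine (List.nodup_finRange m).map fun i j (hij : s(a i, b i) = s(a j, b j)) => ?_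
    exact hshare i j (a i) (Sym2.mem_mk_left _ _) (hij ▸ Sym2.mem_mk_left _ _)
  · intro e he
    obtain ⟨i, rfl⟩ : ∃ i, s(a i, b i) = e := by simpa using he
    exact hab i
  · intro e he f hf v hve hvf
    obtain ⟨i, rfl⟩ : ∃ i, s(a i, b i) = e := by simpa using he
    obtain ⟨j, rfl⟩ : ∃ j, s(a j, b j) = f := by simpa using hf
    rw [hshare i j v hve hvf]
  · intro e he
    obtain ⟨v, hv, i, hi, hvi⟩ : ∃ v ∈ e, ∃ i < m, (v : ℕ) ∈ ends (N i) := by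
      induction e using Sym2.ind with
      | _ x y =>
        rcases hcover x y (coe_mem_pairs.2 he) with hx | hy
        · exact ⟨x, Sym2.mem_mk_left _ _, mem_matched.1 hx⟩
        · exact ⟨y, Sym2.mem_mk_right _ _, mem_matched.1 hy⟩
    exact ⟨s(a ⟨i, hi⟩, b ⟨i, hi⟩),
      List.mem_toFinset.2 (List.mem_map.2 ⟨_, List.mem_map_of_mem (List.mem_finRange _), rfl⟩),
      v, hv, (hends ⟨i, hi⟩ v).2 hvi⟩

end MaximalMatchings

/-- Code of the kind of an update, as passed to the update program. -/
def Update.op {n : ℕ} : Update n → ℕ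
  | .insert _ _ => 0
  | .delete _ _ => 1

/-- First end point of an update. -/
def Update.left {n : ℕ} : Update n → Fin n
  | .insert u _ => u
  | .delete u _ => u

/-- Second end point of an update. -/
def Update.right {n : ℕ} : Update n → Fin n
  | .insert _ v => v
  | .delete _ v => v

section Updates

variable {n : ℕ} {E : Finset (Sym2 (Fin n))} {a : Update n} {S : List (Update n)}

lemma Update.args_eq (a : Update n) : a.args = [a.op, (a.left : ℕ), (a.right : ℕ)] := by
  cases a <;> rfl

lemma Update.op_le_one (a : Update n) : a.op ≤ 1 := by cases a <;> simp [Update.op]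

lemma Update.apply_loopless (h : a.Admissible E) (hloop : ∀ x, s(x, x) ∉ E) (x : Fin n) :
    s(x, x) ∉ a.apply E := by
  cases a with
  | insert u v =>
    simp only [Update.apply, Finset.mem_insert, Sym2.eq_iff]
    rintro ((⟨rfl, rfl⟩ | ⟨rfl, rfl⟩) | hx)
    exacts [h.1 rfl, h.1 rfl, hloop x hx]
  | delete u v => exact fun hx => hloop x (Finset.mem_of_mem_erase hx)

lemma Update.edgeStep (h : a.Admissible E) :
    EdgeStep a.op a.left a.right (pairs E) (pairs (a.apply E)) := by
  cases a with
  | insert u v => exact .inl ⟨rfl, fun huv => h.2 (coe_mem_pairs.1 huv), pairs_insert u v⟩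
  | delete u v => exact .inr ⟨rfl, coe_mem_pairs.2 h, pairs_erase u v⟩

lemma edges_take_succ {i : ℕ} (h : i < S.length) :
    edges (S.take (i + 1)) = S[i].apply (edges (S.take i)) := by
  rw [edges, List.take_succ_eq_append_getElem h, List.foldl_append]
  rfl

lemma IsStream.loopless (hS : IsStream S) : ∀ i ≤ S.length, ∀ x, s(x, x) ∉ edges (S.take i)
  | 0, _ => by simp [edges]
  | i + 1, hi => by
    rw [edges_take_succ hi]
    exact Update.apply_loopless (hS i hi) (hS.loopless i (by omega))

lemma IsStream.coveredGraph {k i : ℕ} (hS : IsStream S) (hpr : Promise k S) (hi : i ≤ S.length) :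
    CoveredGraph n k (pairs (edges (S.take i))) := by
  obtain ⟨M, hM, hk⟩ := hpr i hi
  exact coveredGraph_pairs (hS.loopless i hi) hM hk

end Updates

/-- The sketching algorithm. -/
def sketchAlgorithm : Algorithm := ⟨setupProgram, updateProgram, queryProgram⟩

/-- Bound for the running time of each of the three programs. -/
def timeBound (w l k : ℕ) : ℕ := updateTime w l k + (w * 4 + w * w * 12 + 20) + (2 * k * 8 + 5)

/-- All searches for a new partner in the course of the stream are supported by the sketches. -/
def InformativeStream {w n : ℕ} (l k : ℕ) (ω : ℕ → Fin (2 ^ w)) (S : List (Update n)) : Prop :=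
  ∀ (i : ℕ) (h : i < S.length),
    Informative l k ω (pairs (edges (S.take (i + 1)))) S[i].left ∧
    Informative l k ω (pairs (edges (S.take (i + 1)))) S[i].right

/-- The configuration reached after the first `i` updates of a stream: the memory holds a matching,
which is maximal if the sketches support all searches. -/
def GoodAt {w n : ℕ} (l k : ℕ) (ω : ℕ → Fin (2 ^ w)) (S : List (Update n)) (i : ℕ)
    (σ : Config) : Prop :=
  ∃ m, Invariant l ω (pairs (edges (S.take i))) σ.mem m ∧
    (InformativeStream l k ω S →
      VertexCover (pairs (edges (S.take i))) (matched (storedEdge σ.mem) m))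

lemma exists_seq_of_step {α : Type*} {L : ℕ} {p : ℕ → α → Prop} {R : ℕ → α → α → Prop} {x₀ : α}
    (h₀ : p 0 x₀) (hstep : ∀ i < L, ∀ x, p i x → ∃ y, R i x y ∧ p (i + 1) y) :
    ∃ σ : ℕ → α, σ 0 = x₀ ∧ (∀ i < L, R i (σ i) (σ (i + 1))) ∧ ∀ i ≤ L, p i (σ i) := by
  have hstep' (i : ℕ) (x : α) : ∃ y, i < L → p i x → R i x y ∧ p (i + 1) y := by
    by_cases h : i < L ∧ p i x
    · obtain ⟨y, hy⟩ := hstep i h.1 x h.2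
      exact ⟨y, fun _ _ => hy⟩
    · exact ⟨x, fun hi hx => absurd ⟨hi, hx⟩ h⟩
  choose f hf using hstep'
  let σ : ℕ → α := fun i => Nat.rec x₀ f i
  have hp (i : ℕ) (hi : i ≤ L) : p i (σ i) := by
    induction i with
    | zero => exact h₀
    | succ i ih => exact (hf i (σ i) hi (ih (by omega))).2
  exact ⟨σ, rfl, fun i hi => (hf i (σ i) hi (hp i hi.le)).1, hp⟩

section Runs

variable {w l k n d i m : ℕ} {ω : ℕ → Fin (2 ^ w)} {S : List (Update n)} {σ : Config} {T : ℝ}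

lemma exists_exec_of_reaches {s t T' : ℕ} {a : Cmd} {Q : Config → Prop} (h : Reaches w s ω a σ t Q)
    (ht : t ≤ T') (hT : (T' : ℝ) ≤ T) :
    ∃ τ, (∃ t : ℕ, (t : ℝ) ≤ T ∧ Exec w s ω a σ t τ) ∧ Q τ := by
  obtain ⟨t', τ, ht', hx, hQ⟩ := h
  exact ⟨τ, ⟨t', le_trans (by exact_mod_cast ht'.trans ht) hT, hx⟩, hQ⟩

lemma exists_setup (hS : Sizes w l k n) (hl : l = Nat.clog 2 (256 * k)) (hkn : k ≤ n)
    (hT : (timeBound w l k : ℝ) ≤ T) :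
    ∃ τ, (∃ t : ℕ, (t : ℝ) ≤ T ∧
        Exec w (memSize w l) ω setupProgram (Config.blank.call w [n, k, d, w]) t τ) ∧
      GoodAt l k ω S 0 τ := by
  obtain ⟨τ, hτ, hinv⟩ := exists_exec_of_reaches (reaches_setupProgram (ω := ω) hS hl
    (σ := Config.blank.call w [n, k, d, w]) (Nat.mod_eq_of_lt (hkn.trans_lt hS.n_lt))
    (Nat.mod_eq_of_lt Nat.lt_two_pow_self) (fun _ => rfl) rfl)
    (by rw [timeBound]; omega) hT
  exact ⟨τ, hτ, 0, by simpa [edges, pairs_empty] using hinv,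
    fun _ x y hxy => by simp [edges, pairs_empty] at hxy⟩

lemma exists_update (hS : Sizes w l k n) (hst : IsStream S) (hpr : Promise k S)
    (hT : (timeBound w l k : ℝ) ≤ T) (hi : i < S.length) (hσ : GoodAt l k ω S i σ) :
    ∃ τ, (∃ t : ℕ, (t : ℝ) ≤ T ∧
        Exec w (memSize w l) ω updateProgram (σ.call w S[i].args) t τ) ∧
      GoodAt l k ω S (i + 1) τ := by
  obtain ⟨m, hinv, hcover⟩ := hσ
  have hop : S[i].op < 2 ^ w :=
    S[i].op_le_one.trans_lt (Nat.one_lt_two_pow hS.word_ne_zero)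
  rw [Update.args_eq]
  obtain ⟨τ, hτ, m', hinv', hcover'⟩ := exists_exec_of_reaches
    (reaches_updateProgram (ω := ω) hS
    (σ := σ.call w [S[i].op, S[i].left, S[i].right]) (hst.coveredGraph hpr hi.le)
    (hst.coveredGraph hpr hi) (edges_take_succ hi ▸ Update.edgeStep (hst i hi)) hinv
    (Nat.mod_eq_of_lt hop) (Nat.mod_eq_of_lt (S[i].left.2.trans hS.n_lt))
    (Nat.mod_eq_of_lt (S[i].right.2.trans hS.n_lt))) (by rw [timeBound]; omega) hT
  exact ⟨τ, hτ, m', hinv', fun h => hcover' (hcover h) fun _ => h i hi⟩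

lemma exists_answer (hS : Sizes w l k n) (hst : IsStream S) (hpr : Promise k S)
    (hT : (timeBound w l k : ℝ) ≤ T) (hi : i ≤ S.length) (hσ : GoodAt l k ω S i σ) :
    ∃ out, Answers sketchAlgorithm w (memSize w l) ω T σ out ∧
      (InformativeStream l k ω S → ListsMaximalMatching (edges (S.take i)) out) := by
  obtain ⟨m, hinv, hcover⟩ := hσ
  have hm := hinv.stored.le_of_coveredGraph (hst.coveredGraph hpr hi)
  obtain ⟨τ, ⟨t, ht, hx⟩, hout⟩ := exists_exec_of_reaches
    (reaches_queryProgram (ω := ω) hS (σ := σ.call w []) hm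
    hinv.size rfl) (by rw [timeBound]; omega) hT
  exact ⟨_, ⟨t, τ, ht, hx, hx.frame.mem rfl, hx.frame.pos rfl, hout⟩,
    fun h => listsMaximalMatching_of_vertexCover hinv.stored (hcover h)⟩

theorem exists_isRun (hS : Sizes w l k n) (hl : l = Nat.clog 2 (256 * k)) (hkn : k ≤ n)
    (hst : IsStream S) (hpr : Promise k S) (hT : (timeBound w l k : ℝ) ≤ T) (d : ℕ)
    (ω : ℕ → Fin (2 ^ w)) :
    ∃ σ : ℕ → Config, IsRun sketchAlgorithm w (memSize w l) ω [n, k, d, w] S T σ ∧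
      ∀ i ≤ S.length, ∃ out, Answers sketchAlgorithm w (memSize w l) ω T (σ i) out ∧
        (InformativeStream l k ω S → ListsMaximalMatching (edges (S.take i)) out) := by
  obtain ⟨σ₀, hsetup, hgood⟩ := exists_setup (ω := ω) (d := d) (S := S) hS hl hkn hT
  obtain ⟨σ, rfl, hupdate, hgood⟩ := exists_seq_of_step (L := S.length)
    (R := fun i x y => ∀ h : i < S.length, ∃ t : ℕ, (t : ℝ) ≤ T ∧
      Exec w (memSize w l) ω updateProgram (x.call w S[i].args) t y) hgood fun i hi x hx =>
    let ⟨y, hxy, hy⟩ := exists_update hS hst hpr hT hi hx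
    ⟨y, fun _ => hxy, hy⟩
  exact ⟨σ, ⟨hsetup, fun i hi => hupdate i hi hi⟩,
    fun i hi => exists_answer hS hst hpr hT hi (hgood i hi)⟩

theorem coins_not_informativeStream_le (hS : Sizes w l k n) (hst : IsStream S)
    (hpr : Promise k S) : coins w {ω | ¬InformativeStream l k ω S} ≤
      ENNReal.ofReal (S.length * (2 * (n * (99 / 100) ^ w))) := by
  set bad : Fin S.length → Fin n → Set (ℕ → Fin (2 ^ w)) := fun i x =>
    {ω | ¬Informative l k ω (pairs (edges (S.take (i + 1)))) x}
  have hsub : {ω | ¬InformativeStream l k ω S} ⊆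
      ⋃ i ∈ (Finset.univ : Finset (Fin S.length)), (bad i S[i].left ∪ bad i S[i].right) := by
    intro ω hω
    simp only [Set.mem_ofPred_eq, InformativeStream, not_forall, not_and_or] at hω
    obtain ⟨i, hi, h⟩ := hω
    exact Set.mem_iUnion₂.2 ⟨⟨i, hi⟩, Finset.mem_univ _, h⟩
  have hone (i : Fin S.length) (x : Fin n) :
      coins w (bad i x) ≤ ENNReal.ofReal (n * (99 / 100) ^ w) := by
    rw [ENNReal.ofReal_mul (by positivity), ENNReal.ofReal_natCast]
    exact coins_not_informative_le hS (hst.coveredGraph hpr i.2) x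
  refine (measure_mono hsub).trans ((measure_biUnion_finset_le _ _).trans ?_)
  refine (Finset.sum_le_card_nsmul _ _ (ENNReal.ofReal (2 * (n * (99 / 100) ^ w)))
    fun i _ => ?_).trans_eq ?_
  · rw [two_mul, ENNReal.ofReal_add (by positivity) (by positivity)]
    exact (measure_union_le _ _).trans (add_le_add (hone i _) (hone i _))
  · rw [Finset.card_univ, Fintype.card_fin, nsmul_eq_mul, ← ENNReal.ofReal_natCast,
      ← ENNReal.ofReal_mul (by positivity)]

end Runs

/-! ## Choice of the constants -/

section Constants

variable {c n k w l lam : ℕ} {δ : ℝ}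

lemma clog_two_bounds {x : ℕ} (hx : 2 ≤ x) : x ≤ 2 ^ Nat.clog 2 x ∧ 2 ^ Nat.clog 2 x ≤ 2 * x := by
  refine ⟨Nat.le_pow_clog one_lt_two x, ?_⟩
  obtain ⟨l, hl⟩ := Nat.exists_eq_succ_of_ne_zero (Nat.clog_pos one_lt_two hx).ne'
  have h := Nat.pow_pred_clog_lt_self one_lt_two hx
  rw [hl, Nat.pred_succ] at h
  rw [hl, pow_succ]
  omega

lemma lt_two_pow_div_eight (w : ℕ) : w < 2 ^ (w / 8 + 3) := by
  have h : w / 8 < 2 ^ (w / 8) := Nat.lt_two_pow_self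
  rw [pow_add]
  omega

theorem Sizes.of_le_word (hk : 1 ≤ k) (hkn : k ≤ n) (hn : n ≤ 2 ^ lam) (hlam : 2 ≤ lam)
    (hw : 140 * lam ≤ w) : Sizes w (Nat.clog 2 (256 * k)) k n := by
  obtain ⟨hle, hge⟩ := clog_two_bounds (x := 256 * k) (by omega)
  generalize Nat.clog 2 (256 * k) = l at hle hge
  have hl : l ≤ lam + 9 := by
    refine (Nat.pow_le_pow_iff_right one_lt_two).1 ?_
    rw [pow_add]
    omega
  refine ⟨hk, hle, by omega, by omega, by omega, ?_, by omega, ?_⟩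
  · have hw' := (lt_two_pow_div_eight w).le
    calc 2 * memSize w l = 2 ^ 5 * (w * w * (2 ^ l * 2 ^ l)) := by rw [memSize, cells]; ring
      _ ≤ 2 ^ 5 * (2 ^ (w / 8 + 3) * 2 ^ (w / 8 + 3) * (2 ^ (lam + 9) * 2 ^ (lam + 9))) := by
          gcongr <;> exact one_le_two
      _ = 2 ^ (5 + (w / 8 + 3 + (w / 8 + 3) + (lam + 9 + (lam + 9)))) := by simp only [pow_add]
      _ ≤ 2 ^ w := Nat.pow_le_pow_right two_pos (by omega)
  · calc 16 * (n * n * n) ≤ 2 ^ 4 * (2 ^ lam * 2 ^ lam * 2 ^ lam) := by gcongr; norm_num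
      _ = 2 ^ (4 + (lam + lam + lam)) := by simp only [pow_add]
      _ ≤ 2 ^ w := Nat.pow_le_pow_right two_pos (by omega)

lemma Sizes.timeBound_le (hS : Sizes w l k n) : timeBound w l k ≤ 2 ^ 22 * k * w ^ 3 := by
  have hk := hS.one_le_k
  have hw : 1 ≤ w := Nat.one_le_iff_ne_zero.2 hS.word_ne_zero
  have hwidth := hS.width_le
  calc timeBound w l k
      = w * w * (2 * (2 ^ l * 17 + 2 * k * 24 + 21) + 52) + w * 4 + (k * 34 + 105) := by
        rw [timeBound, updateTime, repairTime]; ring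
    _ ≤ w * w * (w * (20000 * k)) + w * (w * w * (4 * k)) + w * (w * w) * (139 * k) := by
        gcongr ?_ + ?_ + ?_
        · exact Nat.mul_le_mul_left _ (by nlinarith)
        · exact Nat.mul_le_mul_left _ (by nlinarith [Nat.mul_pos hw hw])
        · nlinarith [Nat.mul_pos hw (Nat.mul_pos hw hw)]
    _ = 20143 * k * w ^ 3 := by ring
    _ ≤ 2 ^ 22 * k * w ^ 3 := by gcongr; norm_num

lemma Sizes.space_le (hS : Sizes w l k n) (r : ℕ) :
    (memSize w l + r) * w ≤ (2 ^ 22 + r) * k ^ 2 * w ^ 3 := by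
  have hkw : 1 ≤ k ^ 2 * w ^ 2 :=
    Nat.mul_pos (pow_pos hS.one_le_k 2) (pow_pos (Nat.pos_of_ne_zero hS.word_ne_zero) 2)
  calc (memSize w l + r) * w = (16 * (w * w * (2 ^ l * 2 ^ l)) + r) * w := by rw [memSize, cells]
    _ ≤ (16 * (w * w * (512 * k * (512 * k))) + r * (k ^ 2 * w ^ 2)) * w := by
        gcongr
        · exact hS.width_le
        · exact hS.width_le
        · exact Nat.le_mul_of_pos_right r hkw
    _ = (2 ^ 22 + r) * k ^ 2 * w ^ 3 := by ring

lemma lt_div_self_of_lt_one (hn : 2 ≤ n) (hδ : 0 < δ) (hδ1 : δ < 1) : (n : ℝ) < n / δ :=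
  (lt_div_iff₀ hδ).2 (mul_lt_of_lt_one_right (by positivity) hδ1)

lemma one_le_logb (hn : 2 ≤ n) : 1 ≤ Real.logb 2 n := by
  rw [Real.le_logb_iff_rpow_le one_lt_two (by positivity), Real.rpow_one]
  exact_mod_cast hn

lemma logb_lt_logb_div (hn : 2 ≤ n) (hδ : 0 < δ) (hδ1 : δ < 1) :
    Real.logb 2 n < Real.logb 2 (n / δ) :=
  Real.logb_lt_logb one_lt_two (by positivity) (lt_div_self_of_lt_one hn hδ hδ1)

lemma le_two_pow_ceil_logb {x : ℝ} (hx : 0 < x) : x ≤ 2 ^ ⌈Real.logb 2 x⌉₊ := by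
  rw [← Real.rpow_natCast, ← Real.logb_le_iff_le_rpow one_lt_two hx]
  exact Nat.le_ceil _

/-- A word length of `140 * (c + 1) * lam` bits suffices because `(99 / 100) ^ 70 ≤ 1 / 2`. -/
lemma failure_le (hn : 2 ≤ n) (hδ : 0 < δ) (hδ1 : δ < 1) (hlam : n / δ ≤ 2 ^ lam) :
    (n : ℝ) ^ c * (2 * (n * (99 / 100) ^ (140 * (c + 1) * lam))) ≤ δ / n ^ c := by
  have hn2 : (2 : ℝ) ≤ n := by exact_mod_cast hn
  have hhalf : ((1 : ℝ) / 2) ^ lam ≤ δ / n := by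
    rw [one_div, inv_pow, inv_le_comm₀ (by positivity) (by positivity), inv_div]
    exact hlam
  have hpow : (99 / 100 : ℝ) ^ (140 * (c + 1) * lam) ≤ δ / n ^ (2 * c + 2) :=
    calc (99 / 100 : ℝ) ^ (140 * (c + 1) * lam) = (((99 / 100) ^ 70) ^ lam) ^ (2 * c + 2) := by
          rw [← pow_mul, ← pow_mul]; congr 1; ring
      _ ≤ ((1 / 2) ^ lam) ^ (2 * c + 2) := by gcongr; norm_num
      _ ≤ (δ / n) ^ (2 * c + 2) := by gcongr
      _ = δ ^ (2 * c + 2) / n ^ (2 * c + 2) := div_pow ..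
      _ ≤ δ / n ^ (2 * c + 2) := by
          gcongr
          exact pow_le_of_le_one hδ.le hδ1.le (by omega)
  calc (n : ℝ) ^ c * (2 * (n * (99 / 100) ^ (140 * (c + 1) * lam)))
      ≤ n ^ c * (n * (n * (δ / n ^ (2 * c + 2)))) := by gcongr
    _ = δ / n ^ c := by
        rw [show 2 * c + 2 = c + c + 1 + 1 by ring]
        field_simp
        ring

end Constants

section Maintenance

variable {A : Algorithm} {c n k w l : ℕ} {δ B T Q B' T' Q' : ℝ}

lemma IsRun.mono {s : ℕ} {ω : ℕ → Fin (2 ^ w)} {ps : List ℕ} {S : List (Update n)}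
    {σ : ℕ → Config} (h : IsRun A w s ω ps S T σ) (hT : T ≤ T') : IsRun A w s ω ps S T' σ := by
  obtain ⟨⟨t, ht, hx⟩, hupdate⟩ := h
  refine ⟨⟨t, ht.trans hT, hx⟩, fun i hi => ?_⟩
  obtain ⟨t, ht, hx⟩ := hupdate i hi
  exact ⟨t, ht.trans hT, hx⟩

lemma Answers.mono {s : ℕ} {ω : ℕ → Fin (2 ^ w)} {σ : Config} {out : List ℕ}
    (h : Answers A w s ω Q σ out) (hQ : Q ≤ Q') : Answers A w s ω Q' σ out := by
  obtain ⟨t, τ, ht, hx⟩ := h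
  exact ⟨t, τ, ht.trans hQ, hx⟩

lemma Maintains.mono (h : Maintains A c n k δ w B T Q) (hB : B ≤ B') (hT : T ≤ T')
    (hQ : Q ≤ Q') : Maintains A c n k δ w B' T' Q' := by
  obtain ⟨s, hs, h⟩ := h
  refine ⟨s, hs.trans hB, fun S hS hlen hpr => ⟨fun ω => ?_, ?_⟩⟩
  · obtain ⟨σ, hrun, hans⟩ := (h S hS hlen hpr).1 ω
    exact ⟨σ, hrun.mono hT, fun i hi => (hans i hi).imp fun _ hout => hout.mono hQ⟩
  · refine (measure_mono ?_).trans (h S hS hlen hpr).2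
    refine fun ω hω hex => hω ?_
    obtain ⟨σ, hrun, hans⟩ := hex
    exact ⟨σ, hrun.mono hT,
      fun i hi => (hans i hi).imp fun _ hout => ⟨hout.1.mono hQ, hout.2⟩⟩

theorem Sizes.maintains (hS : Sizes w l k n) (hl : l = Nat.clog 2 (256 * k)) (hkn : k ≤ n)
    (hfail : (n : ℝ) ^ c * (2 * (n * (99 / 100) ^ w)) ≤ δ / n ^ c) :
    Maintains sketchAlgorithm c n k δ w ((memSize w l + sketchAlgorithm.numRegs) * w : ℕ)
      (timeBound w l k) (timeBound w l k) := by
  refine ⟨memSize w l, le_rfl, fun S hst hlen hpr => ⟨fun ω => ?_, ?_⟩⟩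
  · obtain ⟨σ, hrun, hans⟩ := exists_isRun hS hl hkn hst hpr le_rfl ⌈1 / δ⌉₊ ω
    exact ⟨σ, hrun, fun i hi => (hans i hi).imp fun _ hout => hout.1⟩
  · refine (measure_mono ?_).trans
      ((coins_not_informativeStream_le hS hst hpr).trans (ENNReal.ofReal_le_ofReal ?_))
    · refine fun ω hω hinf => hω ?_
      obtain ⟨σ, hrun, hans⟩ := exists_isRun hS hl hkn hst hpr le_rfl ⌈1 / δ⌉₊ ω
      exact ⟨σ, hrun, fun i hi => (hans i hi).imp fun _ hout => ⟨hout.1, hout.2 hinf⟩⟩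
    · refine le_trans ?_ hfail
      gcongr
      exact_mod_cast hlen

theorem exists_maintains (c : ℕ) : ∃ C : ℕ, ∀ (n k : ℕ) (δ : ℝ), 2 ≤ n → 1 ≤ k → k ≤ n → 0 < δ →
    δ < 1 → Maintains sketchAlgorithm c n k δ (140 * (c + 1) * ⌈Real.logb 2 (n / δ)⌉₊)
      (C * (k : ℝ) ^ 2 * Real.logb 2 (n / δ) ^ 3)
      (C * (k : ℝ) * Real.logb 2 (n / δ) ^ 3)
      (C * (k : ℝ) * Real.logb 2 (n / δ) ^ 3) := by
  refine ⟨(2 ^ 22 + sketchAlgorithm.numRegs) * (280 * (c + 1)) ^ 3,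
    fun n k δ hn hk hkn hδ hδ1 => ?_⟩
  have hlog : 1 < Real.logb 2 (n / δ) := (one_le_logb hn).trans_lt (logb_lt_logb_div hn hδ hδ1)
  have hlam : n / δ ≤ 2 ^ ⌈Real.logb 2 (n / δ)⌉₊ := le_two_pow_ceil_logb (by positivity)
  have hnlam : n ≤ 2 ^ ⌈Real.logb 2 (n / δ)⌉₊ := by
    exact_mod_cast (lt_div_self_of_lt_one hn hδ hδ1).le.trans hlam
  have hceil : (⌈Real.logb 2 (n / δ)⌉₊ : ℝ) ≤ 2 * Real.logb 2 (n / δ) := by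
    linarith [Nat.ceil_lt_add_one (zero_le_one.trans hlog.le)]
  have hlam2 : 2 ≤ ⌈Real.logb 2 (n / δ)⌉₊ := Nat.lt_ceil.2 (by simpa using hlog)
  have hS := Sizes.of_le_word hk hkn hnlam hlam2
    (Nat.mul_le_mul_right _ (Nat.le_mul_of_pos_right 140 c.succ_pos))
  have hfail := failure_le (c := c) hn hδ hδ1 hlam
  generalize Real.logb 2 (n / δ) = Λ at *
  set w := 140 * (c + 1) * ⌈Λ⌉₊ with hw
  have hword : (w : ℝ) ≤ 280 * (c + 1) * Λ := by
    rw [hw]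
    push_cast
    nlinarith
  have htime := hS.timeBound_le
  have hspace := hS.space_le sketchAlgorithm.numRegs
  have hK : 2 ^ 22 ≤ 2 ^ 22 + sketchAlgorithm.numRegs := le_self_add
  generalize 2 ^ 22 + sketchAlgorithm.numRegs = C at hspace hK ⊢
  have hbound {K x y : ℕ} (hx : x ≤ K * y * w ^ 3) (hK : K ≤ C) :
      (x : ℝ) ≤ (C * (280 * (c + 1)) ^ 3 : ℕ) * y * Λ ^ 3 :=
    calc (x : ℝ) ≤ K * y * w ^ 3 := by exact_mod_cast hx
      _ ≤ C * y * (280 * (c + 1) * Λ) ^ 3 := by gcongr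
      _ = _ := by push_cast; ring
  refine (hS.maintains rfl hkn hfail).mono ?_ (hbound htime hK) (hbound htime hK)
  exact_mod_cast hbound hspace le_rfl

end Maintenance

section SquareRoot

variable {C b k n Λ : ℝ} {q : ℕ}

lemma time_le_of_le_sqrt (hC : 0 ≤ C) (hb : 1 ≤ b) (hΛ : 1 ≤ Λ) (hk : k ≤ b * √n * Λ ^ q) :
    C * k * Λ ^ 3 ≤ C * b ^ 2 * √n * Λ ^ (3 + 2 * q) :=
  calc C * k * Λ ^ 3 ≤ C * (b * √n * Λ ^ q) * Λ ^ 3 := by gcongr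
    _ = C * b * √n * Λ ^ (3 + q) := by rw [pow_add]; ring
    _ ≤ C * b ^ 2 * √n * Λ ^ (3 + 2 * q) := by
        gcongr
        · exact le_self_pow₀ hb two_ne_zero
        · omega

lemma space_le_of_le_sqrt (hC : 0 ≤ C) (hΛ : 0 ≤ Λ) (hn : 0 ≤ n) (hk0 : 0 ≤ k)
    (hk : k ≤ b * √n * Λ ^ q) : C * k ^ 2 * Λ ^ 3 ≤ C * b ^ 2 * n * Λ ^ (3 + 2 * q) :=
  calc C * k ^ 2 * Λ ^ 3 ≤ C * (b * √n * Λ ^ q) ^ 2 * Λ ^ 3 := by gcongr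
    _ = C * b ^ 2 * √n ^ 2 * Λ ^ (3 + 2 * q) := by ring
    _ = C * b ^ 2 * n * Λ ^ (3 + 2 * q) := by rw [Real.sq_sqrt hn]

end SquareRoot

end DynStream

theorem mainTheorem4 (c : ℕ) :
    ∃ (A : DynStream.Algorithm) (W C p : ℕ),
      (∀ (n k : ℕ) (δ : ℝ), 2 ≤ n → 1 ≤ k → k ≤ n → 0 < δ → δ < 1 →
        DynStream.Maintains A c n k δ (W * ⌈Real.logb 2 (n / δ)⌉₊)
          (C * (k : ℝ) ^ 2 * Real.logb 2 (n / δ) ^ p)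
          (C * (k : ℝ) * Real.logb 2 (n / δ) ^ p)
          (C * (k : ℝ) * Real.logb 2 (n / δ) ^ p)) ∧
      (∀ (a : ℝ) (q : ℕ), ∃ C' p' : ℕ,
        ∀ (n k : ℕ) (δ : ℝ), 2 ≤ n → 1 ≤ k → k ≤ n → 0 < δ → δ < 1 →
          (k : ℝ) ≤ a * Real.sqrt n * Real.logb 2 n ^ q →
          DynStream.Maintains A c n k δ (W * ⌈Real.logb 2 (n / δ)⌉₊)
            (C' * (n : ℝ) * Real.logb 2 (n / δ) ^ p')
            (C' * Real.sqrt n * Real.logb 2 (n / δ) ^ p')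
            (C' * Real.sqrt n * Real.logb 2 (n / δ) ^ p')) := by
  obtain ⟨C, hC⟩ := DynStream.exists_maintains c
  refine ⟨DynStream.sketchAlgorithm, 140 * (c + 1), C, 3, hC,
    fun a q => ⟨C * (⌈|a|⌉₊ + 1) ^ 2, 3 + 2 * q, fun n k δ hn hk hkn hδ hδ1 hka => ?_⟩⟩
  have hlog := (DynStream.logb_lt_logb_div hn hδ hδ1).le
  have hlogn := DynStream.one_le_logb hn
  have hab : a ≤ ⌈|a|⌉₊ + 1 := (le_abs_self a).trans ((Nat.le_ceil |a|).trans (by simp))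
  have hk' : (k : ℝ) ≤ (⌈|a|⌉₊ + 1) * √n * Real.logb 2 (n / δ) ^ q := hka.trans (by gcongr)
  have htime := DynStream.time_le_of_le_sqrt C.cast_nonneg (by simp) (hlogn.trans hlog) hk'
  have hspace := DynStream.space_le_of_le_sqrt C.cast_nonneg
    (zero_le_one.trans (hlogn.trans hlog)) n.cast_nonneg k.cast_nonneg hk'
  refine (hC n k δ hn hk hkn hδ hδ1).mono ?_ ?_ ?_ <;> push_cast
  exacts [hspace, htime, htime]
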